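/- Write $q=e^{2\pi i\tau}$, $\tau=u+iv$ with $v>0$, $\zeta_j=e^{2\pi i z_j}$, $z_j=x_j+iy_j$, $\operatorname{sgn}(0)=0$, $E(w)=2\int_0^w e^{-\pi t^2}\,dt$, and $\zeta\frac{\partial}{\partial\zeta}=\frac1{2\pi i}\frac{\partial}{\partial z}$ (Wirtinger derivative). Let $$F_2(\tau)=\tfrac12\Big(\sum_{a,b\ge0}-\sum_{a,b<0}\Big)(6a+2b+3)\,q^{3a^2+2ab+3a+b+2},$$ $$F_3(\tau)=\tfrac34\Big(\sum_{a,k\ge0}-\sum_{a,k<0}\Big)(-1)^k(2a+k+1)\,q^{3a^2+3ak+3a+\frac{k^2}2+\frac{3k}2+1}.$$ Define the Jacobi versions $$F_2(z_1,z_2;\tau)=\zeta_2^{3/2}\Big(\sum_{a,b\ge0}-\sum_{a,b<0}\Big)(-1)^a\zeta_1^a\zeta_2^b\,q^{\frac{3a(a+1)}2+ab}\quad(0<y_2<v),$$ $$F_3(z_1,z_2;\tau)=\Big(\sum_{a,b\ge0}-\sum_{a,b<0}\Big)\zeta_1^a\zeta_2^b\,q^{3a^2+\frac{b^2}2+3ab},$$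 where the first is continued meromorphically by $\zeta_2^{3/2}\sum_{a\in\mathbb Z}\frac{(-1)^a\zeta_1^aq^{3a(a+1)/2}}{1-\zeta_2q^a}$ to $z_2\notin\mathbb Z\tau+\mathbb Z$. For $s\ge1$ put $$\vartheta(z;\tau)=\sum_{n\in\frac12+\mathbb Z}e^{2\pi in(z+\frac12)}q^{\frac{n^2}2},$$ $$R_s(z;\tau)=\sum_{n\in\frac12+\mathbb Z}\Big(\operatorname{sgn}(n)-E\big(s(n+\tfrac yv)\sqrt{2v}\big)\Big)(-1)^{n-\frac12}q^{-\frac{n^2}2}e^{-2\pi inz},$$ $$\widehat F_{2,s}(z_1,z_2;\tau)=F_2(z_1,z_2;\tau)+\tfrac i2\sum_{k=0}^2\zeta_2^k\,\vartheta(z_1+k\tau;3\tau)\,R_s(3z_2-z_1-k\tau;3\tau),$$ $$\widehat F_{3,s}(z_1,z_2;\tau)=\tfrac12\sum_{a,b\in\mathbb Z}\Big(E\big(s\sqrt{6v}\,(a+\tfrac{3y_2-y_1}{3v})\big)+E\big(s\sqrt v\,(b+\tfrac{y_1-2y_2}{v})\big)\Big)\zeta_1^a\zeta_2^b\,q^{3a^2+\frac{b^2}2+3ab},$$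 $$\widehat F_{2,s}(\tau)=\tfrac{q^{1/2}}4\Big[\big(12\zeta_1\tfrac{\partial}{\partial\zeta_1}+4\zeta_2\tfrac{\partial}{\partial\zeta_2}\big)\widehat F_{2,s}(z_1,z_2;2\tau)\Big]_{z_1=\frac12,\ z_2=\tau},$$ $$\widehat F_{3,s}(\tau)=\tfrac{3q}4\Big[\big(2\zeta_1\tfrac{\partial}{\partial\zeta_1}+\zeta_2\tfrac{\partial}{\partial\zeta_2}+1\big)\widehat F_{3,s}(z_1,z_2;\tau)\Big]_{z_1=3\tau,\ z_2=\frac{3\tau}2+\frac12},$$ and $\widehat F_j:=\widehat F_{j,1}$ (so $R_1$ is Zwegers' $R$); the parameter $s$ serves to define holomorphic parts, since $E(sw)\to\operatorname{sgn}(w)$ as $s\to\infty$. **Lemma.** The functions $F_2$ and $F_3$ have modular completions. Precisely: 1. All the series above converge absolutely, the displayed continuation agrees with the series $F_2(z_1,z_2;\tau)$ for $0<y_2<v$ and is holomorphic in $(z_1,z_2)$ for $z_2\notin\mathbb Z\tau+\mathbb Z$, $F_3(z_1,z_2;\tau)$ is entire in $(z_1,z_2)$, and for $s\ge 1$ the functions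 $\widehat F_{2,s}(z_1,z_2;\tau)$ (for $z_2\notin\mathbb Z\tau+\mathbb Z$) and $\widehat F_{3,s}(z_1,z_2;\tau)$ are real-differentiable in $(z_1,z_2)$. 2. $F_2(\tau)$ and $F_3(\tau)$ are obtained from $F_2(z_1,z_2;\tau)$ and $F_3(z_1,z_2;\tau)$ by the same differential operators, specializations and prefactors by which $\widehat F_{2,s}(\tau)$ and $\widehat F_{3,s}(\tau)$ are obtained from $\widehat F_{2,s}(z_1,z_2;\tau)$ and $\widehat F_{3,s}(z_1,z_2;\tau)$. 3. For $\begin{pmatrix}a&b\\c&d\end{pmatrix}\in\mathrm{SL}_2(\mathbb Z)$, $n_1,n_2,m_1,m_2\in\mathbb Z$ and $z_2\notin\mathbb Z\tau+\mathbb Z$, $$\widehat F_2\Big(\tfrac{z_1}{c\tau+d},\tfrac{z_2}{c\tau+d};\tfrac{a\tau+b}{c\tau+d}\Big)=(c\tau+d)\,e^{\frac{\pi ic(-3z_2^2+2z_1z_2)}{c\tau+d}}\,\widehat F_2(z_1,z_2;\tau),$$ $$\widehat F_2(z_1+n_1\tau+m_1,z_2+n_2\tau+m_2;\tau)=(-1)^{n_2+m_2}\zeta_2^{3n_2-n_1}\zeta_1^{-n_2}q^{\frac{3n_2^2}2-n_1n_2}\,\widehat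 F_2(z_1,z_2;\tau).$$ 4. For all $z_1,z_2\in\mathbb C$ and $n_1,n_2,m_1,m_2\in\mathbb Z$, $$\widehat F_3(z_1+(6n_1+3n_2)\tau+m_1,z_2+(3n_1+n_2)\tau+m_2;\tau)=\zeta_1^{-n_1}\zeta_2^{-n_2}q^{-3n_1^2-3n_1n_2-\frac{n_2^2}2}\,\widehat F_3(z_1,z_2;\tau),$$ $$\widehat F_3(z_1,z_2;\tau+1)=\widehat F_3(z_1,z_2+\tfrac12;\tau),$$ $$\widehat F_3\Big(\tfrac{z_1}\tau,\tfrac{z_2}\tau;-\tfrac1\tau\Big)=\frac{\tau}{\sqrt3}\sum_{k=0}^2e^{\frac{2\pi i}{\tau}\left(-\frac{(z_1+k\tau)^2}6+(z_1+k\tau)z_2-z_2^2\right)}\widehat F_3(z_1+k\tau,z_2;\tau).$$ 5. The holomorphic parts are as expected: $\lim_{s\to\infty}\widehat F_{2,s}(z_1,z_2;\tau)=F_2(z_1,z_2;\tau)$ if $0<y_2<v$ and $\frac16<\frac{3y_2-y_1}{3v}<\frac12$; $\lim_{s\to\infty}\widehat F_{3,s}(z_1,z_2;\tau)=F_3(z_1,z_2;\tau)$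 if $0<\frac{3y_2-y_1}{3v}<1$ and $0<\frac{y_1-2y_2}v<1$; and, for all $\tau$ in the upper half-plane, $\lim_{s\to\infty}\widehat F_{2,s}(\tau)=F_2(\tau)$ and $\lim_{s\to\infty}\widehat F_{3,s}(\tau)=F_3(\tau)$. 6. $q^{-5/4}\widehat F_2(\tau)$ transforms like a modular form of weight $2$ on $\Gamma_0(4)$, and $q^{-1/4}\widehat F_3(\tau)$ like one of weight $2$ on $\Gamma_0(3)$, each with a multiplier that is a character of order dividing $4$; these characters are trivial on $\Gamma(4)$ and $\Gamma(12)$, respectively. -/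

import Mathlib

open scoped UpperHalfPlane MatrixGroups

namespace GWPotential

noncomputable section

/-- `e(x) = exp(2πix)`; in particular `q = e(τ)` and `ζ_j = e(z_j)`. -/
def e (x : ℂ) : ℂ := Complex.exp (2 * Real.pi * Complex.I * x)

/-- The error function `E(w) = 2 ∫_0^w exp(-πt²) dt`. -/
def E (w : ℝ) : ℝ := 2 * ∫ t in (0 : ℝ)..w, Real.exp (-Real.pi * t ^ 2)

/-- The coefficients of `∑_{a,b ≥ 0} - ∑_{a,b < 0}`, as a sum over `ℤ × ℤ`. -/
def orthantSign (p : ℤ × ℤ) : ℂ :=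
  if 0 ≤ p.1 ∧ 0 ≤ p.2 then 1 else if p.1 < 0 ∧ p.2 < 0 then -1 else 0

/-- The Wirtinger derivative `∂f/∂z = (∂f/∂x - i ∂f/∂y)/2`. -/
def wirtinger (f : ℂ → ℂ) (z : ℂ) : ℂ :=
  (fderiv ℝ f z 1 - Complex.I * fderiv ℝ f z Complex.I) / 2

/-- `ζ ∂/∂ζ = (2πi)⁻¹ ∂/∂z` for `ζ = e(z)`. -/
def zetaD (f : ℂ → ℂ) (z : ℂ) : ℂ := wirtinger f z / (2 * Real.pi * Complex.I)

/-! ### The two series -/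

/-- Summand of `F₂(τ)`. -/
def F2Term (τ : ℂ) (p : ℤ × ℤ) : ℂ :=
  orthantSign p * (6 * p.1 + 2 * p.2 + 3) *
    e ((3 * p.1 ^ 2 + 2 * p.1 * p.2 + 3 * p.1 + p.2 + 2) * τ)

/-- `F₂(τ) = ½ (∑_{a,b≥0} - ∑_{a,b<0}) (6a+2b+3) q^{3a²+2ab+3a+b+2}`. -/
def F2 (τ : ℂ) : ℂ := 1 / 2 * ∑' p : ℤ × ℤ, F2Term τ p

/-- Summand of `F₃(τ)`. -/
def F3Term (τ : ℂ) (p : ℤ × ℤ) : ℂ :=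
  orthantSign p * (-1) ^ p.2 * (2 * p.1 + p.2 + 1) *
    e ((3 * p.1 ^ 2 + 3 * p.1 * p.2 + 3 * p.1 + p.2 ^ 2 / 2 + 3 * p.2 / 2 + 1) * τ)

/-- `F₃(τ) = ¾ (∑_{a,k≥0} - ∑_{a,k<0}) (-1)^k (2a+k+1) q^{3a²+3ak+3a+k²/2+3k/2+1}`. -/
def F3 (τ : ℂ) : ℂ := 3 / 4 * ∑' p : ℤ × ℤ, F3Term τ p

/-! ### The Jacobi version of `F₂` and its completion -/

/-- Summand of the Jacobi version of `F₂` (without the factor `ζ₂^{3/2}`). -/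
def F2JTerm (z₁ z₂ τ : ℂ) (p : ℤ × ℤ) : ℂ :=
  orthantSign p * (-1) ^ p.1 *
    e (p.1 * z₁ + p.2 * z₂ + (3 * p.1 * (p.1 + 1) / 2 + p.1 * p.2) * τ)

/-- `F₂(z₁,z₂;τ) = ζ₂^{3/2} (∑_{a,b≥0} - ∑_{a,b<0}) (-1)^a ζ₁^a ζ₂^b q^{3a(a+1)/2+ab}`,
a series that converges for `0 < Im z₂ < Im τ`. -/
def F2J (z₁ z₂ τ : ℂ) : ℂ := e (3 * z₂ / 2) * ∑' p : ℤ × ℤ, F2JTerm z₁ z₂ τ p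

/-- Summand of the meromorphic continuation of `F₂(z₁,z₂;τ)`: the geometric series in `b` summed. -/
def F2MerTerm (z₁ z₂ τ : ℂ) (a : ℤ) : ℂ :=
  (-1) ^ a * e (a * z₁ + 3 * a * (a + 1) / 2 * τ) / (1 - e (z₂ + a * τ))

/-- The meromorphic continuation of `F₂(z₁,z₂;τ)` to all `z₂ ∉ ℤτ + ℤ`. -/
def F2Mer (z₁ z₂ τ : ℂ) : ℂ := e (3 * z₂ / 2) * ∑' a : ℤ, F2MerTerm z₁ z₂ τ a

/-- Summand of `ϑ`; the summation index of the series is `n + 1/2` with `n : ℤ`. -/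
def thetaTerm (z τ : ℂ) (n : ℤ) : ℂ :=
  e ((n + 1 / 2) * (z + 1 / 2) + (n + 1 / 2) ^ 2 / 2 * τ)

/-- `ϑ(z;τ) = ∑_{n ∈ 1/2+ℤ} e^{2πin(z+1/2)} q^{n²/2}`. -/
def theta (z τ : ℂ) : ℂ := ∑' n : ℤ, thetaTerm z τ n

/-- Summand of `R`, with `E(w)` replaced by `E(s w)`;
the summation index of the series is `n + 1/2` with `n : ℤ`. -/
def RTerm (s : ℝ) (z τ : ℂ) (n : ℤ) : ℂ :=
  ((Real.sign ((n : ℝ) + 1 / 2)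
      - E (s * (((n : ℝ) + 1 / 2 + z.im / τ.im) * Real.sqrt (2 * τ.im))) : ℝ) : ℂ) *
    (-1) ^ n * e (-((n + 1 / 2) ^ 2 / 2 * τ) - (n + 1 / 2) * z)

/-- Zwegers' `R(z;τ) = ∑_{n ∈ 1/2+ℤ} (sgn n - E((n+y/v)√(2v))) (-1)^{n-1/2} q^{-n²/2} e^{-2πinz}`
for `s = 1`. The scale `s` only serves to take holomorphic parts: as `s → ∞`, every `E(s w)` tends
to `sgn w`. -/
def R (s : ℝ) (z τ : ℂ) : ℂ := ∑' n : ℤ, RTerm s z τ n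

/-- For `s = 1`, the completion
`F̂₂(z₁,z₂;τ) = F₂(z₁,z₂;τ) + (i/2) ∑_{k=0}^{2} ζ₂^k ϑ(z₁+kτ;3τ) R(3z₂-z₁-kτ;3τ)`. -/
def F2hatJ (s : ℝ) (z₁ z₂ τ : ℂ) : ℂ :=
  F2Mer z₁ z₂ τ + Complex.I / 2 * ∑ k ∈ Finset.range 3,
    e (k * z₂) * theta (z₁ + k * τ) (3 * τ) * R s (3 * z₂ - z₁ - k * τ) (3 * τ)

/-- The operator `G ↦ (q^{1/2}/4) [(12 ζ₁∂/∂ζ₁ + 4 ζ₂∂/∂ζ₂) G]` taken at `ζ₁ = -1`, `ζ₂ = q` after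
`q ↦ q²` in `G`, that is, at `(z₁, z₂; τ) = (1/2, τ; 2τ)`. -/
def specialize2 (G : ℂ → ℂ → ℂ → ℂ) (τ : ℂ) : ℂ :=
  e (τ / 2) / 4 * (12 * zetaD (fun w => G w τ (2 * τ)) (1 / 2)
    + 4 * zetaD (fun w => G (1 / 2) w (2 * τ)) τ)

/-- The completion `F̂₂(τ)` of `F₂(τ)` (for `s = 1`). -/
def F2hat (s : ℝ) (τ : ℂ) : ℂ := specialize2 (F2hatJ s) τ

/-! ### The Jacobi version of `F₃` and its completion -/

/-- Summand of the Jacobi version of `F₃`. -/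
def F3JTerm (z₁ z₂ τ : ℂ) (p : ℤ × ℤ) : ℂ :=
  orthantSign p * e (p.1 * z₁ + p.2 * z₂ + (3 * p.1 ^ 2 + p.2 ^ 2 / 2 + 3 * p.1 * p.2) * τ)

/-- `F₃(z₁,z₂;τ) = (∑_{a,b≥0} - ∑_{a,b<0}) ζ₁^a ζ₂^b q^{3a²+b²/2+3ab}`. -/
def F3J (z₁ z₂ τ : ℂ) : ℂ := ∑' p : ℤ × ℤ, F3JTerm z₁ z₂ τ p

/-- Summand of the completion of the Jacobi version of `F₃`. With `A = (6, 3; 3, 1)`, the vector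
`(a + (3y₂-y₁)/(3v), b + (y₁-2y₂)/v)` is `n + A⁻¹y/v` for `n = (a, b)`, and the two arguments of
`E` (for `s = 1`) are its components, times `√v` and divided by the square root of minus one half
of the corresponding diagonal entry of `A⁻¹`. -/
def F3hatJTerm (s : ℝ) (z₁ z₂ τ : ℂ) (p : ℤ × ℤ) : ℂ :=
  ((E (s * (Real.sqrt (6 * τ.im) * (p.1 + (3 * z₂.im - z₁.im) / (3 * τ.im))))
      + E (s * (Real.sqrt τ.im * (p.2 + (z₁.im - 2 * z₂.im) / τ.im))) : ℝ) : ℂ) *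
    e (p.1 * z₁ + p.2 * z₂ + (3 * p.1 ^ 2 + p.2 ^ 2 / 2 + 3 * p.1 * p.2) * τ)

/-- For `s = 1`, the completion `F̂₃(z₁,z₂;τ)`, obtained from
`F₃(z₁,z₂;τ) = ½ ∑ (sgn(a+1/2) + sgn(b+1/2)) ζ₁^a ζ₂^b q^{3a²+b²/2+3ab}` on replacing the signs by
error functions. -/
def F3hatJ (s : ℝ) (z₁ z₂ τ : ℂ) : ℂ := 1 / 2 * ∑' p : ℤ × ℤ, F3hatJTerm s z₁ z₂ τ p

/-- The operator `G ↦ (3q/4) [(2 ζ₁∂/∂ζ₁ + ζ₂∂/∂ζ₂ + 1) G]` taken at `ζ₁ = q³`, `ζ₂ = -q^{3/2}`,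
that is, at `(z₁, z₂) = (3τ, 3τ/2 + 1/2)`. -/
def specialize3 (G : ℂ → ℂ → ℂ → ℂ) (τ : ℂ) : ℂ :=
  3 * e τ / 4 * (2 * zetaD (fun w => G w (3 * τ / 2 + 1 / 2) τ) (3 * τ)
    + zetaD (fun w => G (3 * τ) w τ) (3 * τ / 2 + 1 / 2)
    + G (3 * τ) (3 * τ / 2 + 1 / 2) τ)

/-- The completion `F̂₃(τ)` of `F₃(τ)` (for `s = 1`). -/
def F3hat (s : ℝ) (τ : ℂ) : ℂ := specialize3 (F3hatJ s) τ

/-- `z` is not in the lattice `ℤτ + ℤ`. -/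
def OffLattice (z τ : ℂ) : Prop := ∀ m n : ℤ, z ≠ m * τ + n

/-- `f` transforms like a modular form of weight `2` on `Γ₀(N)`, with a multiplier that is a
character of order dividing `4`, trivial on `Γ(M)`. -/
def TransformsWeightTwo (N M : ℕ) (f : ℂ → ℂ) : Prop :=
  ∃ χ : CongruenceSubgroup.Gamma0 N →* ℂˣ,
    (∀ γ, χ γ ^ 4 = 1) ∧
    (∀ γ : CongruenceSubgroup.Gamma0 N, (γ : SL(2, ℤ)) ∈ CongruenceSubgroup.Gamma M → χ γ = 1) ∧
    ∀ (γ : CongruenceSubgroup.Gamma0 N) (τ : ℍ),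
      f (((γ : SL(2, ℤ)) • τ : ℍ) : ℂ) =
        (χ γ : ℂ) * (((γ : SL(2, ℤ)) 1 0 : ℂ) * τ + ((γ : SL(2, ℤ)) 1 1 : ℂ)) ^ 2 * f τ

end

end GWPotential

/-! Both completions are a holomorphic function minus copies of one building block `NH`, a double
sum over the form Q(a,b) = C(b+ra)²/2 - Da²/2 of signature (1,1), in which sgn(a+1/2) - E(...)
supplies Gaussian decay in the negative direction. For F̂₃ this is the splitting of the two error
functions (`F3hatJ_eq`). For F̂₂ it is the product of theta and R, regrouped over three residue
classes (`F2hatJ_eq`).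

The modularity rests on one fact about `NH`. Its antiholomorphic derivative is a multiple of the
Gaussian sum `GS` (`hasWirt_NH`), and in `GS` the Gaussian turns τ into its conjugate on the
negative direction, so that the sum is an ordinary convergent theta series. Poisson summation
(`GS_neg_inv`) gives its inversion as a sum over the dual lattice, which has index CD in the present
cases: three cosets for F̂₃, one for F̂₂. Hence the two sides of each inversion formula have equal
antiholomorphic derivatives in one elliptic variable, and their difference is entire in that
variable. This difference is a section of a line bundle on the torus: of degree -2 for F̂₃
(`eq_zero_of_degree_neg`), of degree 0 and nontrivial for F̂₂ because z₂ is off the lattice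
(`eq_zero_of_degree_zero`). By Liouville it is zero. With the termwise behaviour under τ ↦ τ+1, this
gives the law of F̂₂ for all of SL₂(ℤ) (`jacobiLaw`).

Each differential operator is a Wirtinger derivative along a line through a torsion point, and the
completed Jacobi function vanishes there by oddness and ellipticity (`lineF2_zero`, `lineF3_zero`).
At a zero, the automorphy factor is not differentiated, so weight 1 becomes weight 2 without
correction terms. The multiplier on Γ₀(4) is read off from the law directly. On Γ₀(3) it is checked
on generators (`mem_of_mem_Gamma0_three`) against an explicit character `kappaThree`.

For the holomorphic parts, dominated convergence applies uniformly in s ≥ 1 (`norm_terms_le`). A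
block tends to 0 when its shift L lies in 0 < L < 1. On the wall L = 0 the column a = 0 survives,
but at the special points its weighted sum is odd under b ↦ -1-b. The differentiation is tangent to
those walls, so no Gaussian term appears there. The block of F̂₃ in the interior of its chamber does
have one, and it dies exponentially (`tendsto_mul_GS_zero`). -/

namespace GWPotential

open Filter Topology ComplexConjugate

/-! ### The exponential `e` -/

lemma e_add (x y : ℂ) : e (x + y) = e x * e y := by
  simp only [e, mul_add, Complex.exp_add]

lemma e_zero : e 0 = 1 := by simp [e]

lemma e_ne_zero (x : ℂ) : e x ≠ 0 := Complex.exp_ne_zero _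

lemma e_neg (x : ℂ) : e (-x) = (e x)⁻¹ := by
  simp only [e, mul_neg, Complex.exp_neg]

lemma e_int (n : ℤ) : e n = 1 := by
  rw [e, Complex.exp_eq_one_iff]
  exact ⟨n, by ring⟩

lemma e_add_int (x : ℂ) (n : ℤ) : e (x + n) = e x := by
  rw [e_add, e_int, mul_one]

lemma e_eq_of_sub_eq_int {x y : ℂ} (n : ℤ) (h : x = y + n) : e x = e y := by
  rw [h, e_add_int]

lemma e_half : e (1 / 2) = -1 := by
  rw [e, show (2 * Real.pi * Complex.I * (1 / 2) : ℂ) = Real.pi * Complex.I by ring,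
    Complex.exp_pi_mul_I]

lemma e_int_mul (n : ℤ) (x : ℂ) : e (n * x) = e x ^ n := by
  rw [e, e, ← Complex.exp_int_mul]
  congr 1; ring

lemma e_int_half (n : ℤ) : e (n / 2) = (-1) ^ n := by
  rw [← e_half, ← e_int_mul]; congr 1; ring

lemma e_eq_one_iff {x : ℂ} : e x = 1 ↔ ∃ n : ℤ, x = n := by
  constructor
  · intro h
    obtain ⟨n, hn⟩ := Complex.exp_eq_one_iff.1 h
    refine ⟨n, mul_left_cancel₀ Complex.two_pi_I_ne_zero ?_⟩
    rw [hn]; ring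
  · rintro ⟨n, rfl⟩; exact e_int n

lemma norm_e (x : ℂ) : ‖e x‖ = Real.exp (-(2 * Real.pi * x.im)) := by
  rw [e, Complex.norm_exp]
  congr 1
  simp

lemma hasDerivAt_e (x : ℂ) : HasDerivAt e (2 * Real.pi * Complex.I * e x) x := by
  have h : HasDerivAt (fun x : ℂ => 2 * Real.pi * Complex.I * x) (2 * Real.pi * Complex.I) x := by
    simpa using (hasDerivAt_id x).const_mul (2 * Real.pi * Complex.I : ℂ)
  exact h.cexp.congr_deriv (mul_comm _ _)

lemma differentiable_e : Differentiable ℂ e := fun x => (hasDerivAt_e x).differentiableAt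

lemma continuous_e : Continuous e := differentiable_e.continuous

/-! ### The error function -/

lemma continuous_gauss : Continuous fun t : ℝ => Real.exp (-Real.pi * t ^ 2) := by fun_prop

lemma integrable_gauss : MeasureTheory.Integrable fun t : ℝ => Real.exp (-Real.pi * t ^ 2) :=
  integrable_exp_neg_mul_sq Real.pi_pos

lemma E_zero : E 0 = 0 := by simp [E]

lemma E_neg (w : ℝ) : E (-w) = -E w := by
  have h := intervalIntegral.integral_comp_neg (f := fun t : ℝ => Real.exp (-Real.pi * t ^ 2))
    (a := 0) (b := w)
  simp only [neg_sq, neg_zero] at h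
  rw [E, E, h, intervalIntegral.integral_symm]
  ring

lemma hasDerivAt_E (w : ℝ) : HasDerivAt E (2 * Real.exp (-Real.pi * w ^ 2)) w := by
  have := intervalIntegral.integral_hasDerivAt_right
    (continuous_gauss.intervalIntegrable 0 w)
    (continuous_gauss.stronglyMeasurableAtFilter _ _) continuous_gauss.continuousAt
  exact this.const_mul 2

lemma one_sub_E_eq (w : ℝ) :
    1 - E w = 2 * ∫ t in Set.Ioi w, Real.exp (-Real.pi * t ^ 2) := by
  have h1 := intervalIntegral.integral_Ioi_sub_Ioi' (a := 0) (b := w)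
    (f := fun t : ℝ => Real.exp (-Real.pi * t ^ 2)) integrable_gauss.integrableOn
    integrable_gauss.integrableOn
  have h2 := integral_gaussian_Ioi Real.pi
  rw [div_self Real.pi_ne_zero, Real.sqrt_one] at h2
  rw [E, ← h1, h2]
  ring

lemma one_sub_E_nonneg (w : ℝ) : 0 ≤ 1 - E w := by
  rw [one_sub_E_eq]
  exact mul_nonneg zero_le_two (MeasureTheory.integral_nonneg fun t => (Real.exp_pos _).le)

/-- After the substitution t ↦ t + w, the inequality (t+w)² ≥ t² + w² for t, w ≥ 0 leaves half a
Gaussian integral, which the factor 2 turns into 1. -/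
lemma one_sub_E_le {w : ℝ} (hw : 0 ≤ w) : 1 - E w ≤ Real.exp (-Real.pi * w ^ 2) := by
  have h1 : ∫ t in Set.Ioi w, Real.exp (-Real.pi * t ^ 2)
      = ∫ t in Set.Ioi (0 : ℝ), Real.exp (-Real.pi * (t + w) ^ 2) := by
    rw [← MeasureTheory.integral_indicator measurableSet_Ioi,
      ← MeasureTheory.integral_indicator measurableSet_Ioi,
      ← MeasureTheory.integral_add_right_eq_self _ w]
    congr 1
    ext t
    simp [Set.indicator_apply]
  have h2 : ∫ t in Set.Ioi (0 : ℝ), Real.exp (-Real.pi * (t + w) ^ 2)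
      ≤ ∫ t in Set.Ioi (0 : ℝ), Real.exp (-Real.pi * w ^ 2) * Real.exp (-Real.pi * t ^ 2) := by
    refine MeasureTheory.setIntegral_mono_on ?_ ?_ measurableSet_Ioi ?_
    · exact (integrable_gauss.comp_add_right w).integrableOn
    · exact (integrable_gauss.const_mul _).integrableOn
    · intro t ht
      rw [← Real.exp_add]
      apply Real.exp_le_exp.2
      have : 0 ≤ Real.pi * (t * w) := mul_nonneg Real.pi_pos.le (mul_nonneg (le_of_lt ht) hw)
      nlinarith
  have h3 := integral_gaussian_Ioi Real.pi
  rw [div_self Real.pi_ne_zero, Real.sqrt_one] at h3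
  rw [MeasureTheory.integral_const_mul, h3] at h2
  rw [one_sub_E_eq, h1]
  linarith

lemma abs_sign_sub_E_le (w : ℝ) : |Real.sign w - E w| ≤ Real.exp (-Real.pi * w ^ 2) := by
  rcases lt_trichotomy w 0 with h | h | h
  · have h0 : 0 ≤ -w := by linarith
    have h1 := one_sub_E_nonneg (-w)
    have h2 := one_sub_E_le h0
    rw [E_neg] at h1 h2
    rw [neg_sq] at h2
    rw [Real.sign_of_neg h, abs_le]
    constructor <;> linarith
  · subst h; simp [E_zero]
  · rw [Real.sign_of_pos h, abs_of_nonneg (one_sub_E_nonneg w)]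
    exact one_sub_E_le h.le

lemma abs_E_le (w : ℝ) : |E w| ≤ 1 := by
  have h1 := one_sub_E_nonneg w
  have h2 := one_sub_E_nonneg (-w)
  rw [E_neg] at h2
  rw [abs_le]; constructor <;> linarith

lemma real_sign_mul_of_pos {s : ℝ} (hs : 0 < s) (w : ℝ) : Real.sign (s * w) = Real.sign w := by
  rcases lt_trichotomy w 0 with h | h | h
  · rw [Real.sign_of_neg h, Real.sign_of_neg (mul_neg_of_pos_of_neg hs h)]
  · simp [h]
  · rw [Real.sign_of_pos h, Real.sign_of_pos (mul_pos hs h)]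

lemma tendsto_E_mul (w : ℝ) : Tendsto (fun s : ℝ => E (s * w)) atTop (𝓝 (Real.sign w)) := by
  rcases eq_or_ne w 0 with rfl | hw
  · simp [E_zero]
  rw [tendsto_iff_norm_sub_tendsto_zero]
  have h1 : Tendsto (fun s : ℝ => Real.exp (-(Real.pi * w ^ 2 * s ^ 2))) atTop (𝓝 0) := by
    refine Real.tendsto_exp_neg_atTop_nhds_zero.comp ?_
    exact Tendsto.const_mul_atTop (by positivity) (tendsto_pow_atTop two_ne_zero)
  refine squeeze_zero' (Eventually.of_forall fun s => norm_nonneg _) ?_ h1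
  filter_upwards [eventually_gt_atTop 0] with s hs
  rw [Real.norm_eq_abs, abs_sub_comm]
  refine (real_sign_mul_of_pos hs w ▸ abs_sign_sub_E_le (s * w)).trans (le_of_eq ?_)
  congr 1; ring

/-! ### The sign of a half-integer -/

/-- The sign of `a + 1/2`. -/
noncomputable def sg (a : ℤ) : ℝ := Real.sign (a + 1 / 2)

lemma sg_of_nonneg {a : ℤ} (h : 0 ≤ a) : sg a = 1 := by
  have : (0 : ℝ) ≤ a := by exact_mod_cast h
  exact Real.sign_of_pos (by linarith)

lemma sg_of_neg {a : ℤ} (h : a < 0) : sg a = -1 := by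
  have : (a : ℝ) ≤ -1 := by exact_mod_cast (by omega : a ≤ -1)
  exact Real.sign_of_neg (by linarith)

lemma abs_sg (a : ℤ) : |sg a| = 1 := by
  rcases le_or_gt 0 a with h | h
  · simp [sg_of_nonneg h]
  · simp [sg_of_neg h]

lemma orthantSign_eq (p : ℤ × ℤ) : orthantSign p = ((sg p.1 + sg p.2) / 2 : ℝ) := by
  unfold orthantSign
  rcases le_or_gt 0 p.1 with h1 | h1 <;> rcases le_or_gt 0 p.2 with h2 | h2 <;>
    simp [h1, h2, sg_of_nonneg, sg_of_neg, not_le.2, not_lt.2]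

/-- Replacing the sign of a half-integer by an error function costs at most a Gaussian. -/
lemma abs_sg_sub_E_le {κ L M s : ℝ} (hκ : 0 < κ) (hs : 1 ≤ s) (hL : |L| ≤ M) (a : ℤ) :
    |sg a - E (s * (κ * (a + L)))| ≤
      2 * Real.exp (Real.pi * κ ^ 2 * (M + 1) ^ 2) * Real.exp (-(Real.pi * κ ^ 2 * (a + L) ^ 2)) := by
  have hM : 0 ≤ M := (abs_nonneg L).trans hL
  have hc : 1 ≤ Real.exp (Real.pi * κ ^ 2 * (M + 1) ^ 2) := Real.one_le_exp (by positivity)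
  -- When the signs agree, the plain Gaussian estimate applies. They can disagree only for |a + L| ≤
  -- M + 1, where the trivial bound 2 is enough because the constant exp(πκ²(M+1)²) outweighs the
  -- Gaussian.
  by_cases h : sg a = Real.sign (κ * (a + L))
  · rw [h, ← real_sign_mul_of_pos (by linarith : 0 < s)]
    refine (abs_sign_sub_E_le _).trans ?_
    have h1 : Real.exp (-Real.pi * (s * (κ * (a + L))) ^ 2) ≤
        Real.exp (-(Real.pi * κ ^ 2 * (a + L) ^ 2)) := by
      apply Real.exp_le_exp.2
      have h2 : 1 ≤ s ^ 2 := one_le_pow₀ hs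
      have h3 : 0 ≤ Real.pi * κ ^ 2 * (a + L) ^ 2 := by positivity
      nlinarith
    refine h1.trans (le_mul_of_one_le_left (Real.exp_pos _).le (by linarith))
  · have h1 : |sg a - E (s * (κ * (a + L)))| ≤ 2 := by
      refine (abs_sub _ _).trans ?_
      rw [abs_sg]
      linarith [abs_E_le (s * (κ * (a + L)))]
    refine h1.trans ?_
    have h2 : |a + L| ≤ M + 1 := by
      have hL' := abs_le.1 hL
      rcases le_or_gt 0 a with h0 | h0
      · have h0' : (0 : ℝ) ≤ a := by exact_mod_cast h0
        have : a + L ≤ 0 := by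
          by_contra! h3
          exact h (by rw [sg_of_nonneg h0, Real.sign_of_pos (mul_pos hκ h3)])
        rw [abs_le]; constructor <;> linarith
      · have h0' : (a : ℝ) ≤ -1 := by exact_mod_cast (by omega : a ≤ -1)
        have : 0 ≤ a + L := by
          by_contra! h3
          exact h (by rw [sg_of_neg h0, Real.sign_of_neg (mul_neg_of_pos_of_neg hκ h3)])
        rw [abs_le]; constructor <;> linarith
    rw [mul_assoc, ← Real.exp_add]
    refine le_mul_of_one_le_right zero_le_two (Real.one_le_exp ?_)
    have h3 : (a + L) ^ 2 ≤ (M + 1) ^ 2 := by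
      rw [← sq_abs]; exact pow_le_pow_left₀ (abs_nonneg _) h2 2
    have h4 : 0 ≤ Real.pi * κ ^ 2 := by positivity
    nlinarith

/-! ### A summable majorant -/

/-- `exp(K(|a|+|b|) - δ(a²+b²))`, the majorant of all double series. -/
noncomputable def majorant (K δ : ℝ) (p : ℤ × ℤ) : ℝ :=
  Real.exp (K * (|(p.1 : ℝ)| + |(p.2 : ℝ)|) - δ * ((p.1 : ℝ) ^ 2 + (p.2 : ℝ) ^ 2))

lemma summable_exp_neg_abs : Summable fun n : ℤ => Real.exp (-|(n : ℝ)|) := by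
  refine Summable.of_nat_of_neg ?_ ?_ <;> simpa using Real.summable_exp_neg_nat

lemma summable_exp_abs_sub_sq (K : ℝ) {δ : ℝ} (hδ : 0 < δ) :
    Summable fun n : ℤ => Real.exp (K * |(n : ℝ)| - δ * (n : ℝ) ^ 2) := by
  refine Summable.of_nonneg_of_le (fun n => (Real.exp_pos _).le) (fun n => ?_)
    (summable_exp_neg_abs.mul_left (Real.exp ((K + 1) ^ 2 / (4 * δ))))
  rw [← Real.exp_add]
  apply Real.exp_le_exp.2
  rw [← sq_abs (n : ℝ)]
  -- Completing the square produces the constant (K+1)²/(4δ); the extra 1 in K + 1 leaves exp(-|n|)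
  -- to sum.
  have h : (K + 1) ^ 2 / (4 * δ) - (K + 1) * |(n : ℝ)| + δ * |(n : ℝ)| ^ 2
      = (2 * δ * |(n : ℝ)| - (K + 1)) ^ 2 / (4 * δ) := by field_simp; ring
  have : 0 ≤ (2 * δ * |(n : ℝ)| - (K + 1)) ^ 2 / (4 * δ) := by positivity
  linarith

lemma summable_majorant (K : ℝ) {δ : ℝ} (hδ : 0 < δ) : Summable (majorant K δ) := by
  have h := summable_exp_abs_sub_sq K hδ
  refine (h.mul_of_nonneg h (fun n => (Real.exp_pos _).le) fun n => (Real.exp_pos _).le).congr ?_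
  intro p
  rw [majorant, ← Real.exp_add]
  congr 1; ring

lemma abs_fst_mul_majorant_le (K δ : ℝ) (p : ℤ × ℤ) :
    |(p.1 : ℝ)| * majorant K δ p ≤ majorant (K + 1) δ p := by
  have h1 : |(p.1 : ℝ)| ≤ Real.exp (|(p.1 : ℝ)| + |(p.2 : ℝ)|) := by
    have := Real.add_one_le_exp (|(p.1 : ℝ)| + |(p.2 : ℝ)|)
    linarith [abs_nonneg (p.2 : ℝ)]
  refine (mul_le_mul_of_nonneg_right h1 (Real.exp_pos _).le).trans (le_of_eq ?_)
  rw [majorant, ← Real.exp_add]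
  congr 1; ring

lemma majorant_swap (K δ : ℝ) (p : ℤ × ℤ) : majorant K δ p.swap = majorant K δ p := by
  simp only [majorant, Prod.fst_swap, Prod.snd_swap]
  congr 1; ring

lemma abs_snd_mul_majorant_le (K δ : ℝ) (p : ℤ × ℤ) :
    |(p.2 : ℝ)| * majorant K δ p ≤ majorant (K + 1) δ p := by
  rw [← majorant_swap K, ← majorant_swap (K + 1)]
  exact abs_fst_mul_majorant_le K δ p.swap

lemma majorant_nonneg (K δ : ℝ) (p : ℤ × ℤ) : 0 ≤ majorant K δ p := (Real.exp_pos _).le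

/-! ### The non-holomorphic building block -/

/-- The quadratic form `C(b + ra)²/2 - Da²/2`, of signature `(1,1)` for `C, D > 0`. -/
noncomputable def qf (D C r a b : ℝ) : ℝ := C * (b + r * a) ^ 2 / 2 - D * a ^ 2 / 2

/-- The linear form `(r Im x₂ - Im x₁) / (Dv)`. -/
noncomputable def shiftL (D r v : ℝ) : ℂ × ℂ →L[ℝ] ℝ :=
  (1 / (D * v)) • (r • (Complex.imCLM.comp (ContinuousLinearMap.snd ℝ ℂ ℂ))
    - Complex.imCLM.comp (ContinuousLinearMap.fst ℝ ℂ ℂ))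

lemma shiftL_apply (D r v : ℝ) (x : ℂ × ℂ) : shiftL D r v x = (r * x.2.im - x.1.im) / (D * v) := by
  simp [shiftL]; ring

/-- The exponential `e(a x₁ + b x₂ + Q(a,b) τ)`. -/
noncomputable def eTerm (D C r : ℝ) (τ : ℂ) (x : ℂ × ℂ) (p : ℤ × ℤ) : ℂ :=
  e (p.1 * x.1 + p.2 * x.2 + (qf D C r p.1 p.2 : ℝ) * τ)

/-- The normalised argument of the error function. -/
noncomputable def errArg (D r : ℝ) (τ : ℂ) (x : ℂ × ℂ) (a : ℤ) : ℝ :=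
  Real.sqrt (2 * D * τ.im) * (a + shiftL D r τ.im x)

/-- Summand of the non-holomorphic building block. -/
noncomputable def nhTerm (s D C r : ℝ) (τ : ℂ) (x : ℂ × ℂ) (p : ℤ × ℤ) : ℂ :=
  ((sg p.1 - E (s * errArg D r τ x p.1) : ℝ) : ℂ) * eTerm D C r τ x p

/-- Summand of the non-holomorphic part of the derivative of the building block. -/
noncomputable def gTerm (s D C r : ℝ) (τ : ℂ) (x : ℂ × ℂ) (p : ℤ × ℤ) : ℂ :=
  ((Real.exp (-Real.pi * (s * errArg D r τ x p.1) ^ 2) : ℝ) : ℂ) * eTerm D C r τ x p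

/-- `∑ (sgn(a+1/2) - E(s√(2Dv)(a + (r Im x₂ - Im x₁)/(Dv)))) e(a x₁ + b x₂ + Q(a,b) τ)`. -/
noncomputable def NH (s D C r : ℝ) (τ : ℂ) (x : ℂ × ℂ) : ℂ := ∑' p, nhTerm s D C r τ x p

/-- The sum of the Gaussians `gTerm`. -/
noncomputable def GS (s D C r : ℝ) (τ : ℂ) (x : ℂ × ℂ) : ℂ := ∑' p, gTerm s D C r τ x p

/-- The form with its negative direction reversed dominates a multiple of the Euclidean one. The
constant comes from a² + b² ≤ (1+2r²)a² + 2(b+ra)², comparing the coefficients with D and C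
separately. -/
lemma posDef_bound {D C : ℝ} (hD : 0 < D) (hC : 0 < C) (r : ℝ) :
    ∃ δ : ℝ, 0 < δ ∧ ∀ a b : ℝ, δ * (a ^ 2 + b ^ 2) ≤ D * a ^ 2 + C * (b + r * a) ^ 2 := by
  have h0 : 0 < (1 + 2 * r ^ 2) / D + 2 / C := by positivity
  refine ⟨((1 + 2 * r ^ 2) / D + 2 / C)⁻¹, inv_pos.2 h0, fun a b => ?_⟩
  rw [inv_mul_le_iff₀ h0]
  have h1 : a ^ 2 + b ^ 2 ≤ (1 + 2 * r ^ 2) * a ^ 2 + 2 * (b + r * a) ^ 2 := by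
    nlinarith [sq_nonneg (b + 2 * r * a)]
  have h2 : ((1 + 2 * r ^ 2) / D + 2 / C) * (D * a ^ 2 + C * (b + r * a) ^ 2)
      = (1 + 2 * r ^ 2) * a ^ 2 + 2 * (b + r * a) ^ 2
        + ((1 + 2 * r ^ 2) * C / D * (b + r * a) ^ 2 + 2 * D / C * a ^ 2) := by
    field_simp; ring
  have h3 : 0 ≤ (1 + 2 * r ^ 2) * C / D * (b + r * a) ^ 2 + 2 * D / C * a ^ 2 := by positivity
  linarith

lemma abs_shiftL_le {D v : ℝ} (hD : 0 < D) (hv : 0 < v) (r : ℝ) {M : ℝ} {x : ℂ × ℂ}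
    (hx : ‖x‖ ≤ M) : |shiftL D r v x| ≤ (|r| + 1) * M / (D * v) := by
  have h1 : |x.1.im| ≤ M := (Complex.abs_im_le_norm _).trans ((norm_fst_le x).trans hx)
  have h2 : |x.2.im| ≤ M := (Complex.abs_im_le_norm _).trans ((norm_snd_le x).trans hx)
  rw [shiftL_apply, abs_div, abs_of_pos (mul_pos hD hv)]
  gcongr
  refine (abs_sub _ _).trans ?_
  rw [abs_mul]
  nlinarith [mul_le_mul_of_nonneg_left h2 (abs_nonneg r)]

lemma sq_errArg {D : ℝ} {τ : ℂ} (hD : 0 < D) (hτ : 0 < τ.im) (r : ℝ) (x : ℂ × ℂ) (a : ℤ) :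
    errArg D r τ x a ^ 2 = 2 * D * τ.im * (a + shiftL D r τ.im x) ^ 2 := by
  rw [errArg, mul_pow, Real.sq_sqrt (by positivity)]

/-- The Gaussian contributes -2πDv(a+L)², and the indefinite exponential grows only like +πDva². The
total is -πv(Da² + C(b+ra)²) up to linear terms, hence negative definite. This is the source of
every convergence statement about the building block. -/
lemma norm_gauss_mul_eTerm_le {D C : ℝ} (hD : 0 < D) (hC : 0 < C) (r : ℝ) {τ : ℂ} (hτ : 0 < τ.im)
    (M : ℝ) : ∃ K δ : ℝ, 0 < δ ∧ ∀ (x : ℂ × ℂ), ‖x‖ ≤ M → ∀ p : ℤ × ℤ,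
      Real.exp (-(Real.pi * errArg D r τ x p.1 ^ 2)) * ‖eTerm D C r τ x p‖ ≤ majorant K δ p := by
  obtain ⟨δ, hδ, h⟩ := posDef_bound hD hC r
  set v := τ.im with hv
  set B := (|r| + 1) * M / (D * v) with hB
  refine ⟨4 * Real.pi * D * v * B + 2 * Real.pi * M, Real.pi * v * δ, by positivity, ?_⟩
  intro x hx p
  rw [eTerm, norm_e, ← Real.exp_add, sq_errArg hD hτ, majorant]
  apply Real.exp_le_exp.2
  have hL := abs_shiftL_le hD hτ r hx
  rw [← hB] at hL
  have h1 : |x.1.im| ≤ M := (Complex.abs_im_le_norm _).trans ((norm_fst_le x).trans hx)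
  have h2 : |x.2.im| ≤ M := (Complex.abs_im_le_norm _).trans ((norm_snd_le x).trans hx)
  have hB0 : 0 ≤ B := (abs_nonneg _).trans hL
  have hM0 : 0 ≤ M := (abs_nonneg _).trans h1
  set L := shiftL D r τ.im x
  set a : ℝ := (p.1 : ℝ)
  set b : ℝ := (p.2 : ℝ)
  have him : ((p.1 : ℂ) * x.1 + p.2 * x.2 + (qf D C r a b : ℝ) * τ).im
      = a * x.1.im + b * x.2.im + qf D C r a b * v := by
    simp [a, b, v]
  rw [him, qf]
  have e1 : -(a * L) ≤ |a| * B := by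
    refine (neg_le_abs _).trans ?_
    rw [abs_mul]; gcongr
  have e2 : -(a * x.1.im) ≤ |a| * M := by
    refine (neg_le_abs _).trans ?_
    rw [abs_mul]; gcongr
  have e3 : -(b * x.2.im) ≤ |b| * M := by
    refine (neg_le_abs _).trans ?_
    rw [abs_mul]; gcongr
  have e4 : Real.pi * v * (δ * (a ^ 2 + b ^ 2))
      ≤ Real.pi * v * (D * a ^ 2 + C * (b + r * a) ^ 2) := by
    gcongr; exact h a b
  have e5 := mul_le_mul_of_nonneg_left e1 (by positivity : 0 ≤ 4 * Real.pi * D * v)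
  have e6 := mul_le_mul_of_nonneg_left (add_le_add e2 e3) (by positivity : 0 ≤ 2 * Real.pi)
  have e7 : 0 ≤ 2 * Real.pi * D * v * L ^ 2 := by positivity
  have e8 : 0 ≤ 4 * Real.pi * D * v * (B * |b|) := by positivity
  nlinarith

lemma gauss_scale_le {s : ℝ} (hs : 1 ≤ s) (w : ℝ) :
    Real.exp (-Real.pi * (s * w) ^ 2) ≤ Real.exp (-(Real.pi * w ^ 2)) := by
  apply Real.exp_le_exp.2
  have h2 : 1 ≤ s ^ 2 := one_le_pow₀ hs
  have h3 : 0 ≤ Real.pi * w ^ 2 := by positivity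
  nlinarith

/-- A bound for the summands, uniform in `s ≥ 1` and locally uniform in `x`. -/
lemma norm_terms_le {D C : ℝ} (hD : 0 < D) (hC : 0 < C) (r : ℝ) {τ : ℂ} (hτ : 0 < τ.im)
    (M : ℝ) : ∃ c K δ : ℝ, 0 < c ∧ 0 < δ ∧ ∀ s : ℝ, 1 ≤ s → ∀ x : ℂ × ℂ, ‖x‖ ≤ M → ∀ p : ℤ × ℤ,
      ‖nhTerm s D C r τ x p‖ ≤ c * majorant K δ p ∧
      ‖gTerm s D C r τ x p‖ ≤ c * majorant K δ p := by
  obtain ⟨K, δ, hδ, h⟩ := norm_gauss_mul_eTerm_le hD hC r hτ M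
  set κ := Real.sqrt (2 * D * τ.im) with hκ
  have hκ0 : 0 < κ := Real.sqrt_pos.2 (by positivity)
  set B := (|r| + 1) * M / (D * τ.im) with hB
  set c := 2 * Real.exp (Real.pi * κ ^ 2 * (B + 1) ^ 2) with hc
  have hc1 : 1 ≤ c := by
    have := Real.one_le_exp (by positivity : 0 ≤ Real.pi * κ ^ 2 * (B + 1) ^ 2)
    linarith
  refine ⟨c, K, δ, by linarith, hδ, fun s hs x hx p => ⟨?_, ?_⟩⟩
  · rw [nhTerm, norm_mul, Complex.norm_real, Real.norm_eq_abs]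
    have h1 := abs_sg_sub_E_le hκ0 hs (abs_shiftL_le hD hτ r hx) p.1
    rw [← hB, ← hc, show Real.pi * κ ^ 2 * (p.1 + shiftL D r τ.im x) ^ 2
      = Real.pi * errArg D r τ x p.1 ^ 2 by rw [errArg, ← hκ]; ring] at h1
    calc _ ≤ (c * Real.exp (-(Real.pi * errArg D r τ x p.1 ^ 2))) * ‖eTerm D C r τ x p‖ := by
          gcongr; exact h1
      _ ≤ _ := by rw [mul_assoc]; gcongr; exact h x hx p
  · rw [gTerm, norm_mul, Complex.norm_real, Real.norm_eq_abs, abs_of_pos (Real.exp_pos _)]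
    have h1 := gauss_scale_le hs (errArg D r τ x p.1)
    calc _ ≤ Real.exp (-(Real.pi * errArg D r τ x p.1 ^ 2)) * ‖eTerm D C r τ x p‖ := by gcongr
      _ ≤ majorant K δ p := h x hx p
      _ ≤ _ := le_mul_of_one_le_left (majorant_nonneg _ _ _) hc1

lemma one_add_abs_le (p : ℤ × ℤ) :
    1 + |(p.1 : ℝ)| + |(p.2 : ℝ)| ≤ Real.exp (|(p.1 : ℝ)| + |(p.2 : ℝ)|) := by
  have := Real.add_one_le_exp (|(p.1 : ℝ)| + |(p.2 : ℝ)|)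
  linarith

lemma weight_mul_majorant_le {w : ℂ} {c₀ : ℝ} (hc₀ : 0 ≤ c₀) (p : ℤ × ℤ)
    (hw : ‖w‖ ≤ c₀ * (1 + |(p.1 : ℝ)| + |(p.2 : ℝ)|)) (K δ : ℝ) :
    ‖w‖ * majorant K δ p ≤ c₀ * majorant (K + 1) δ p := by
  have h : majorant (K + 1) δ p = Real.exp (|(p.1 : ℝ)| + |(p.2 : ℝ)|) * majorant K δ p := by
    rw [majorant, majorant, ← Real.exp_add]; congr 1; ring
  rw [h, ← mul_assoc]
  have := mul_le_mul_of_nonneg_left (one_add_abs_le p) hc₀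
  exact mul_le_mul_of_nonneg_right (hw.trans this) (majorant_nonneg _ _ _)

lemma summable_weight_nhTerm {s D C : ℝ} (hs : 1 ≤ s) (hD : 0 < D) (hC : 0 < C) (r : ℝ) {τ : ℂ}
    (hτ : 0 < τ.im) (x : ℂ × ℂ) {w : ℤ × ℤ → ℂ} {c₀ : ℝ} (hc₀ : 0 ≤ c₀)
    (hw : ∀ p, ‖w p‖ ≤ c₀ * (1 + |(p.1 : ℝ)| + |(p.2 : ℝ)|)) :
    Summable fun p => w p * nhTerm s D C r τ x p := by
  obtain ⟨c, K, δ, hc, hδ, h⟩ := norm_terms_le hD hC r hτ ‖x‖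
  refine Summable.of_norm_bounded (g := fun p => c * (c₀ * majorant (K + 1) δ p))
    (((summable_majorant _ hδ).mul_left _).mul_left _) fun p => ?_
  rw [norm_mul]
  calc _ ≤ ‖w p‖ * (c * majorant K δ p) := by gcongr; exact (h s hs x le_rfl p).1
    _ = c * (‖w p‖ * majorant K δ p) := by ring
    _ ≤ _ := mul_le_mul_of_nonneg_left (weight_mul_majorant_le hc₀ p (hw p) K δ) hc.le

lemma summable_nhTerm {s D C : ℝ} (hs : 1 ≤ s) (hD : 0 < D) (hC : 0 < C) (r : ℝ) {τ : ℂ}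
    (hτ : 0 < τ.im) (x : ℂ × ℂ) : Summable (nhTerm s D C r τ x) := by
  obtain ⟨c, K, δ, hc, hδ, h⟩ := norm_terms_le hD hC r hτ ‖x‖
  exact Summable.of_norm_bounded ((summable_majorant K hδ).mul_left c)
    fun p => (h s hs x le_rfl p).1

lemma summable_gTerm {s D C : ℝ} (hs : 1 ≤ s) (hD : 0 < D) (hC : 0 < C) (r : ℝ) {τ : ℂ}
    (hτ : 0 < τ.im) (x : ℂ × ℂ) : Summable (gTerm s D C r τ x) := by
  obtain ⟨c, K, δ, hc, hδ, h⟩ := norm_terms_le hD hC r hτ ‖x‖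
  exact Summable.of_norm_bounded ((summable_majorant K hδ).mul_left c)
    fun p => (h s hs x le_rfl p).2

/-! ### Differentiability of the building block -/

lemma hasFDerivAt_eTerm (D C r : ℝ) (τ : ℂ) (p : ℤ × ℤ) (x : ℂ × ℂ) :
    HasFDerivAt (fun x => eTerm D C r τ x p)
      ((2 * Real.pi * Complex.I * eTerm D C r τ x p) •
        ((p.1 : ℂ) • ContinuousLinearMap.fst ℝ ℂ ℂ + (p.2 : ℂ) • ContinuousLinearMap.snd ℝ ℂ ℂ))
      x := by
  have h1 : HasFDerivAt (fun x : ℂ × ℂ => (p.1 : ℂ) * x.1 + p.2 * x.2 + (qf D C r p.1 p.2 : ℝ) * τ)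
      ((p.1 : ℂ) • ContinuousLinearMap.fst ℝ ℂ ℂ + (p.2 : ℂ) • ContinuousLinearMap.snd ℝ ℂ ℂ) x :=
    ((hasFDerivAt_fst.const_mul _).add (hasFDerivAt_snd.const_mul _)).add_const _
  exact (hasDerivAt_e _).comp_hasFDerivAt x h1

/-- The differential of a summand of the building block. -/
noncomputable def nhDeriv (s D C r : ℝ) (τ : ℂ) (x : ℂ × ℂ) (p : ℤ × ℤ) : ℂ × ℂ →L[ℝ] ℂ :=
  (2 * Real.pi * Complex.I) • ((p.1 * nhTerm s D C r τ x p) • ContinuousLinearMap.fst ℝ ℂ ℂ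
    + (p.2 * nhTerm s D C r τ x p) • ContinuousLinearMap.snd ℝ ℂ ℂ)
  - (2 * s * Real.sqrt (2 * D * τ.im) : ℝ) • (gTerm s D C r τ x p) •
    Complex.ofRealCLM.comp (shiftL D r τ.im)

lemma hasFDerivAt_nhTerm (s D C r : ℝ) (τ : ℂ) (p : ℤ × ℤ) (x : ℂ × ℂ) :
    HasFDerivAt (fun x => nhTerm s D C r τ x p) (nhDeriv s D C r τ x p) x := by
  have h1 : HasFDerivAt (fun x => s * errArg D r τ x p.1)
      ((s * Real.sqrt (2 * D * τ.im)) • shiftL D r τ.im) x := by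
    have := (((shiftL D r τ.im).hasFDerivAt (x := x)).const_add (p.1 : ℝ)).const_mul
      (s * Real.sqrt (2 * D * τ.im))
    refine this.congr_of_eventuallyEq (Eventually.of_forall fun y => ?_)
    simp only [errArg]; ring
  have h2 := ((hasDerivAt_E (s * errArg D r τ x p.1)).comp_hasFDerivAt x h1).const_sub (sg p.1)
  have h3 := (Complex.ofRealCLM.hasFDerivAt.comp x h2).mul (hasFDerivAt_eTerm D C r τ p x)
  refine (h3.congr_fderiv ?_).congr_of_eventuallyEq (Eventually.of_forall fun y => ?_)
  · ext y <;> simp [nhDeriv, nhTerm, gTerm] <;> ring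
  · simp [nhTerm]

lemma norm_nhDeriv_le (s D C r : ℝ) (hs : 0 ≤ s) (τ : ℂ) (x : ℂ × ℂ) (p : ℤ × ℤ) :
    ‖nhDeriv s D C r τ x p‖ ≤ 2 * Real.pi * (|(p.1 : ℝ)| * ‖nhTerm s D C r τ x p‖
      + |(p.2 : ℝ)| * ‖nhTerm s D C r τ x p‖)
      + 2 * s * Real.sqrt (2 * D * τ.im) * (‖gTerm s D C r τ x p‖ *
        ‖Complex.ofRealCLM.comp (shiftL D r τ.im)‖) := by
  refine (norm_sub_le _ _).trans (add_le_add ?_ ?_)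
  · rw [norm_smul]
    have hn : ‖(2 * Real.pi * Complex.I : ℂ)‖ = 2 * Real.pi := by
      simp [abs_of_pos Real.pi_pos]
    rw [hn]
    gcongr
    refine (norm_add_le _ _).trans (add_le_add ?_ ?_)
    · rw [norm_smul, norm_mul, Complex.norm_intCast]
      exact mul_le_of_le_one_right (by positivity) (ContinuousLinearMap.norm_fst_le ..)
    · rw [norm_smul, norm_mul, Complex.norm_intCast]
      exact mul_le_of_le_one_right (by positivity) (ContinuousLinearMap.norm_snd_le ..)
  · rw [norm_smul, norm_smul, Real.norm_eq_abs, abs_of_nonneg (by positivity)]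

/-- Termwise differentiation on a ball around x. A factor a or b only raises K by 1 in the majorant,
and differentiating E produces exactly the Gaussian sum. -/
lemma hasFDerivAt_NH {s D C : ℝ} (hs : 1 ≤ s) (hD : 0 < D) (hC : 0 < C) (r : ℝ) {τ : ℂ}
    (hτ : 0 < τ.im) (x : ℂ × ℂ) :
    HasFDerivAt (NH s D C r τ)
      ((2 * Real.pi * Complex.I) •
        ((∑' p : ℤ × ℤ, p.1 * nhTerm s D C r τ x p) • ContinuousLinearMap.fst ℝ ℂ ℂ
          + (∑' p : ℤ × ℤ, p.2 * nhTerm s D C r τ x p) • ContinuousLinearMap.snd ℝ ℂ ℂ)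
        - (2 * s * Real.sqrt (2 * D * τ.im) : ℝ) • (GS s D C r τ x) •
          Complex.ofRealCLM.comp (shiftL D r τ.im)) x := by
  set M := ‖x‖ + 1 with hM
  obtain ⟨c, K, δ, hc, hδ, h⟩ := norm_terms_le hD hC r hτ M
  have hx : x ∈ Metric.ball (0 : ℂ × ℂ) M := by simp [hM]
  have hu : Summable fun p : ℤ × ℤ => 2 * Real.pi * (c * majorant (K + 1) δ p
      + c * majorant (K + 1) δ p) + 2 * s * Real.sqrt (2 * D * τ.im) * (c * majorant K δ p *
        ‖Complex.ofRealCLM.comp (shiftL D r τ.im)‖) := by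
    have h1 := (summable_majorant (K + 1) hδ).mul_left c
    have h2 := (summable_majorant K hδ).mul_left c
    exact ((h1.add h1).mul_left _).add ((h2.mul_right _).mul_left _)
  have hd : ∀ p, ∀ y ∈ Metric.ball (0 : ℂ × ℂ) M, ‖nhDeriv s D C r τ y p‖ ≤
      2 * Real.pi * (c * majorant (K + 1) δ p
      + c * majorant (K + 1) δ p) + 2 * s * Real.sqrt (2 * D * τ.im) * (c * majorant K δ p *
        ‖Complex.ofRealCLM.comp (shiftL D r τ.im)‖) := by
    intro p y hy
    have hy' : ‖y‖ ≤ M := (mem_ball_zero_iff.1 hy).le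
    refine (norm_nhDeriv_le s D C r (by linarith) τ y p).trans ?_
    obtain ⟨h1, h2⟩ := h s hs y hy' p
    have h3 : |(p.1 : ℝ)| * ‖nhTerm s D C r τ y p‖ ≤ c * majorant (K + 1) δ p := by
      calc _ ≤ |(p.1 : ℝ)| * (c * majorant K δ p) := by gcongr
        _ = c * (|(p.1 : ℝ)| * majorant K δ p) := by ring
        _ ≤ _ := by gcongr; exact abs_fst_mul_majorant_le K δ p
    have h4 : |(p.2 : ℝ)| * ‖nhTerm s D C r τ y p‖ ≤ c * majorant (K + 1) δ p := by
      calc _ ≤ |(p.2 : ℝ)| * (c * majorant K δ p) := by gcongr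
        _ = c * (|(p.2 : ℝ)| * majorant K δ p) := by ring
        _ ≤ _ := by gcongr; exact abs_snd_mul_majorant_le K δ p
    gcongr
  have key := hasFDerivAt_tsum_of_isPreconnected hu Metric.isOpen_ball
    (convex_ball (0 : ℂ × ℂ) M).isPreconnected
    (fun p y _ => hasFDerivAt_nhTerm s D C r τ p y) hd hx (summable_nhTerm hs hD hC r hτ x) hx
  refine key.congr_fderiv ?_
  have s1 : Summable fun p : ℤ × ℤ => (p.1 : ℂ) * nhTerm s D C r τ x p :=
    summable_weight_nhTerm hs hD hC r hτ x zero_le_one fun p => by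
      rw [Complex.norm_intCast]; linarith [abs_nonneg (p.2 : ℝ)]
  have s2 : Summable fun p : ℤ × ℤ => (p.2 : ℂ) * nhTerm s D C r τ x p :=
    summable_weight_nhTerm hs hD hC r hτ x zero_le_one fun p => by
      rw [Complex.norm_intCast]; linarith [abs_nonneg (p.1 : ℝ)]
  have s3 := summable_gTerm hs hD hC r hτ x
  refine HasSum.tsum_eq ?_
  refine HasSum.sub (HasSum.const_smul _ (HasSum.add ?_ ?_)) (HasSum.const_smul _ ?_)
  · exact s1.hasSum.smul_const _
  · exact s2.hasSum.smul_const _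
  · exact s3.hasSum.smul_const _

/-! ### The limit `s → ∞` -/

lemma tendsto_weight_nhTerm {D C : ℝ} (hD : 0 < D) (hC : 0 < C) (r : ℝ) {τ : ℂ}
    (hτ : 0 < τ.im) (x : ℂ × ℂ) {w : ℤ × ℤ → ℂ} {c₀ : ℝ} (hc₀ : 0 ≤ c₀)
    (hw : ∀ p, ‖w p‖ ≤ c₀ * (1 + |(p.1 : ℝ)| + |(p.2 : ℝ)|)) :
    Tendsto (fun s => ∑' p, w p * nhTerm s D C r τ x p) atTop
      (𝓝 (∑' p : ℤ × ℤ, w p * (((sg p.1 - Real.sign (p.1 + shiftL D r τ.im x) : ℝ) : ℂ) *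
        eTerm D C r τ x p))) := by
  obtain ⟨c, K, δ, hc, hδ, h⟩ := norm_terms_le hD hC r hτ ‖x‖
  refine tendsto_tsum_of_dominated_convergence
    (bound := fun p => c * (c₀ * majorant (K + 1) δ p))
    (((summable_majorant _ hδ).mul_left _).mul_left _) (fun p => ?_) ?_
  · refine Tendsto.const_mul _ (Tendsto.mul_const _ ?_)
    refine (Complex.continuous_ofReal.tendsto _).comp (Tendsto.const_sub _ ?_)
    have := tendsto_E_mul (errArg D r τ x p.1)
    rwa [errArg, real_sign_mul_of_pos (Real.sqrt_pos.2 (by positivity))] at this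
  · filter_upwards [eventually_ge_atTop 1] with s hs p
    rw [norm_mul]
    calc _ ≤ ‖w p‖ * (c * majorant K δ p) := by gcongr; exact (h s hs x le_rfl p).1
      _ = c * (‖w p‖ * majorant K δ p) := by ring
      _ ≤ _ := mul_le_mul_of_nonneg_left (weight_mul_majorant_le hc₀ p (hw p) K δ) hc.le

lemma sg_eq_sign {a : ℤ} {L : ℝ} (h0 : 0 < L) (h1 : L < 1) : sg a = Real.sign (a + L) := by
  rcases le_or_gt 0 a with h | h
  · have : (0 : ℝ) ≤ a := by exact_mod_cast h
    rw [sg_of_nonneg h, Real.sign_of_pos (by linarith)]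
  · have : (a : ℝ) ≤ -1 := by exact_mod_cast (by omega : a ≤ -1)
    rw [sg_of_neg h, Real.sign_of_neg (by linarith)]

/-- In the chamber `0 < L < 1` the building block has holomorphic part zero. -/
lemma tendsto_weight_nhTerm_zero {D C : ℝ} (hD : 0 < D) (hC : 0 < C) {r : ℝ} {τ : ℂ}
    (hτ : 0 < τ.im) {x : ℂ × ℂ} (h0 : 0 < shiftL D r τ.im x) (h1 : shiftL D r τ.im x < 1)
    {w : ℤ × ℤ → ℂ} {c₀ : ℝ} (hc₀ : 0 ≤ c₀)
    (hw : ∀ p, ‖w p‖ ≤ c₀ * (1 + |(p.1 : ℝ)| + |(p.2 : ℝ)|)) :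
    Tendsto (fun s => ∑' p, w p * nhTerm s D C r τ x p) atTop (𝓝 0) := by
  have := tendsto_weight_nhTerm hD hC r hτ x hc₀ hw
  simpa [← sg_eq_sign h0 h1] using this

/-- On the wall `L = 0`, the holomorphic part is the sum over `a = 0`. -/
lemma tendsto_weight_nhTerm_wall {D C : ℝ} (hD : 0 < D) (hC : 0 < C) {r : ℝ} {τ : ℂ}
    (hτ : 0 < τ.im) {x : ℂ × ℂ} (h0 : shiftL D r τ.im x = 0)
    {w : ℤ × ℤ → ℂ} {c₀ : ℝ} (hc₀ : 0 ≤ c₀)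
    (hw : ∀ p, ‖w p‖ ≤ c₀ * (1 + |(p.1 : ℝ)| + |(p.2 : ℝ)|)) :
    Tendsto (fun s => ∑' p, w p * nhTerm s D C r τ x p) atTop
      (𝓝 (∑' b : ℤ, w (0, b) * e (b * x.2 + (C / 2 : ℝ) * b ^ 2 * τ))) := by
  have := tendsto_weight_nhTerm hD hC r hτ x hc₀ hw
  convert this using 2
  symm
  have hinj : Function.Injective fun b : ℤ => ((0 : ℤ), b) := fun b b' h => by simpa using h
  rw [← hinj.tsum_eq]
  · refine tsum_congr fun b => ?_
    -- On this column E tends to sgn(0) = 0 while sgn(1/2) = 1, so it survives with coefficient one.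
    rw [h0, sg_of_nonneg le_rfl, eTerm, qf]
    simp
    left; ring_nf
  · intro p hp
    by_contra hne
    apply hp
    have hp1 : p.1 ≠ 0 := fun h => hne ⟨p.2, by rw [← h]⟩
    have : sg p.1 = Real.sign (p.1 + shiftL D r τ.im x) := by
      rw [h0, add_zero]
      rcases lt_or_gt_of_ne hp1 with h | h
      · rw [sg_of_neg h, Real.sign_of_neg (by exact_mod_cast h)]
      · rw [sg_of_nonneg h.le, Real.sign_of_pos (by exact_mod_cast h)]
    simp [this]

/-- In the chamber `0 < L < 1` the Gaussian part decays faster than `1/s`. -/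
lemma tendsto_mul_GS_zero {D C : ℝ} (hD : 0 < D) (hC : 0 < C) {r : ℝ} {τ : ℂ}
    (hτ : 0 < τ.im) {x : ℂ × ℂ} (h0 : 0 < shiftL D r τ.im x) (h1 : shiftL D r τ.im x < 1) :
    Tendsto (fun s : ℝ => (s : ℂ) * GS s D C r τ x) atTop (𝓝 0) := by
  obtain ⟨K, δ, hδ, h⟩ := norm_gauss_mul_eTerm_le hD hC r hτ ‖x‖
  set L := shiftL D r τ.im x with hL
  -- The distance of -L from ℤ: every Gaussian in the sum has |a + L| ≥ m > 0.
  set m := min L (1 - L) with hm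
  have hm0 : 0 < m := lt_min h0 (by linarith)
  have hmL : ∀ a : ℤ, m ^ 2 ≤ (a + L) ^ 2 := by
    intro a
    rw [← sq_abs (a + L)]
    refine pow_le_pow_left₀ hm0.le ?_ 2
    rcases le_or_gt 0 a with h | h
    · have : (0 : ℝ) ≤ a := by exact_mod_cast h
      exact (min_le_left _ _).trans ((by linarith : L ≤ a + L).trans (le_abs_self _))
    · have : (a : ℝ) ≤ -1 := by exact_mod_cast (by omega : a ≤ -1)
      exact (min_le_right _ _).trans ((by linarith : 1 - L ≤ -(a + L)).trans (neg_le_abs _))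
  set k := Real.pi * (2 * D * τ.im * m ^ 2) with hk
  have hk0 : 0 < k := by positivity
  have hb : ∀ s : ℝ, 1 ≤ s → ‖(s : ℂ) * GS s D C r τ x‖ ≤
      (s * Real.exp (-(k * (s ^ 2 - 1)))) * ∑' p, majorant K δ p := by
    intro s hs
    rw [norm_mul, Complex.norm_real, Real.norm_eq_abs, abs_of_pos (by linarith), mul_assoc]
    gcongr
    rw [← tsum_mul_left]
    refine tsum_of_norm_bounded ((summable_majorant K hδ).mul_left _).hasSum fun p => ?_
    rw [gTerm, norm_mul, Complex.norm_real, Real.norm_eq_abs, abs_of_pos (Real.exp_pos _)]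
    -- With s² = (s² - 1) + 1, one copy of the Gaussian is kept to dominate the indefinite
    -- exponential. The remaining s² - 1 copies give decay in s that is uniform over the lattice.
    have h2 : Real.exp (-Real.pi * (s * errArg D r τ x p.1) ^ 2) ≤
        Real.exp (-(k * (s ^ 2 - 1))) * Real.exp (-(Real.pi * errArg D r τ x p.1 ^ 2)) := by
      rw [← Real.exp_add]
      apply Real.exp_le_exp.2
      rw [mul_pow, sq_errArg hD hτ, ← hL]
      have h3 : 0 ≤ s ^ 2 - 1 := by nlinarith
      have h4 : k ≤ Real.pi * (2 * D * τ.im * (p.1 + L) ^ 2) := by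
        rw [hk]
        exact mul_le_mul_of_nonneg_left (mul_le_mul_of_nonneg_left (hmL p.1) (by positivity))
          Real.pi_pos.le
      nlinarith [mul_le_mul_of_nonneg_left h4 h3]
    calc _ ≤ (Real.exp (-(k * (s ^ 2 - 1))) * Real.exp (-(Real.pi * errArg D r τ x p.1 ^ 2)))
          * ‖eTerm D C r τ x p‖ := by gcongr
      _ ≤ _ := by rw [mul_assoc]; gcongr; exact h x le_rfl p
  have hlim : Tendsto (fun s : ℝ => (s * Real.exp (-(k * (s ^ 2 - 1)))) * ∑' p, majorant K δ p)
      atTop (𝓝 0) := by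
    have h5 : Tendsto (fun s : ℝ => s ^ (1 : ℝ) * Real.exp (-k * s)) atTop (𝓝 0) :=
      tendsto_rpow_mul_exp_neg_mul_atTop_nhds_zero 1 k hk0
    have h6 : Tendsto (fun s : ℝ => Real.exp k * (s ^ (1 : ℝ) * Real.exp (-k * s))) atTop (𝓝 0) := by
      simpa using h5.const_mul (Real.exp k)
    rw [← zero_mul (∑' p, majorant K δ p)]
    refine Tendsto.mul_const _ (squeeze_zero' ?_ ?_ h6)
    · filter_upwards [eventually_ge_atTop 0] with s hs
      positivity
    · filter_upwards [eventually_ge_atTop 1] with s hs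
      rw [Real.rpow_one, mul_left_comm, ← Real.exp_add]
      gcongr
      nlinarith [mul_nonneg hk0.le (mul_nonneg (by linarith : 0 ≤ s) (by linarith : 0 ≤ s - 1))]
  rw [tendsto_zero_iff_norm_tendsto_zero]
  refine squeeze_zero' (Eventually.of_forall fun s => norm_nonneg _) ?_ hlim
  filter_upwards [eventually_ge_atTop 1] with s hs using hb s hs

/-! ### Poisson summation for the Gaussian sum -/

lemma neg_inv_im_pos {τ : ℂ} (hτ : 0 < τ.im) : 0 < (-1 / τ).im := by
  have h0 : τ ≠ 0 := by rintro rfl; simp at hτ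
  have := div_pos hτ (Complex.normSq_pos.2 h0)
  rw [Complex.div_im]
  simpa [neg_div] using this

/-- One-dimensional Poisson summation, with the translation ρ kept explicit: on the dual side it
appears as the phase exp(2πimρ), which couples the two variables in the double sum. -/
lemma tsum_gauss_shift {A : ℂ} (hA : 0 < A.im) (x ρ : ℂ) :
    ∑' b : ℤ, Complex.exp (Real.pi * Complex.I * A * (b + ρ) ^ 2
        + 2 * Real.pi * Complex.I * (b + ρ) * x) =
      1 / (-Complex.I * A) ^ (1 / 2 : ℂ) * ∑' m : ℤ,
        Complex.exp (-(Real.pi * Complex.I * (m - x) ^ 2 / A)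
          + 2 * Real.pi * Complex.I * m * ρ) := by
  have hA0 : A ≠ 0 := by rintro rfl; simp at hA
  have hre : 0 < (-Complex.I * A).re := by simpa using hA
  have h := Complex.tsum_exp_neg_quadratic hre (Complex.I * (A * ρ + x))
  have h1 : ∀ b : ℤ, Complex.exp (Real.pi * Complex.I * A * (b + ρ) ^ 2
        + 2 * Real.pi * Complex.I * (b + ρ) * x) =
      Complex.exp (Real.pi * Complex.I * A * ρ ^ 2 + 2 * Real.pi * Complex.I * ρ * x) *
        Complex.exp (-Real.pi * (-Complex.I * A) * b ^ 2
          + 2 * Real.pi * (Complex.I * (A * ρ + x)) * b) := by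
    intro b
    rw [← Complex.exp_add]; congr 1; ring
  rw [tsum_congr h1, tsum_mul_left, h, mul_left_comm, ← tsum_mul_left]
  congr 1
  refine tsum_congr fun m => ?_
  rw [← Complex.exp_add]
  congr 1
  have hI : (-Real.pi / (-Complex.I * A) : ℂ) = -(Real.pi * Complex.I / A) := by
    field_simp
    simp
  rw [hI]
  field_simp
  ring_nf
  simp only [Complex.I_sq, Complex.I_pow_four]
  ring

lemma summable_exp_gauss {A : ℂ} (hA : 0 < A.im) (x : ℂ) :
    Summable fun n : ℤ => Complex.exp (Real.pi * Complex.I * A * n ^ 2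
      + 2 * Real.pi * Complex.I * n * x) := by
  refine ((summable_jacobiTheta₂_term_iff x A).2 hA).congr fun n => ?_
  rw [jacobiTheta₂_term]; congr 1; ring

/-- Poisson summation in two variables, for a Gaussian in triangular form. -/
lemma tsum_gauss_two {A B : ℂ} (hA : 0 < A.im) (hB : 0 < B.im) (r : ℝ) (x η : ℂ)
    (hF : Summable fun p : ℤ × ℤ => Complex.exp (Real.pi * Complex.I * A * (p.2 + r * p.1) ^ 2
        + 2 * Real.pi * Complex.I * (p.2 + r * p.1) * x) *
        Complex.exp (Real.pi * Complex.I * B * p.1 ^ 2 + 2 * Real.pi * Complex.I * p.1 * η)) :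
    ∑' p : ℤ × ℤ, Complex.exp (Real.pi * Complex.I * A * (p.2 + r * p.1) ^ 2
        + 2 * Real.pi * Complex.I * (p.2 + r * p.1) * x) *
        Complex.exp (Real.pi * Complex.I * B * p.1 ^ 2 + 2 * Real.pi * Complex.I * p.1 * η) =
      1 / ((-Complex.I * A) ^ (1 / 2 : ℂ) * (-Complex.I * B) ^ (1 / 2 : ℂ)) *
        ∑' m : ℤ, ∑' l : ℤ, Complex.exp (-(Real.pi * Complex.I * (m - x) ^ 2 / A)) *
          Complex.exp (-(Real.pi * Complex.I * (l - (η + m * r)) ^ 2 / B)) := by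
  have hA0 : A ≠ 0 := by rintro rfl; simp at hA
  rw [hF.tsum_prod]
  -- Poisson summation over b with translation ra leaves the phase exp(2πimra), which moves the
  -- elliptic variable of the sum over a from η to η + mr.
  have h1 : ∀ a : ℤ, ∑' b : ℤ, Complex.exp (Real.pi * Complex.I * A * (b + r * a) ^ 2
        + 2 * Real.pi * Complex.I * (b + r * a) * x) *
        Complex.exp (Real.pi * Complex.I * B * a ^ 2 + 2 * Real.pi * Complex.I * a * η) =
      1 / (-Complex.I * A) ^ (1 / 2 : ℂ) * ∑' m : ℤ,
        Complex.exp (-(Real.pi * Complex.I * (m - x) ^ 2 / A)) *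
        Complex.exp (Real.pi * Complex.I * B * (a + (0 : ℂ)) ^ 2
          + 2 * Real.pi * Complex.I * (a + (0 : ℂ)) * (η + m * r)) := by
    intro a
    rw [tsum_mul_right, tsum_gauss_shift hA, mul_assoc, ← tsum_mul_right]
    congr 1
    refine tsum_congr fun m => ?_
    rw [← Complex.exp_add, ← Complex.exp_add]
    congr 1; ring
  have hsum : Summable (Function.uncurry fun a m : ℤ =>
        Complex.exp (-(Real.pi * Complex.I * (m - x) ^ 2 / A)) *
        Complex.exp (Real.pi * Complex.I * B * (a + (0 : ℂ)) ^ 2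
          + 2 * Real.pi * Complex.I * (a + (0 : ℂ)) * (η + m * r))) := by
    have hA' : 0 < (-1 / A).im := by
      exact neg_inv_im_pos hA
    have t1 := (summable_exp_gauss hB η).norm
    have t2 := ((summable_exp_gauss hA' (x / A)).mul_left
      (Complex.exp (-(Real.pi * Complex.I * x ^ 2 / A)))).norm
    have t3 := t1.mul_of_nonneg t2 (fun _ => norm_nonneg _) fun _ => norm_nonneg _
    refine Summable.of_norm (t3.congr ?_)
    rintro ⟨a, m⟩
    -- As r is real, the coupling phase has modulus one, and absolute summability reduces to a
    -- product of two one-dimensional Gaussians. This justifies the interchange of sums.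
    have hn : ‖Complex.exp (2 * Real.pi * Complex.I * a * (m * r))‖ = 1 := by
      rw [show (2 * Real.pi * Complex.I * a * (m * r) : ℂ)
        = ((2 * Real.pi * a * (m * r) : ℝ) : ℂ) * Complex.I by push_cast; ring,
        Complex.norm_exp_ofReal_mul_I]
    rw [← norm_mul, ← mul_one ‖_‖, ← hn, ← norm_mul]
    congr 1
    simp only [Function.uncurry_apply_pair, ← Complex.exp_add]
    congr 1
    field_simp
    ring
  rw [tsum_congr h1, tsum_mul_left, ← hsum.tsum_comm]
  have h2 : ∀ m : ℤ, ∑' a : ℤ, Complex.exp (-(Real.pi * Complex.I * (m - x) ^ 2 / A)) *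
        Complex.exp (Real.pi * Complex.I * B * (a + (0 : ℂ)) ^ 2
          + 2 * Real.pi * Complex.I * (a + (0 : ℂ)) * (η + m * r)) =
      1 / (-Complex.I * B) ^ (1 / 2 : ℂ) * ∑' l : ℤ,
        Complex.exp (-(Real.pi * Complex.I * (m - x) ^ 2 / A)) *
          Complex.exp (-(Real.pi * Complex.I * (l - (η + m * r)) ^ 2 / B)) := by
    intro m
    rw [tsum_mul_left, tsum_gauss_shift hB, tsum_mul_left, mul_left_comm]
    simp
  rw [tsum_congr h2, tsum_mul_left, ← mul_assoc]
  congr 1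
  field_simp

/-- Both arguments lie in (-π/2, π/2), so the principal logarithms add without a branch jump. It
merges the two Poisson factors, one from τ and one from its conjugate, into a positive real number.
-/
lemma cpow_half_mul {z w : ℂ} (hz : 0 < z.re) (hw : 0 < w.re) {P : ℝ} (hP : 0 < P)
    (h : z * w = (P : ℂ) ^ 2) : z ^ (1 / 2 : ℂ) * w ^ (1 / 2 : ℂ) = P := by
  have hz0 : z ≠ 0 := by rintro rfl; simp at hz
  have hw0 : w ≠ 0 := by rintro rfl; simp at hw
  have h1 := abs_lt.1 (Complex.abs_arg_lt_pi_div_two_iff.2 (Or.inl hz))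
  have h2 := abs_lt.1 (Complex.abs_arg_lt_pi_div_two_iff.2 (Or.inl hw))
  rw [Complex.cpow_def_of_ne_zero hz0, Complex.cpow_def_of_ne_zero hw0, ← Complex.exp_add,
    ← add_mul, ← (Complex.log_mul_eq_add_log_iff hz0 hw0).2 ⟨by linarith, by linarith⟩,
    ← Complex.cpow_def_of_ne_zero (mul_ne_zero hz0 hw0), h, ← Complex.ofReal_pow, show (1 / 2 : ℂ) = ((1 / 2 : ℝ) : ℂ) by norm_num,
    ← Complex.ofReal_cpow (by positivity), ← Real.sqrt_eq_rpow, Real.sqrt_sq hP.le]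

/-! ### The Gaussian at real vectors -/

/-- The summand of `GS 1`, at a real vector `(a, b)`. -/
noncomputable def gR (D C r : ℝ) (τ : ℂ) (x : ℂ × ℂ) (a b : ℝ) : ℂ :=
  Complex.exp (-(2 * Real.pi * D * τ.im * (a + shiftL D r τ.im x) ^ 2 : ℝ)
    + 2 * Real.pi * Complex.I * (a * x.1 + b * x.2 + (qf D C r a b : ℝ) * τ))

lemma gTerm_one_eq {D : ℝ} (hD : 0 < D) (C r : ℝ) {τ : ℂ} (hτ : 0 < τ.im) (x : ℂ × ℂ)
    (p : ℤ × ℤ) : gTerm 1 D C r τ x p = gR D C r τ x p.1 p.2 := by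
  rw [gTerm, gR, Complex.exp_add, eTerm, e, one_mul, neg_mul, sq_errArg hD hτ, Complex.ofReal_exp]
  congr 2
  · push_cast; ring_nf

lemma im_eq_sub_conj (z : ℂ) : (z.im : ℂ) = (z - conj z) / (2 * Complex.I) := by
  rw [Complex.sub_conj]
  field_simp
  push_cast; ring

lemma sub_conj_ne_zero {τ : ℂ} (hτ : 0 < τ.im) : τ - conj τ ≠ 0 := by
  rw [Complex.sub_conj]
  have : (τ.im : ℂ) ≠ 0 := by exact_mod_cast hτ.ne'
  push_cast
  simp [this]

/-- Writing v = (τ - τ̄)/(2i), the Gaussian exponent -2πDva² added to -πiDτa² gives -πiDτ̄a². The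
negative direction thus becomes a convergent Gaussian in -τ̄, with conjugated elliptic variable, and
the remaining factor does not depend on the lattice point. -/
lemma gR_eq {D : ℝ} (hD : 0 < D) (C r : ℝ) {τ : ℂ} (hτ : 0 < τ.im) (x : ℂ × ℂ) (a b : ℝ) :
    gR D C r τ x a b =
      Complex.exp (-(2 * Real.pi * ((x.1 - r * x.2).im : ℂ) ^ 2 / (D * τ.im))) *
      (Complex.exp (Real.pi * Complex.I * (C * τ) * (b + r * a) ^ 2
        + 2 * Real.pi * Complex.I * (b + r * a) * x.2) *
       Complex.exp (Real.pi * Complex.I * (D * -conj τ) * a ^ 2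
        + 2 * Real.pi * Complex.I * a * conj (x.1 - r * x.2))) := by
  have hD' : (D : ℂ) ≠ 0 := by exact_mod_cast hD.ne'
  have hs := sub_conj_ne_zero hτ
  rw [gR, ← Complex.exp_add, ← Complex.exp_add]
  congr 1
  rw [shiftL_apply, qf]
  push_cast
  rw [im_eq_sub_conj (x.1 - r * x.2), im_eq_sub_conj x.1, im_eq_sub_conj x.2, im_eq_sub_conj τ]
  simp only [map_sub, map_mul, Complex.conj_ofReal]
  generalize conj τ = tc at *
  generalize conj x.1 = x1c at *
  generalize conj x.2 = x2c at *
  field_simp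
  ring_nf
  simp only [Complex.I_sq]
  ring

/-- The comparison of exponents in the inversion formula, with each variable and its conjugate
treated as independent, so that it is an identity of rational functions. -/
lemma GS_exponent {t tc x1 x2 x1c x2c D C r m l : ℂ} (hD : D ≠ 0) (hC : C ≠ 0)
    (ht : t ≠ 0) (htc : tc ≠ 0) (hs : t - tc ≠ 0) :
    -(2 * ((x1 / t - r * (x2 / t) - (x1c / tc - r * (x2c / tc))) / (2 * Complex.I)) ^ 2 /
        (D * ((-1 / t - -1 / tc) / (2 * Complex.I))))
      + (-(Complex.I * (m - x2 / t) ^ 2 / (C * (-1 / t)))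
        + -(Complex.I * (l - ((x1c / tc - r * (x2c / tc)) + m * r)) ^ 2 / (D * (-(-1 / tc))))) =
      2 * Complex.I * ((x2 ^ 2 / (2 * C) - (x1 - r * x2) ^ 2 / (2 * D)) / t)
      + (-(2 * ((x1 - r * x2 - (x1c - r * x2c)) / (2 * Complex.I)) ^ 2 /
          (D * ((t - tc) / (2 * Complex.I))))
        + (Complex.I * (C * t) * (-m / C) ^ 2 + 2 * Complex.I * (-m / C) * x2
        + (Complex.I * (D * -tc) * ((l - m * r) / D) ^ 2
          + 2 * Complex.I * ((l - m * r) / D) * (x1c - r * x2c)))) := by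
  have h1 : (-1 / t - -1 / tc) = (t - tc) / (t * tc) := by field_simp; ring
  rw [h1]
  field_simp
  ring_nf
  simp only [Complex.I_sq]
  ring

/-- The behaviour of the Gaussian sum under `τ ↦ -1/τ`: a sum over the dual lattice. -/
lemma GS_neg_inv {D C : ℝ} (hD : 0 < D) (hC : 0 < C) (r : ℝ) {τ : ℂ} (hτ : 0 < τ.im)
    (x : ℂ × ℂ) :
    GS 1 D C r (-1 / τ) (x.1 / τ, x.2 / τ) = (‖τ‖ / Real.sqrt (C * D) : ℝ) *
      e ((x.2 ^ 2 / (2 * C) - (x.1 - r * x.2) ^ 2 / (2 * D)) / τ) *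
      ∑' m : ℤ, ∑' l : ℤ, gR D C r τ x ((l - m * r) / D) (-m / C - r * ((l - m * r) / D)) := by
  have hτ' := neg_inv_im_pos hτ
  have h0 : τ ≠ 0 := by rintro rfl; simp at hτ
  have hc0 : conj τ ≠ 0 := by simpa using h0
  have hD' : (D : ℂ) ≠ 0 := by exact_mod_cast hD.ne'
  have hC' : (C : ℂ) ≠ 0 := by exact_mod_cast hC.ne'
  have hs := sub_conj_ne_zero hτ
  have hA : 0 < ((C : ℂ) * (-1 / τ)).im := by rw [Complex.im_ofReal_mul]; positivity
  have hB : 0 < ((D : ℂ) * -conj (-1 / τ)).im := by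
    rw [Complex.im_ofReal_mul, Complex.neg_im, Complex.conj_im, neg_neg]; positivity
  have hterm : ∀ p : ℤ × ℤ, gTerm 1 D C r (-1 / τ) (x.1 / τ, x.2 / τ) p = _ := fun p =>
    (gTerm_one_eq hD C r hτ' _ p).trans (gR_eq hD C r hτ' (x.1 / τ, x.2 / τ) p.1 p.2)
  have hsum := (summable_gTerm le_rfl hD hC r hτ' (x.1 / τ, x.2 / τ)).congr hterm
  rw [summable_mul_left_iff (Complex.exp_ne_zero _)] at hsum
  rw [GS, tsum_congr hterm, tsum_mul_left]
  have hP := tsum_gauss_two hA hB r (x.2 / τ) (conj (x.1 / τ - r * (x.2 / τ))) (by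
    simpa using hsum)
  have hcp : (-Complex.I * ((C : ℂ) * (-1 / τ))) ^ (1 / 2 : ℂ) *
      (-Complex.I * ((D : ℂ) * -conj (-1 / τ))) ^ (1 / 2 : ℂ)
      = ((Real.sqrt (C * D) / ‖τ‖ : ℝ) : ℂ) := by
    refine cpow_half_mul (by simpa using hA) (by simpa using hB)
      (div_pos (Real.sqrt_pos.2 (by positivity)) (norm_pos_iff.2 h0)) ?_
    push_cast
    rw [div_pow, ← Complex.ofReal_pow, Real.sq_sqrt (by positivity), ← Complex.mul_conj']
    simp only [map_div₀, map_neg, map_one]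
    field_simp
    push_cast
    linear_combination (-(C : ℂ) * D) * Complex.I_sq
  rw [hcp] at hP
  simp only [Complex.ofReal_intCast] at hP ⊢
  rw [hP, mul_left_comm, mul_assoc ((‖τ‖ / Real.sqrt (C * D) : ℝ) : ℂ)]
  refine congrArg₂ (· * ·) ?_ ?_
  · push_cast; rw [one_div, inv_div]
  simp only [← tsum_mul_left]
  refine tsum_congr fun m => tsum_congr fun l => ?_
  rw [gR_eq hD C r hτ, e]
  simp only [← Complex.exp_add]
  congr 1
  have key := GS_exponent (x1 := x.1) (x2 := x.2) (x1c := conj x.1) (x2c := conj x.2) (r := r)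
    (m := m) (l := l) hD' hC' h0 hc0 hs
  rw [im_eq_sub_conj, im_eq_sub_conj (-1 / τ), im_eq_sub_conj (x.1 - r * x.2), im_eq_sub_conj τ]
  push_cast
  simp only [map_sub, map_mul, map_div₀, map_neg, map_one, Complex.conj_ofReal, sub_add_cancel]
  linear_combination (Real.pi : ℂ) * key

/-! ### Wirtinger derivatives -/

/-- `df = p dz + q dz̄` at `z`. -/
def HasWirt (f : ℂ → ℂ) (p q z : ℂ) : Prop :=
  HasFDerivAt f (p • ContinuousLinearMap.id ℝ ℂ + q • (Complex.conjCLE : ℂ →L[ℝ] ℂ)) z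

lemma HasWirt.wirtinger_eq {f : ℂ → ℂ} {p q z : ℂ} (h : HasWirt f p q z) : wirtinger f z = p := by
  rw [wirtinger, HasFDerivAt.fderiv h]
  simp
  linear_combination ((q - p) / 2) * Complex.I_sq

lemma HasWirt.zetaD_eq {f : ℂ → ℂ} {p q z : ℂ} (h : HasWirt f p q z) :
    zetaD f z = p / (2 * Real.pi * Complex.I) := by
  rw [zetaD, h.wirtinger_eq]

lemma HasDerivAt.hasWirt {f : ℂ → ℂ} {f' z : ℂ} (h : HasDerivAt f f' z) : HasWirt f f' 0 z := by
  refine (h.hasFDerivAt.restrictScalars ℝ).congr_fderiv ?_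
  ext x
  simp [mul_comm]

lemma HasWirt.differentiableAt {f : ℂ → ℂ} {p z : ℂ} (h : HasWirt f p 0 z) :
    DifferentiableAt ℂ f z := by
  have : HasFDerivAt f (p • ContinuousLinearMap.id ℂ ℂ) z :=
    hasFDerivAt_of_restrictScalars ℝ h (by ext x; simp)
  exact this.differentiableAt

lemma HasWirt.sub {f g : ℂ → ℂ} {p q p' q' z : ℂ} (hf : HasWirt f p q z) (hg : HasWirt g p' q' z) :
    HasWirt (fun w => f w - g w) (p - p') (q - q') z := by
  refine (HasFDerivAt.sub hf hg).congr_fderiv ?_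
  ext x; simp; ring

lemma HasWirt.sum {ι : Type*} {s : Finset ι} {f : ι → ℂ → ℂ} {p q : ι → ℂ} {z : ℂ}
    (hf : ∀ i ∈ s, HasWirt (f i) (p i) (q i) z) :
    HasWirt (fun w => ∑ i ∈ s, f i w) (∑ i ∈ s, p i) (∑ i ∈ s, q i) z := by
  refine (HasFDerivAt.fun_sum hf).congr_fderiv ?_
  simp only [Finset.sum_add_distrib, ← Finset.sum_smul]

lemma HasWirt.mul_left {f g : ℂ → ℂ} {p q g' z : ℂ} (hg : HasDerivAt g g' z)
    (hf : HasWirt f p q z) : HasWirt (fun w => g w * f w) (g' * f z + g z * p) (g z * q) z := by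
  refine (HasFDerivAt.mul (HasDerivAt.hasWirt hg) hf).congr_fderiv ?_
  ext x; simp; ring

lemma HasWirt.const_mul {f : ℂ → ℂ} {p q z : ℂ} (c : ℂ) (hf : HasWirt f p q z) :
    HasWirt (fun w => c * f w) (c * p) (c * q) z := by
  simpa using HasWirt.mul_left (hasDerivAt_const z c) hf

lemma HasWirt.comp {f h : ℂ → ℂ} {p q h' z : ℂ} (hf : HasWirt f p q (h z))
    (hh : HasDerivAt h h' z) : HasWirt (fun w => f (h w)) (p * h') (q * conj h') z := by
  refine (HasFDerivAt.comp z hf (HasDerivAt.hasWirt hh)).congr_fderiv ?_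
  ext x; simp; ring

lemma HasWirt.congr_deriv {f : ℂ → ℂ} {p q p' q' z : ℂ} (h : HasWirt f p q z) (hp : p = p')
    (hq : q = q') : HasWirt f p' q' z := by
  subst hp hq; exact h

lemma HasWirt.congr_of_eventuallyEq {f g : ℂ → ℂ} {p q z : ℂ} (h : HasWirt f p q z)
    (hg : g =ᶠ[𝓝 z] f) : HasWirt g p q z :=
  HasFDerivAt.congr_of_eventuallyEq h hg

lemma hasWirt_of_hasFDerivAt {f : ℂ → ℂ} {L : ℂ →L[ℝ] ℂ} {z : ℂ} (h : HasFDerivAt f L z) :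
    HasWirt f ((L 1 - Complex.I * L Complex.I) / 2) ((L 1 + Complex.I * L Complex.I) / 2) z := by
  refine h.congr_fderiv ?_
  ext x
  have hx : L x = x.re * L 1 + x.im * L Complex.I := by
    conv_lhs => rw [← Complex.re_add_im x]
    have h1 : ((x.re : ℂ) + x.im * Complex.I) = x.re • (1 : ℂ) + x.im • Complex.I := by simp
    rw [h1, map_add, map_smul, map_smul]
    simp
  have h1 : (x.re : ℂ) = (x + conj x) / 2 := by rw [Complex.add_conj]; push_cast; ring
  rw [hx, h1, im_eq_sub_conj]
  simp
  field_simp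
  linear_combination ((x - conj x) * L Complex.I) * Complex.I_sq

/-- The Wirtinger derivative along a complex line is the combination of the partial ones. -/
lemma wirtinger_line {F : ℂ × ℂ → ℂ} {z : ℂ × ℂ} (h : DifferentiableAt ℝ F z) (v₁ v₂ : ℂ) :
    wirtinger (fun t => F (z.1 + v₁ * t, z.2 + v₂ * t)) 0 =
      v₁ * wirtinger (fun w => F (w, z.2)) z.1 + v₂ * wirtinger (fun w => F (z.1, w)) z.2 := by
  have hF := h.hasFDerivAt
  set L := fderiv ℝ F z
  have h1 : HasFDerivAt (fun w : ℂ => F (w, z.2)) (L.comp (ContinuousLinearMap.inl ℝ ℂ ℂ)) z.1 :=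
    hF.comp z.1 (hasFDerivAt_prodMk_left z.1 z.2)
  have h2 : HasFDerivAt (fun w : ℂ => F (z.1, w)) (L.comp (ContinuousLinearMap.inr ℝ ℂ ℂ)) z.2 :=
    hF.comp z.2 (hasFDerivAt_prodMk_right z.1 z.2)
  have h3 : HasFDerivAt (fun t : ℂ => (z.1 + v₁ * t, z.2 + v₂ * t))
      ((v₁ • ContinuousLinearMap.id ℝ ℂ).prod (v₂ • ContinuousLinearMap.id ℝ ℂ)) 0 :=
    ((hasFDerivAt_id (𝕜 := ℝ) (0 : ℂ)).const_mul v₁ |>.const_add z.1).prodMk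
      ((hasFDerivAt_id (𝕜 := ℝ) (0 : ℂ)).const_mul v₂ |>.const_add z.2)
  have hF' : HasFDerivAt F L ((fun t : ℂ => (z.1 + v₁ * t, z.2 + v₂ * t)) 0) := by simpa using hF
  have h4 := hF'.comp (0 : ℂ) h3
  have e4 := (hasWirt_of_hasFDerivAt h4).wirtinger_eq
  have e1 := (hasWirt_of_hasFDerivAt h1).wirtinger_eq
  have e2 := (hasWirt_of_hasFDerivAt h2).wirtinger_eq
  have e4' : wirtinger (fun t => F (z.1 + v₁ * t, z.2 + v₂ * t)) 0 = _ := e4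
  rw [e4', e1, e2]
  have w1 := hasWirt_of_hasFDerivAt h1
  have w2 := hasWirt_of_hasFDerivAt h2
  have L1 : ∀ v : ℂ, L (v, 0) = _ := fun v =>
    DFunLike.congr_fun (HasFDerivAt.unique h1 w1) v
  have L2 : ∀ v : ℂ, L (0, v) = _ := fun v =>
    DFunLike.congr_fun (HasFDerivAt.unique h2 w2) v
  have hsplit : ∀ a b : ℂ, L (a, b) = L (a, 0) + L (0, b) := fun a b => by
    rw [← map_add]; simp
  simp only [ContinuousLinearMap.comp_apply, ContinuousLinearMap.prod_apply,
    smul_apply, ContinuousLinearMap.id_apply, ContinuousLinearMap.inl_apply,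
    ContinuousLinearMap.inr_apply, smul_eq_mul, mul_one]
  rw [hsplit v₁ v₂, hsplit (v₁ * Complex.I), L1 v₁, L1 (v₁ * Complex.I), L2 v₂,
    L2 (v₂ * Complex.I)]
  simp
  generalize L (1, 0) = A
  generalize L (0, 1) = A'
  generalize L (Complex.I, 0) = B
  generalize L (0, Complex.I) = B'
  generalize conj v₁ = c₁
  generalize conj v₂ = c₂
  ring_nf
  simp only [Complex.I_sq, Complex.I_pow_three]
  ring

/-- Wirtinger derivatives of the building block along a holomorphic curve. -/
lemma hasWirt_NH {s D C : ℝ} (hs : 1 ≤ s) (hD : 0 < D) (hC : 0 < C) (r : ℝ) {τ : ℂ}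
    (hτ : 0 < τ.im) {h₁ h₂ : ℂ → ℂ} {h₁' h₂' z : ℂ} (H₁ : HasDerivAt h₁ h₁' z)
    (H₂ : HasDerivAt h₂ h₂' z) :
    HasWirt (fun w => NH s D C r τ (h₁ w, h₂ w))
      (2 * Real.pi * Complex.I *
        ((∑' p : ℤ × ℤ, p.1 * nhTerm s D C r τ (h₁ z, h₂ z) p) * h₁'
          + (∑' p : ℤ × ℤ, p.2 * nhTerm s D C r τ (h₁ z, h₂ z) p) * h₂')
        + Complex.I * s * Real.sqrt (2 * D * τ.im) / (D * τ.im) * GS s D C r τ (h₁ z, h₂ z)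
          * (r * h₂' - h₁'))
      (-(Complex.I * s * Real.sqrt (2 * D * τ.im) / (D * τ.im) * GS s D C r τ (h₁ z, h₂ z)
          * conj (r * h₂' - h₁'))) z := by
  have h3 : HasFDerivAt (fun t : ℂ => (h₁ t, h₂ t)) _ z :=
    HasFDerivAt.prodMk (HasDerivAt.hasWirt H₁) (HasDerivAt.hasWirt H₂)
  refine ((hasFDerivAt_NH hs hD hC r hτ (h₁ z, h₂ z)).comp z h3).congr_fderiv ?_
  have hD' : (D : ℂ) ≠ 0 := by exact_mod_cast hD.ne'
  have hv' : (τ.im : ℂ) ≠ 0 := by exact_mod_cast hτ.ne'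
  have key : ∀ x : ℂ, ((shiftL D r τ.im (h₁' * x, h₂' * x) : ℝ) : ℂ) =
      ((r * h₂' - h₁') * x - conj (r * h₂' - h₁') * conj x) / (2 * Complex.I * (D * τ.im)) := by
    intro x
    rw [shiftL_apply]
    push_cast
    rw [im_eq_sub_conj, im_eq_sub_conj]
    simp only [map_sub, map_mul, Complex.conj_ofReal]
    field_simp
    ring
  ext x
  simp [key]
  field_simp
  ring_nf
  simp only [Complex.I_sq]
  ring

/-! ### Quasi-periodic entire functions -/

/-- Every point is congruent to one of a fundamental parallelogram, which lies in a compact disc of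
radius 1 + ‖τ‖. -/
lemma exists_bound_of_doubly_periodic {τ : ℂ} (hτ : 0 < τ.im) {g : ℂ → ℝ} (hg : Continuous g)
    (h1 : ∀ z, g (z + 1) = g z) (h2 : ∀ z, g (z + τ) = g z) : ∃ B, ∀ z, g z ≤ B := by
  have hK : IsCompact (Metric.closedBall (0 : ℂ) (1 + ‖τ‖)) := isCompact_closedBall _ _
  obtain ⟨B, hB⟩ := (hK.image hg).bddAbove
  refine ⟨B, fun z => ?_⟩
  have p1 : Function.Periodic g 1 := h1
  have p2 : Function.Periodic g τ := h2
  set m := ⌊z.im / τ.im⌋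
  set n := ⌊(z - m * τ).re - Int.fract (z.im / τ.im) * τ.re⌋
  have hz : g z = g (z - m * τ - n * 1) := by rw [p1.sub_int_mul_eq, p2.sub_int_mul_eq]
  rw [hz]
  refine hB ⟨_, ?_, rfl⟩
  rw [mem_closedBall_zero_iff]
  have hfr : z - m * τ - n * 1 = (Int.fract ((z - m * τ).re - Int.fract (z.im / τ.im) * τ.re) : ℝ)
      + (Int.fract (z.im / τ.im) : ℝ) * τ := by
    apply Complex.ext
    · have := Int.self_sub_floor ((z - m * τ).re - Int.fract (z.im / τ.im) * τ.re)
      rw [← this]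
      have hn : (n : ℝ) = ⌊(z - m * τ).re - Int.fract (z.im / τ.im) * τ.re⌋ := rfl
      rw [← hn]
      simp
      ring
    · have : Int.fract (z.im / τ.im) = z.im / τ.im - m := (Int.self_sub_floor _).symm
      rw [this]
      simp
      field_simp
  rw [hfr]
  refine (norm_add_le _ _).trans (add_le_add ?_ ?_)
  · rw [Complex.norm_real, Real.norm_eq_abs, abs_of_nonneg (Int.fract_nonneg _)]
    exact (Int.fract_lt_one _).le
  · rw [norm_mul, Complex.norm_real, Real.norm_eq_abs, abs_of_nonneg (Int.fract_nonneg _)]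
    exact mul_le_of_le_one_left (norm_nonneg _) (Int.fract_lt_one _).le

/-- A section of a non-trivial line bundle of degree `0` on the torus vanishes. -/
lemma eq_zero_of_degree_zero {τ u : ℂ} (hτ : 0 < τ.im) (hu : OffLattice u τ) {f : ℂ → ℂ}
    (hf : Differentiable ℂ f) (h1 : ∀ z, f (z + 1) = f z) (h2 : ∀ z, f (z + τ) = e (-u) * f z)
    (z : ℂ) : f z = 0 := by
  -- The real α for which ατ - u is real: multiplying by e(αz) makes both multipliers unimodular, so
  -- the modulus is doubly periodic. A nonzero constant would force both multipliers to be 1 and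
  -- place u in the lattice.
  set α : ℝ := u.im / τ.im with hα
  set h : ℂ → ℂ := fun z => e (α * z) * f z with hh
  have hd : Differentiable ℂ h :=
    (differentiable_e.comp (differentiable_id.const_mul (α : ℂ))).mul hf
  have hh1 : ∀ z, h (z + 1) = e α * h z := fun z => by
    simp only [hh, h1, mul_add, e_add]; ring_nf
  have hh2 : ∀ z, h (z + τ) = e (α * τ - u) * h z := fun z => by
    simp only [hh, h2, mul_add, e_add, sub_eq_add_neg]; ring
  have hn1 : ‖e (α : ℂ)‖ = 1 := by rw [norm_e]; simp
  have hn2 : ‖e (α * τ - u)‖ = 1 := by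
    rw [norm_e]
    have : ((α : ℂ) * τ - u).im = 0 := by
      simp [hα]; field_simp; ring
    simp [this]
  obtain ⟨B, hB⟩ := exists_bound_of_doubly_periodic hτ (g := fun z => ‖h z‖)
    hd.continuous.norm (fun z => by simp only [hh1, norm_mul, hn1, one_mul])
    (fun z => by simp only [hh2, norm_mul, hn2, one_mul])
  have hb : Bornology.IsBounded (Set.range h) :=
    isBounded_iff_forall_norm_le.2 ⟨B, by rintro _ ⟨z, rfl⟩; exact hB z⟩
  have hconst : ∀ z w, h z = h w := fun z w => hd.apply_eq_apply_of_bounded hb z w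
  have h0 : h z = 0 := by
    by_contra hne
    have t1 : e (α : ℂ) = 1 := by
      have := hh1 z
      rw [hconst (z + 1) z] at this
      exact mul_right_cancel₀ hne (by rw [← this, one_mul])
    have t2 : e (α * τ - u) = 1 := by
      have := hh2 z
      rw [hconst (z + τ) z] at this
      exact mul_right_cancel₀ hne (by rw [← this, one_mul])
    obtain ⟨m, hm⟩ := e_eq_one_iff.1 t1
    obtain ⟨n, hn⟩ := e_eq_one_iff.1 t2
    refine hu m (-n) ?_
    rw [← hm]
    push_cast
    linear_combination -hn
  exact (mul_eq_zero.1 h0).resolve_left (e_ne_zero _)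

/-- A section of a line bundle of negative degree on the torus vanishes. -/
lemma eq_zero_of_degree_neg {τ c : ℂ} (hτ : 0 < τ.im) {f : ℂ → ℂ}
    (hf : Differentiable ℂ f) (h1 : ∀ z, f (z + 1) = f z)
    (h2 : ∀ z, f (z + τ) = e (2 * z + c) * f z) (z : ℂ) : f z = 0 := by
  -- With these α and β, the weight exp(αy² + βy) exactly cancels the modulus of e(2z + c) under z ↦
  -- z + τ. Since α > 0, boundedness of the weighted modulus gives Gaussian decay of f in the
  -- imaginary direction.
  set α : ℝ := 2 * Real.pi / τ.im with hα
  set β : ℝ := (2 * Real.pi * c.im - α * τ.im ^ 2) / τ.im with hβ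
  have hα0 : 0 < α := by positivity
  obtain ⟨B, hB⟩ := exists_bound_of_doubly_periodic hτ
    (g := fun z => Real.exp (α * z.im ^ 2 + β * z.im) * ‖f z‖)
    ((Real.continuous_exp.comp (by fun_prop)).mul hf.continuous.norm)
    (fun z => by simp [h1]) (fun z => by
      simp only [h2, norm_mul, norm_e, ← mul_assoc, ← Real.exp_add]
      congr 2
      have : (2 * z + c).im = 2 * z.im + c.im := by simp
      rw [this, Complex.add_im, hβ, hα]
      field_simp
      ring)
  have hle : ∀ z, ‖f z‖ ≤ B * Real.exp (-(α * z.im ^ 2 + β * z.im)) := fun z => by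
    rw [Real.exp_neg, ← div_eq_mul_inv, le_div_iff₀ (Real.exp_pos _), mul_comm]
    exact hB z
  have hB0 : 0 ≤ B := (by positivity : 0 ≤ Real.exp (α * (0 : ℂ).im ^ 2 + β * (0 : ℂ).im) *
    ‖f 0‖).trans (hB 0)
  have hb : Bornology.IsBounded (Set.range f) := by
    refine isBounded_iff_forall_norm_le.2 ⟨B * Real.exp (β ^ 2 / (4 * α)), ?_⟩
    rintro _ ⟨w, rfl⟩
    refine (hle w).trans (mul_le_mul_of_nonneg_left (Real.exp_le_exp.2 ?_) hB0)
    rw [le_div_iff₀ (by positivity)]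
    nlinarith [sq_nonneg (2 * α * w.im + β)]
  have hlim : Tendsto (fun y : ℝ => B * Real.exp (-(α * y ^ 2 + β * y))) atTop (𝓝 0) := by
    rw [← mul_zero B]
    refine Tendsto.const_mul _ (Real.tendsto_exp_neg_atTop_nhds_zero.comp ?_)
    have : (fun y : ℝ => α * y ^ 2 + β * y) = fun y => y * (α * y + β) := by ext; ring
    rw [this]
    exact tendsto_id.atTop_mul_atTop₀
      (tendsto_atTop_add_const_right _ _ (tendsto_id.const_mul_atTop hα0))
  -- By Liouville f is constant, so its value can be read along the imaginary axis, where it decays.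
  have hz : Tendsto (fun _ : ℝ => ‖f z‖) atTop (𝓝 0) := by
    refine squeeze_zero (fun _ => norm_nonneg _) (fun y => ?_) hlim
    rw [hf.apply_eq_apply_of_bounded hb z (y * Complex.I)]
    simpa using hle (y * Complex.I)
  exact norm_eq_zero.1 (tendsto_nhds_unique tendsto_const_nhds hz)

/-! ### The Jacobi version of `F₃` -/

lemma norm_weight_fst_le (p : ℤ × ℤ) :
    ‖(p.1 : ℂ)‖ ≤ 1 * (1 + |(p.1 : ℝ)| + |(p.2 : ℝ)|) := by
  rw [Complex.norm_intCast]; linarith [abs_nonneg (p.2 : ℝ)]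

lemma norm_weight_snd_le (p : ℤ × ℤ) :
    ‖(p.2 : ℂ)‖ ≤ 1 * (1 + |(p.1 : ℝ)| + |(p.2 : ℝ)|) := by
  rw [Complex.norm_intCast]; linarith [abs_nonneg (p.1 : ℝ)]

lemma norm_weight_one_le (p : ℤ × ℤ) :
    ‖(1 : ℂ)‖ ≤ 1 * (1 + |(p.1 : ℝ)| + |(p.2 : ℝ)|) := by
  rw [norm_one]; linarith [abs_nonneg (p.1 : ℝ), abs_nonneg (p.2 : ℝ)]

/-- The form is indefinite, but on the two quadrants where the coefficient is nonzero ab ≥ 0, and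
there it is at least (a² + b²)/2. -/
lemma norm_F3JTerm_le {τ : ℂ} (hτ : 0 < τ.im) {M : ℝ} {x : ℂ × ℂ} (hx : ‖x‖ ≤ M) (p : ℤ × ℤ) :
    ‖F3JTerm x.1 x.2 τ p‖ ≤ majorant (2 * Real.pi * M) (Real.pi * τ.im) p := by
  by_cases h0 : orthantSign p = 0
  · rw [F3JTerm, h0, zero_mul, norm_zero]; exact majorant_nonneg _ _ _
  have hab : 0 ≤ (p.1 : ℝ) * p.2 ∧ ‖orthantSign p‖ = 1 := by
    unfold orthantSign at h0 ⊢
    split_ifs at h0 ⊢ with h1 h2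
    · exact ⟨mul_nonneg (by exact_mod_cast h1.1) (by exact_mod_cast h1.2), by simp⟩
    · exact ⟨mul_nonneg_of_nonpos_of_nonpos (by exact_mod_cast h2.1.le)
        (by exact_mod_cast h2.2.le), by simp⟩
    · simp at h0
  have h1 : |x.1.im| ≤ M := (Complex.abs_im_le_norm _).trans ((norm_fst_le x).trans hx)
  have h2 : |x.2.im| ≤ M := (Complex.abs_im_le_norm _).trans ((norm_snd_le x).trans hx)
  rw [F3JTerm, norm_mul, hab.2, one_mul, norm_e, majorant]
  apply Real.exp_le_exp.2
  set a : ℝ := (p.1 : ℝ)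
  set b : ℝ := (p.2 : ℝ)
  have him : ((p.1 : ℂ) * x.1 + p.2 * x.2 + (3 * (p.1 : ℂ) ^ 2 + (p.2 : ℂ) ^ 2 / 2
      + 3 * p.1 * p.2) * τ).im
      = a * x.1.im + b * x.2.im + (3 * a ^ 2 + b ^ 2 / 2 + 3 * a * b) * τ.im := by
    have : (3 * (p.1 : ℂ) ^ 2 + (p.2 : ℂ) ^ 2 / 2 + 3 * p.1 * p.2)
        = ((3 * a ^ 2 + b ^ 2 / 2 + 3 * a * b : ℝ) : ℂ) := by simp [a, b]
    have ha : (p.1 : ℂ) = (a : ℂ) := by simp [a]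
    have hb : (p.2 : ℂ) = (b : ℂ) := by simp [b]
    rw [this, ha, hb]
    simp only [Complex.add_im, Complex.im_ofReal_mul]
  rw [him]
  have e2 : -(a * x.1.im) ≤ |a| * M := by
    refine (neg_le_abs _).trans ?_
    rw [abs_mul]; gcongr
  have e3 : -(b * x.2.im) ≤ |b| * M := by
    refine (neg_le_abs _).trans ?_
    rw [abs_mul]; gcongr
  have e4 := mul_le_mul_of_nonneg_left (add_le_add e2 e3) (by positivity : 0 ≤ 2 * Real.pi)
  have e5 : 0 ≤ Real.pi * τ.im * (6 * (a * b) + 5 * a ^ 2) :=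
    mul_nonneg (by positivity) (by nlinarith [hab.1, sq_nonneg a])
  nlinarith

lemma summable_weight_F3JTerm {τ : ℂ} (hτ : 0 < τ.im) (z₁ z₂ : ℂ) {w : ℤ × ℤ → ℂ} {c₀ : ℝ}
    (hc₀ : 0 ≤ c₀) (hw : ∀ p, ‖w p‖ ≤ c₀ * (1 + |(p.1 : ℝ)| + |(p.2 : ℝ)|)) :
    Summable fun p => w p * F3JTerm z₁ z₂ τ p := by
  refine Summable.of_norm_bounded
    (g := fun p => c₀ * majorant (2 * Real.pi * ‖(z₁, z₂)‖ + 1) (Real.pi * τ.im) p)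
    ((summable_majorant _ (by positivity)).mul_left _) fun p => ?_
  rw [norm_mul]
  refine le_trans ?_ (weight_mul_majorant_le hc₀ p (hw p) _ _)
  gcongr
  exact norm_F3JTerm_le hτ (x := (z₁, z₂)) le_rfl p

lemma summable_F3JTerm {τ : ℂ} (hτ : 0 < τ.im) (z₁ z₂ : ℂ) : Summable (F3JTerm z₁ z₂ τ) := by
  simpa using summable_weight_F3JTerm hτ z₁ z₂ zero_le_one norm_weight_one_le

lemma hasFDerivAt_F3J {τ : ℂ} (hτ : 0 < τ.im) (x : ℂ × ℂ) :
    HasFDerivAt (fun w : ℂ × ℂ => F3J w.1 w.2 τ)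
      ((2 * Real.pi * Complex.I) •
        ((∑' p : ℤ × ℤ, p.1 * F3JTerm x.1 x.2 τ p) • ContinuousLinearMap.fst ℂ ℂ ℂ
          + (∑' p : ℤ × ℤ, p.2 * F3JTerm x.1 x.2 τ p) • ContinuousLinearMap.snd ℂ ℂ ℂ)) x := by
  set M := ‖x‖ + 1 with hM
  set K := 2 * Real.pi * M with hK
  set δ := Real.pi * τ.im with hδ
  have hδ0 : 0 < δ := by positivity
  have hx : x ∈ Metric.ball (0 : ℂ × ℂ) M := by simp [hM]
  have hd : ∀ (p : ℤ × ℤ) (y : ℂ × ℂ), HasFDerivAt (fun w : ℂ × ℂ => F3JTerm w.1 w.2 τ p)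
      ((2 * Real.pi * Complex.I : ℂ) • ((p.1 * F3JTerm y.1 y.2 τ p) • ContinuousLinearMap.fst ℂ ℂ ℂ
        + (p.2 * F3JTerm y.1 y.2 τ p) • ContinuousLinearMap.snd ℂ ℂ ℂ)) y := by
    intro p y
    have h1 : HasFDerivAt (fun x : ℂ × ℂ => (p.1 : ℂ) * x.1 + p.2 * x.2
        + (3 * (p.1 : ℂ) ^ 2 + (p.2 : ℂ) ^ 2 / 2 + 3 * p.1 * p.2) * τ)
      ((p.1 : ℂ) • ContinuousLinearMap.fst ℂ ℂ ℂ + (p.2 : ℂ) • ContinuousLinearMap.snd ℂ ℂ ℂ) y :=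
      ((hasFDerivAt_fst.const_mul _).add (hasFDerivAt_snd.const_mul _)).add_const _
    have h2 := ((hasDerivAt_e _).comp_hasFDerivAt y h1).const_mul (orthantSign p)
    refine h2.congr_fderiv ?_
    ext <;> simp [F3JTerm] <;> ring
  have hb : ∀ (p : ℤ × ℤ), ∀ y ∈ Metric.ball (0 : ℂ × ℂ) M,
      ‖(2 * Real.pi * Complex.I : ℂ) • ((p.1 * F3JTerm y.1 y.2 τ p) •
        ContinuousLinearMap.fst ℂ ℂ ℂ
        + (p.2 * F3JTerm y.1 y.2 τ p) • ContinuousLinearMap.snd ℂ ℂ ℂ)‖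
      ≤ 2 * Real.pi * (majorant (K + 1) δ p + majorant (K + 1) δ p) := by
    intro p y hy
    have hy' : ‖y‖ ≤ M := (mem_ball_zero_iff.1 hy).le
    have h0 := norm_F3JTerm_le hτ hy' p
    rw [norm_smul, show ‖(2 * Real.pi * Complex.I : ℂ)‖ = 2 * Real.pi by
      simp [abs_of_pos Real.pi_pos]]
    gcongr
    refine (norm_add_le _ _).trans (add_le_add ?_ ?_)
    · rw [norm_smul, norm_mul, Complex.norm_intCast]
      refine (mul_le_of_le_one_right (by positivity) (ContinuousLinearMap.norm_fst_le ..)).trans ?_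
      exact (mul_le_mul_of_nonneg_left h0 (abs_nonneg _)).trans (abs_fst_mul_majorant_le K δ p)
    · rw [norm_smul, norm_mul, Complex.norm_intCast]
      refine (mul_le_of_le_one_right (by positivity) (ContinuousLinearMap.norm_snd_le ..)).trans ?_
      exact (mul_le_mul_of_nonneg_left h0 (abs_nonneg _)).trans (abs_snd_mul_majorant_le K δ p)
  have hs := summable_majorant (K + 1) hδ0
  refine (hasFDerivAt_tsum_of_isPreconnected ((hs.add hs).mul_left _) Metric.isOpen_ball
    (convex_ball (0 : ℂ × ℂ) M).isPreconnected (fun p y _ => hd p y) hb hx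
    (summable_F3JTerm hτ x.1 x.2) hx).congr_fderiv ?_
  exact (((summable_weight_F3JTerm hτ x.1 x.2 zero_le_one norm_weight_fst_le).hasSum.smul_const
    _).add ((summable_weight_F3JTerm hτ x.1 x.2 zero_le_one
      norm_weight_snd_le).hasSum.smul_const _)).const_smul _ |>.tsum_eq

lemma hasDerivAt_F3J_fst {τ : ℂ} (hτ : 0 < τ.im) (z₁ z₂ : ℂ) :
    HasDerivAt (fun w => F3J w z₂ τ)
      (2 * Real.pi * Complex.I * ∑' p : ℤ × ℤ, p.1 * F3JTerm z₁ z₂ τ p) z₁ := by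
  have : HasFDerivAt (fun w => F3J w z₂ τ) _ z₁ :=
    HasFDerivAt.comp (g := fun w : ℂ × ℂ => F3J w.1 w.2 τ) (f := fun w => (w, z₂)) z₁
      (hasFDerivAt_F3J hτ (z₁, z₂)) (hasFDerivAt_prodMk_left (𝕜 := ℂ) z₁ z₂)
  exact this.hasDerivAt.congr_deriv (by simp)

lemma hasDerivAt_F3J_snd {τ : ℂ} (hτ : 0 < τ.im) (z₁ z₂ : ℂ) :
    HasDerivAt (fun w => F3J z₁ w τ)
      (2 * Real.pi * Complex.I * ∑' p : ℤ × ℤ, p.2 * F3JTerm z₁ z₂ τ p) z₂ := by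
  have : HasFDerivAt (fun w => F3J z₁ w τ) _ z₂ :=
    HasFDerivAt.comp (g := fun w : ℂ × ℂ => F3J w.1 w.2 τ) (f := fun w => (z₁, w)) z₂
      (hasFDerivAt_F3J hτ (z₁, z₂)) (hasFDerivAt_prodMk_right (𝕜 := ℂ) z₁ z₂)
  exact this.hasDerivAt.congr_deriv (by simp)

lemma F3Term_eq (τ : ℂ) (p : ℤ × ℤ) :
    F3Term τ p = e τ * ((2 * p.1 + p.2 + 1) * F3JTerm (3 * τ) (3 * τ / 2 + 1 / 2) τ p) := by
  rw [F3Term, F3JTerm, ← e_int_half]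
  have h : e ((3 * p.1 ^ 2 + 3 * p.1 * p.2 + 3 * p.1 + p.2 ^ 2 / 2 + 3 * p.2 / 2 + 1) * τ) * e (p.2 / 2)
      = e τ * e (p.1 * (3 * τ) + p.2 * (3 * τ / 2 + 1 / 2) +
        (3 * p.1 ^ 2 + p.2 ^ 2 / 2 + 3 * p.1 * p.2) * τ) := by
    rw [← e_add, ← e_add]; congr 1; ring
  linear_combination (orthantSign p * (2 * p.1 + p.2 + 1)) * h

lemma norm_weight_F3_le (p : ℤ × ℤ) :
    ‖(2 * p.1 + p.2 + 1 : ℂ)‖ ≤ 2 * (1 + |(p.1 : ℝ)| + |(p.2 : ℝ)|) := by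
  have h1 := norm_add_le (2 * p.1 + p.2 : ℂ) 1
  have h2 := norm_add_le (2 * p.1 : ℂ) (p.2 : ℂ)
  rw [norm_mul, Complex.norm_intCast, Complex.norm_intCast] at h2
  rw [norm_one] at h1
  rw [Complex.norm_ofNat] at h2
  linarith [abs_nonneg (p.2 : ℝ)]

lemma summable_F3Term {τ : ℂ} (hτ : 0 < τ.im) : Summable (F3Term τ) := by
  refine ((summable_weight_F3JTerm hτ (3 * τ) (3 * τ / 2 + 1 / 2) zero_le_two
    norm_weight_F3_le).mul_left (e τ)).congr fun p => (F3Term_eq τ p).symm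

/-- Combining three weighted sums. -/
lemma tsum_weights {t : ℤ × ℤ → ℂ} (h : Summable t) (h1 : Summable fun p => (p.1 : ℂ) * t p)
    (h2 : Summable fun p => (p.2 : ℂ) * t p) (α β γ : ℂ) :
    ∑' p : ℤ × ℤ, (α * p.1 + β * p.2 + γ) * t p =
      α * (∑' p : ℤ × ℤ, p.1 * t p) + β * (∑' p : ℤ × ℤ, p.2 * t p) + γ * ∑' p, t p := by
  rw [← tsum_mul_left, ← tsum_mul_left, ← tsum_mul_left,
    ← (h1.mul_left α).tsum_add (h2.mul_left β),
    ← ((h1.mul_left α).add (h2.mul_left β)).tsum_add (h.mul_left γ)]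
  exact tsum_congr fun p => by ring

lemma F3_eq_specialize {τ : ℂ} (hτ : 0 < τ.im) : F3 τ = specialize3 F3J τ := by
  rw [specialize3, (HasDerivAt.hasWirt (hasDerivAt_F3J_fst hτ _ _)).zetaD_eq,
    (HasDerivAt.hasWirt (hasDerivAt_F3J_snd hτ _ _)).zetaD_eq,
    mul_div_cancel_left₀ _ Complex.two_pi_I_ne_zero,
    mul_div_cancel_left₀ _ Complex.two_pi_I_ne_zero, F3]
  have h := tsum_weights (summable_F3JTerm hτ (3 * τ) (3 * τ / 2 + 1 / 2))
    (summable_weight_F3JTerm hτ _ _ zero_le_one norm_weight_fst_le)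
    (summable_weight_F3JTerm hτ _ _ zero_le_one norm_weight_snd_le) 2 1 1
  simp only [one_mul] at h
  rw [tsum_congr (F3Term_eq τ), tsum_mul_left, h, F3J]
  ring

/-! ### The completion of the Jacobi version of `F₃` -/

/-- The form 3a² + 3ab + b²/2 completes to a square in two ways: (b+3a)²/2 - 3a²/2 and 3(a+b/2)² -
b²/4. Each error function belongs to one of them, which explains the parameters (3, 1, 3) and, with
exchanged coordinates, (1/2, 6, 1/2). -/
lemma F3hatJTerm_eq (s : ℝ) {τ : ℂ} (hτ : 0 < τ.im) (z₁ z₂ : ℂ) (p : ℤ × ℤ) :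
    F3hatJTerm s z₁ z₂ τ p = 2 * F3JTerm z₁ z₂ τ p - nhTerm s 3 1 3 τ (z₁, z₂) p
      - nhTerm s (1 / 2) 6 (1 / 2) τ (z₂, z₁) p.swap := by
  have h1 : eTerm 3 1 3 τ (z₁, z₂) p
      = e (p.1 * z₁ + p.2 * z₂ + (3 * p.1 ^ 2 + p.2 ^ 2 / 2 + 3 * p.1 * p.2) * τ) := by
    rw [eTerm, qf]; congr 1; push_cast; ring
  have h2 : eTerm (1 / 2) 6 (1 / 2) τ (z₂, z₁) p.swap
      = e (p.1 * z₁ + p.2 * z₂ + (3 * p.1 ^ 2 + p.2 ^ 2 / 2 + 3 * p.1 * p.2) * τ) := by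
    rw [eTerm, qf]; congr 1; simp only [Prod.fst_swap, Prod.snd_swap]; push_cast; ring
  have h3 : errArg 3 3 τ (z₁, z₂) p.1
      = Real.sqrt (6 * τ.im) * (p.1 + (3 * z₂.im - z₁.im) / (3 * τ.im)) := by
    rw [errArg, shiftL_apply]; norm_num
  have h4 : errArg (1 / 2) (1 / 2) τ (z₂, z₁) p.2
      = Real.sqrt τ.im * (p.2 + (z₁.im - 2 * z₂.im) / τ.im) := by
    rw [errArg, shiftL_apply, show 2 * (1 / 2 : ℝ) * τ.im = τ.im by ring]
    congr 2
    field_simp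
  rw [F3hatJTerm, F3JTerm, nhTerm, nhTerm, h1, h2, h3, Prod.fst_swap, h4, orthantSign_eq]
  push_cast
  ring

lemma summable_F3hatJTerm {s : ℝ} (hs : 1 ≤ s) {τ : ℂ} (hτ : 0 < τ.im) (z₁ z₂ : ℂ) :
    Summable (F3hatJTerm s z₁ z₂ τ) := by
  refine Summable.congr ((((summable_F3JTerm hτ z₁ z₂).mul_left 2).sub
    (summable_nhTerm hs (by norm_num : (0 : ℝ) < 3) one_pos 3 hτ (z₁, z₂))).sub
    ((Equiv.prodComm ℤ ℤ).summable_iff.2 (summable_nhTerm hs (by norm_num : (0 : ℝ) < 1 / 2)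
      (by norm_num : (0 : ℝ) < 6) (1 / 2) hτ (z₂, z₁)))) fun p => ?_
  rw [F3hatJTerm_eq s hτ]
  rfl

lemma F3hatJ_eq {s : ℝ} (hs : 1 ≤ s) {τ : ℂ} (hτ : 0 < τ.im) (z₁ z₂ : ℂ) :
    F3hatJ s z₁ z₂ τ = F3J z₁ z₂ τ - 1 / 2 * NH s 3 1 3 τ (z₁, z₂)
      - 1 / 2 * NH s (1 / 2) 6 (1 / 2) τ (z₂, z₁) := by
  have s1 := (summable_F3JTerm hτ z₁ z₂).mul_left 2
  have s2 := summable_nhTerm hs (by norm_num : (0 : ℝ) < 3) one_pos 3 hτ (z₁, z₂)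
  have s3 := summable_nhTerm hs (by norm_num : (0 : ℝ) < 1 / 2)
      (by norm_num : (0 : ℝ) < 6) (1 / 2) hτ (z₂, z₁)
  have key : ∑' p, F3hatJTerm s z₁ z₂ τ p = _ := (tsum_congr (F3hatJTerm_eq s hτ z₁ z₂)).trans
    ((s1.hasSum.sub s2.hasSum).sub ((Equiv.prodComm ℤ ℤ).hasSum_iff.2 s3.hasSum)).tsum_eq
  rw [F3hatJ, key, tsum_mul_left, F3J, NH, NH]
  ring

lemma differentiableAt_NH {s D C : ℝ} (hs : 1 ≤ s) (hD : 0 < D) (hC : 0 < C) (r : ℝ) {τ : ℂ}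
    (hτ : 0 < τ.im) (x : ℂ × ℂ) : DifferentiableAt ℝ (NH s D C r τ) x :=
  (hasFDerivAt_NH hs hD hC r hτ x).differentiableAt

lemma differentiableAt_F3hatJ {s : ℝ} (hs : 1 ≤ s) {τ : ℂ} (hτ : 0 < τ.im) (p : ℂ × ℂ) :
    DifferentiableAt ℝ (fun w : ℂ × ℂ => F3hatJ s w.1 w.2 τ) p := by
  simp only [F3hatJ_eq hs hτ]
  have h1 : DifferentiableAt ℝ (fun w : ℂ × ℂ => F3J w.1 w.2 τ) p :=
    (hasFDerivAt_F3J hτ p).differentiableAt.restrictScalars ℝ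
  have h2 := differentiableAt_NH hs (by norm_num : (0 : ℝ) < 3) one_pos 3 hτ p
  have h3 : DifferentiableAt ℝ (fun w : ℂ × ℂ => NH s (1 / 2) 6 (1 / 2) τ (w.2, w.1)) p :=
    DifferentiableAt.comp (g := NH s (1 / 2) 6 (1 / 2) τ) p
      (differentiableAt_NH hs (by norm_num) (by norm_num) _ hτ _)
      (differentiableAt_snd.prodMk differentiableAt_fst)
  exact (h1.sub (h2.const_mul _)).sub (h3.const_mul _)

/-! ### Elliptic transformations of the completion of `F₃` -/

lemma F3hatJ_elliptic (s : ℝ) {τ : ℂ} (hτ : 0 < τ.im) (n₁ n₂ m₁ m₂ : ℤ) (z₁ z₂ : ℂ) :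
    F3hatJ s (z₁ + (6 * n₁ + 3 * n₂) * τ + m₁) (z₂ + (3 * n₁ + n₂) * τ + m₂) τ =
      e (-(n₁ * z₁ + n₂ * z₂) - (3 * n₁ ^ 2 + 3 * n₁ * n₂ + n₂ ^ 2 / 2) * τ) *
        F3hatJ s z₁ z₂ τ := by
  rw [F3hatJ, F3hatJ, mul_left_comm]
  congr 1
  rw [← tsum_mul_left]
  refine Eq.trans ?_ ((Equiv.addRight ((n₁, n₂) : ℤ × ℤ)).tsum_eq _)
  refine tsum_congr fun p => ?_
  simp only [Equiv.coe_addRight, F3hatJTerm, Prod.fst_add, Prod.snd_add]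
  rw [mul_left_comm (e _), ← e_add]
  congr 1
  · have i1 : (z₁ + (6 * n₁ + 3 * n₂) * τ + m₁).im = z₁.im + (6 * n₁ + 3 * n₂) * τ.im := by simp
    have i2 : (z₂ + (3 * n₁ + n₂) * τ + m₂).im = z₂.im + (3 * n₁ + n₂) * τ.im := by simp
    rw [i1, i2]
    have k1 : (p.1 : ℝ) + (3 * (z₂.im + (3 * n₁ + n₂) * τ.im) - (z₁.im + (6 * n₁ + 3 * n₂) * τ.im))
        / (3 * τ.im) = ((p.1 + n₁ : ℤ) : ℝ) + (3 * z₂.im - z₁.im) / (3 * τ.im) := by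
      push_cast; field_simp; ring
    have k2 : (p.2 : ℝ) + ((z₁.im + (6 * n₁ + 3 * n₂) * τ.im) - 2 * (z₂.im + (3 * n₁ + n₂) * τ.im))
        / τ.im = ((p.2 + n₂ : ℤ) : ℝ) + (z₁.im - 2 * z₂.im) / τ.im := by
      push_cast; field_simp; ring
    rw [k1, k2]
  · refine e_eq_of_sub_eq_int (p.1 * m₁ + p.2 * m₂) ?_
    push_cast; ring

lemma F3hatJ_add_one (s : ℝ) (z₁ z₂ τ : ℂ) :
    F3hatJ s z₁ z₂ (τ + 1) = F3hatJ s z₁ (z₂ + 1 / 2) τ := by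
  rw [F3hatJ, F3hatJ]
  congr 1
  refine tsum_congr fun p => ?_
  simp only [F3hatJTerm]
  congr 1
  · simp
  -- Modulo 1, b²/2 equals b/2, so the translation of τ acts as the half period 1/2 in z₂.
  · obtain ⟨k, hk⟩ : Even (p.2 ^ 2 - p.2) := by
      rw [sq, ← mul_sub_one]; exact Int.even_mul_pred_self _
    refine e_eq_of_sub_eq_int (3 * p.1 ^ 2 + 3 * p.1 * p.2 + k) ?_
    have hk' : (p.2 : ℂ) ^ 2 - p.2 = k + k := by exact_mod_cast hk
    push_cast
    linear_combination hk' / 2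

lemma F3hatJ_neg (s : ℝ) (z₁ z₂ τ : ℂ) : F3hatJ s (-z₁) (-z₂) τ = -F3hatJ s z₁ z₂ τ := by
  rw [F3hatJ, F3hatJ, ← mul_neg]
  congr 1
  rw [← tsum_neg, ← (Equiv.neg (ℤ × ℤ)).tsum_eq]
  refine tsum_congr fun p => ?_
  simp only [Equiv.neg_apply, F3hatJTerm, Prod.fst_neg, Prod.snd_neg]
  rw [← neg_mul, ← Complex.ofReal_neg, neg_add, ← E_neg, ← E_neg]
  congr 2
  · simp only [Complex.neg_im]; push_cast; ring_nf
  · push_cast; ring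

/-! ### Regrouping the dual lattice -/

/-- Translating the lattice by δ is the same as translating x by Aδ·τ, with A the Gram matrix of Q,
up to e(δ·x + Q(δ)τ). It turns a coset of the lattice into a translate of the elliptic variables. -/
lemma gR_add (C r : ℝ) {D : ℝ} (hD : 0 < D) {τ : ℂ} (hτ : 0 < τ.im) (x : ℂ × ℂ)
    (a b δa δb : ℝ) :
    gR D C r τ x (a + δa) (b + δb) =
      e (δa * x.1 + δb * x.2 + (qf D C r δa δb : ℝ) * τ) *
        gR D C r τ (x.1 + (C * r * (δb + r * δa) - D * δa : ℝ) * τ,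
          x.2 + (C * (δb + r * δa) : ℝ) * τ) a b := by
  have hL : shiftL D r τ.im (x.1 + (C * r * (δb + r * δa) - D * δa : ℝ) * τ,
          x.2 + (C * (δb + r * δa) : ℝ) * τ) = shiftL D r τ.im x + δa := by
    rw [shiftL_apply, shiftL_apply]
    simp only [Complex.add_im, Complex.im_ofReal_mul]
    field_simp
    ring
  rw [gR, gR, e, hL, ← Complex.exp_add]
  congr 1
  simp only [qf]
  push_cast
  ring

lemma tsum_tsum_regroup {n : ℕ} {F : ℤ → ℤ → ℂ} (φ : Fin n × (ℤ × ℤ) ≃ ℤ × ℤ)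
    (h : ∀ k, Summable fun p : ℤ × ℤ => F (φ (k, p)).1 (φ (k, p)).2) :
    ∑' m : ℤ, ∑' l : ℤ, F m l = ∑ k : Fin n, ∑' p : ℤ × ℤ, F (φ (k, p)).1 (φ (k, p)).2 := by
  have h1 : Summable fun x : Fin n × (ℤ × ℤ) => F (φ x).1 (φ x).2 := by
    refine Summable.of_norm ((summable_prod_of_nonneg fun _ => norm_nonneg _).2 ⟨fun k => ?_, ?_⟩)
    · exact (h k).norm
    · exact (hasSum_fintype _).summable
  have h2 : Summable fun p : ℤ × ℤ => F p.1 p.2 := by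
    rw [← φ.summable_iff]; exact h1
  have h3 := h2.tsum_prod
  rw [← h3, ← φ.tsum_eq, h1.tsum_prod, tsum_fintype]

/-- The dual lattice of the form `3a² + 3ab + b²/2` as a union of three cosets. -/
def dualEquivFst : Fin 3 × (ℤ × ℤ) ≃ ℤ × ℤ where
  toFun x := (-x.2.2 - 3 * x.2.1, 3 * (-x.2.2 - 2 * x.2.1) - x.1)
  invFun y := (⟨((-y.2) % 3).toNat, by omega⟩, (-(-y.2 / 3) - y.1, 2 * y.1 + 3 * (-y.2 / 3)))
  left_inv := by
    rintro ⟨⟨k, hk⟩, a, b⟩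
    simp only [Prod.mk.injEq, Fin.mk.injEq]
    refine ⟨?_, ?_, ?_⟩ <;> omega
  right_inv := by
    rintro ⟨m, l⟩
    simp only [Prod.mk.injEq]
    constructor <;> omega

/-- The same decomposition, with the two coordinates exchanged. -/
def dualEquivSnd : Fin 3 × (ℤ × ℤ) ≃ ℤ × ℤ where
  toFun x := (3 * (-x.2.1 - 2 * x.2.2) - x.1, -x.2.1 - 3 * x.2.2)
  invFun y := (⟨((-y.1) % 3).toNat, by omega⟩, (2 * y.2 + 3 * (-y.1 / 3), -(-y.1 / 3) - y.2))
  left_inv := by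
    rintro ⟨⟨k, hk⟩, a, b⟩
    simp only [Prod.mk.injEq, Fin.mk.injEq]
    refine ⟨?_, ?_, ?_⟩ <;> omega
  right_inv := by
    rintro ⟨m, l⟩
    simp only [Prod.mk.injEq]
    constructor <;> omega

/-! ### The inversion for `F₃` -/

lemma summable_gR {D C : ℝ} (hD : 0 < D) (hC : 0 < C) (r : ℝ) {τ : ℂ} (hτ : 0 < τ.im)
    (x : ℂ × ℂ) : Summable fun p : ℤ × ℤ => gR D C r τ x p.1 p.2 :=
  (summable_gTerm le_rfl hD hC r hτ x).congr (gTerm_one_eq hD C r hτ x)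

lemma GS_one_eq {D : ℝ} (hD : 0 < D) (C r : ℝ) {τ : ℂ} (hτ : 0 < τ.im) (x : ℂ × ℂ) :
    GS 1 D C r τ x = ∑' p : ℤ × ℤ, gR D C r τ x p.1 p.2 :=
  tsum_congr (gTerm_one_eq hD C r hτ x)

/-- The form `-z₁²/6 + z₁z₂ - z₂²`. -/
noncomputable def Q3 (z₁ z₂ : ℂ) : ℂ := -z₁ ^ 2 / 6 + z₁ * z₂ - z₂ ^ 2

/-- The lattice has index 3 in its dual, with coset representatives (-k/3, k). The Gram matrix sends
such a vector to (k, 0), so each coset contributes the translate z₁ + kτ with z₂ unchanged. -/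
lemma GS_F3_fst {τ : ℂ} (hτ : 0 < τ.im) (z₁ z₂ : ℂ) :
    GS 1 3 1 3 (-1 / τ) (z₁ / τ, z₂ / τ) = (‖τ‖ / Real.sqrt 3 : ℝ) * ∑ k : Fin 3,
      e (Q3 (z₁ + k * τ) z₂ / τ) * GS 1 3 1 3 τ (z₁ + k * τ, z₂) := by
  have h0 : τ ≠ 0 := by rintro rfl; simp at hτ
  have h3 : (0 : ℝ) < 3 := by norm_num
  have hterm : ∀ (k : Fin 3) (p : ℤ × ℤ), e ((z₂ ^ 2 / (2 * (1 : ℝ)) - (z₁ - (3 : ℝ) * z₂) ^ 2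
        / (2 * (3 : ℝ))) / τ) *
        gR 3 1 3 τ (z₁, z₂) (((dualEquivFst (k, p)).2 - (dualEquivFst (k, p)).1 * 3) / 3)
          (-(dualEquivFst (k, p)).1 / 1
            - 3 * (((dualEquivFst (k, p)).2 - (dualEquivFst (k, p)).1 * 3) / 3)) =
      e (Q3 (z₁ + k * τ) z₂ / τ) * gR 3 1 3 τ (z₁ + k * τ, z₂) p.1 p.2 := by
    intro k p
    have ha : (((dualEquivFst (k, p)).2 : ℝ) - (dualEquivFst (k, p)).1 * 3) / 3
        = p.1 + (-k / 3) := by simp only [dualEquivFst, Equiv.coe_fn_mk]; push_cast; ring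
    have hb : (-(dualEquivFst (k, p)).1 : ℝ) / 1 - 3 * (p.1 + (-k / 3)) = p.2 + k := by
      simp only [dualEquivFst, Equiv.coe_fn_mk]; push_cast; ring
    rw [ha, hb, gR_add 1 3 h3 hτ, ← mul_assoc, ← e_add]
    congr 2
    · simp only [Q3, qf]; push_cast; field_simp; ring
    · push_cast; ring_nf
  rw [GS_neg_inv h3 one_pos 3 hτ (z₁, z₂), one_mul, mul_assoc]
  congr 1
  simp only [← tsum_mul_left]
  rw [tsum_tsum_regroup dualEquivFst (F := fun m l => e ((z₂ ^ 2 / (2 * (1 : ℝ)) - (z₁ - (3 : ℝ)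
    * z₂) ^ 2 / (2 * (3 : ℝ))) / τ) *
        gR 3 1 3 τ (z₁, z₂) ((l - m * 3) / 3) (-m / 1 - 3 * ((l - m * 3) / 3)))]
  · refine Finset.sum_congr rfl fun k _ => ?_
    rw [tsum_congr (hterm k), tsum_mul_left, GS_one_eq h3 1 3 hτ]
  · intro k
    simp only [hterm]
    exact (summable_gR h3 one_pos 3 hτ _).mul_left _

/-- The same three cosets in exchanged coordinates, so that the two Gaussian sums acquire identical
translates and factors and can be combined in `F3dbar_neg_inv`. -/
lemma GS_F3_snd {τ : ℂ} (hτ : 0 < τ.im) (z₁ z₂ : ℂ) :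
    GS 1 (1 / 2) 6 (1 / 2) (-1 / τ) (z₂ / τ, z₁ / τ) = (‖τ‖ / Real.sqrt 3 : ℝ) * ∑ k : Fin 3,
      e (Q3 (z₁ + k * τ) z₂ / τ) * GS 1 (1 / 2) 6 (1 / 2) τ (z₂, z₁ + k * τ) := by
  have h0 : τ ≠ 0 := by rintro rfl; simp at hτ
  have h3 : (0 : ℝ) < 1 / 2 := by norm_num
  have h6 : (0 : ℝ) < 6 := by norm_num
  have hterm : ∀ (k : Fin 3) (p : ℤ × ℤ), e ((z₁ ^ 2 / (2 * (6 : ℝ)) - (z₂ - (1 / 2 : ℝ) * z₁) ^ 2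
        / (2 * (1 / 2 : ℝ))) / τ) *
        gR (1 / 2) 6 (1 / 2) τ (z₂, z₁) (((dualEquivSnd (k, p)).2
            - (dualEquivSnd (k, p)).1 * (1 / 2)) / (1 / 2))
          (-(dualEquivSnd (k, p)).1 / 6
            - 1 / 2 * (((dualEquivSnd (k, p)).2 - (dualEquivSnd (k, p)).1 * (1 / 2)) / (1 / 2))) =
      e (Q3 (z₁ + k * τ) z₂ / τ) * gR (1 / 2) 6 (1 / 2) τ (z₂, z₁ + k * τ) p.1 p.2 := by
    intro k p
    have ha : (((dualEquivSnd (k, p)).2 : ℝ) - (dualEquivSnd (k, p)).1 * (1 / 2)) / (1 / 2)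
        = p.1 + k := by simp only [dualEquivSnd, Equiv.coe_fn_mk]; push_cast; ring
    have hb : (-(dualEquivSnd (k, p)).1 : ℝ) / 6 - 1 / 2 * (p.1 + k) = p.2 + (-k / 3) := by
      simp only [dualEquivSnd, Equiv.coe_fn_mk]; push_cast; ring
    rw [ha, hb, gR_add 6 (1 / 2) h3 hτ, ← mul_assoc, ← e_add]
    congr 2
    · simp only [Q3, qf]; push_cast; field_simp; ring
    · push_cast; ring_nf
  rw [GS_neg_inv h3 h6 (1 / 2) hτ (z₂, z₁), show (6 * (1 / 2) : ℝ) = 3 by norm_num, mul_assoc]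
  congr 1
  simp only [← tsum_mul_left]
  rw [tsum_tsum_regroup dualEquivSnd (F := fun m l => e ((z₁ ^ 2 / (2 * (6 : ℝ)) - (z₂ -
    (1 / 2 : ℝ) * z₁) ^ 2 / (2 * (1 / 2 : ℝ))) / τ) * gR (1 / 2) 6 (1 / 2) τ (z₂, z₁)
      ((l - m * (1 / 2)) / (1 / 2)) (-m / 6 - 1 / 2 * ((l - m * (1 / 2)) / (1 / 2))))]
  · refine Finset.sum_congr rfl fun k _ => ?_
    rw [tsum_congr (hterm k), tsum_mul_left, GS_one_eq h3 6 (1 / 2) hτ]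
  · intro k
    simp only [hterm]
    exact (summable_gR h3 h6 (1 / 2) hτ _).mul_left _

lemma sqrt_div_self_im {c v : ℝ} (hc : 0 ≤ c) (hv : 0 < v) :
    Real.sqrt (c * v) / v = Real.sqrt c / Real.sqrt v := by
  rw [Real.sqrt_mul hc, div_eq_div_iff hv.ne' (Real.sqrt_pos.2 hv).ne', mul_assoc,
    Real.mul_self_sqrt hv.le]

lemma inv_sqrt_im_neg_inv {τ : ℂ} (hτ : 0 < τ.im) :
    1 / Real.sqrt (-1 / τ).im = ‖τ‖ / Real.sqrt τ.im := by
  have h0 : τ ≠ 0 := by rintro rfl; simp at hτ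
  have h : (-1 / τ).im = τ.im / ‖τ‖ ^ 2 := by
    rw [Complex.div_im, Complex.normSq_eq_norm_sq]; simp [neg_div]
  rw [h, Real.sqrt_div hτ.le, Real.sqrt_sq (norm_nonneg _), one_div_div]

/-- The antiholomorphic derivative of `F̂₃` in `z₂`. -/
noncomputable def F3dbar (z₁ z₂ τ : ℂ) : ℂ :=
  Complex.I / (Real.sqrt τ.im : ℝ) * ((Real.sqrt 6 / 2 : ℝ) * GS 1 3 1 3 τ (z₁, z₂)
    - GS 1 (1 / 2) 6 (1 / 2) τ (z₂, z₁))

lemma hasWirt_F3hatJ_snd {τ : ℂ} (hτ : 0 < τ.im) (z₁ z₂ : ℂ) :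
    ∃ p, HasWirt (fun w => F3hatJ 1 z₁ w τ) p (F3dbar z₁ z₂ τ) z₂ := by
  simp only [F3hatJ_eq le_rfl hτ]
  have h1 := HasDerivAt.hasWirt (hasDerivAt_F3J_snd hτ z₁ z₂)
  have h2 := (hasWirt_NH le_rfl (by norm_num : (0 : ℝ) < 3) one_pos 3 hτ (hasDerivAt_const z₂ z₁)
    (hasDerivAt_id z₂)).const_mul (1 / 2)
  have h3 := (hasWirt_NH le_rfl (by norm_num : (0 : ℝ) < 1 / 2) (by norm_num : (0 : ℝ) < 6)
    (1 / 2) hτ (hasDerivAt_id z₂) (hasDerivAt_const z₂ z₁)).const_mul (1 / 2)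
  refine ⟨_, ((h1.sub h2).sub h3).congr_deriv rfl ?_⟩
  have k1 := congrArg (fun x : ℝ => (x : ℂ))
    (sqrt_div_self_im (by norm_num : (0 : ℝ) ≤ 6) hτ)
  have k2 := congrArg (fun x : ℝ => (x : ℂ)) (sqrt_div_self_im zero_le_one hτ)
  simp only [Real.sqrt_one, one_mul, Complex.ofReal_div, Complex.ofReal_one] at k1 k2
  have hv' : (τ.im : ℂ) ≠ 0 := by exact_mod_cast hτ.ne'
  rw [F3dbar, show 2 * 3 * τ.im = 6 * τ.im by ring, show 2 * (1 / 2) * τ.im = τ.im by ring]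
  simp only [id, Complex.conj_ofReal, map_neg, map_one, mul_zero, mul_one, sub_zero, zero_sub]
  generalize GS 1 3 1 3 τ (z₁, z₂) = A
  generalize GS 1 (1 / 2) 6 (1 / 2) τ (z₂, z₁) = B
  push_cast
  linear_combination (Complex.I / 2 * A) * k1 - Complex.I * B * k2

/-- One factor |τ| comes from 1/√v and another from Poisson summation; with 1/τ̄ from the chain rule
they make |τ|²/τ̄ = τ, the weight 1 of the completion itself. -/
lemma F3dbar_neg_inv {τ : ℂ} (hτ : 0 < τ.im) (z₁ z₂ : ℂ) :
    F3dbar (z₁ / τ) (z₂ / τ) (-1 / τ) * conj (1 / τ) =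
      τ / (Real.sqrt 3 : ℝ) * ∑ k : Fin 3, e (Q3 (z₁ + k * τ) z₂ / τ) * F3dbar (z₁ + k * τ) z₂ τ := by
  have h0 : τ ≠ 0 := by rintro rfl; simp at hτ
  have hc0 : conj τ ≠ 0 := by simpa using h0
  have k1 := congrArg (fun x : ℝ => (x : ℂ)) (inv_sqrt_im_neg_inv hτ)
  simp only [Complex.ofReal_div, Complex.ofReal_one] at k1
  have k2 : (‖τ‖ : ℂ) * ‖τ‖ = τ * conj τ := by rw [Complex.mul_conj', sq]
  simp only [F3dbar]
  rw [GS_F3_fst hτ, GS_F3_snd hτ, div_eq_mul_one_div Complex.I, k1]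
  have hs : ∀ k : Fin 3, e (Q3 (z₁ + k * τ) z₂ / τ) * (Complex.I / (Real.sqrt τ.im : ℝ) *
      ((Real.sqrt 6 / 2 : ℝ) * GS 1 3 1 3 τ (z₁ + k * τ, z₂)
        - GS 1 (1 / 2) 6 (1 / 2) τ (z₂, z₁ + k * τ))) =
      Complex.I / (Real.sqrt τ.im : ℝ) * ((Real.sqrt 6 / 2 : ℝ) *
        (e (Q3 (z₁ + k * τ) z₂ / τ) * GS 1 3 1 3 τ (z₁ + k * τ, z₂))
        - e (Q3 (z₁ + k * τ) z₂ / τ) * GS 1 (1 / 2) 6 (1 / 2) τ (z₂, z₁ + k * τ)) := by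
    intro k; ring
  rw [Finset.sum_congr rfl fun k _ => hs k, ← Finset.mul_sum, Finset.sum_sub_distrib,
    ← Finset.mul_sum]
  generalize ∑ k : Fin 3, e (Q3 (z₁ + k * τ) z₂ / τ) * GS 1 3 1 3 τ (z₁ + k * τ, z₂) = A
  generalize ∑ k : Fin 3, e (Q3 (z₁ + k * τ) z₂ / τ) * GS 1 (1 / 2) 6 (1 / 2) τ (z₂, z₁ + k * τ)
    = B
  rw [map_div₀, map_one]
  push_cast
  have e1 : (Complex.I * (‖τ‖ / (Real.sqrt τ.im : ℂ)) * ((Real.sqrt 6 : ℂ) / 2 *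
      (‖τ‖ / (Real.sqrt 3 : ℂ) * A) - ‖τ‖ / (Real.sqrt 3 : ℂ) * B)) * (1 / conj τ) =
      (‖τ‖ * ‖τ‖ / conj τ) * (Complex.I / (Real.sqrt τ.im : ℂ) / (Real.sqrt 3 : ℂ) *
        ((Real.sqrt 6 : ℂ) / 2 * A - B)) := by ring
  rw [e1, k2, mul_div_cancel_right₀ _ hc0]
  ring

/-- The behaviour of `F̂₃(z₁,z₂;τ)` under `τ ↦ -1/τ`. -/
lemma F3hatJ_neg_inv {τ : ℂ} (hτ : 0 < τ.im) (z₁ z₂ : ℂ) :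
    F3hatJ 1 (z₁ / τ) (z₂ / τ) (-1 / τ) = τ / (Real.sqrt 3 : ℝ) * ∑ k : Fin 3,
      e (Q3 (z₁ + k * τ) z₂ / τ) * F3hatJ 1 (z₁ + k * τ) z₂ τ := by
  have h0 : τ ≠ 0 := by rintro rfl; simp at hτ
  have hτ' := neg_inv_im_pos hτ
  -- The exponential in front makes the difference of the two sides exactly 1-periodic in w, as the
  -- vanishing criterion requires.
  set f : ℂ → ℂ := fun w => e (-(Q3 z₁ w / τ)) * (F3hatJ 1 (z₁ / τ) (w / τ) (-1 / τ)
    - τ / (Real.sqrt 3 : ℝ) * ∑ k : Fin 3,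
      e (Q3 (z₁ + k * τ) w / τ) * F3hatJ 1 (z₁ + k * τ) w τ) with hf
  have hQ : ∀ z w : ℂ, HasDerivAt (fun w => Q3 z w / τ) ((z - 2 * w) / τ) w := by
    intro z w
    have := (((hasDerivAt_id w).const_mul z).const_add (-z ^ 2 / 6)).sub ((hasDerivAt_id w).pow 2)
    refine (this.div_const τ).congr_deriv ?_
    simp
  have hd : Differentiable ℂ f := by
    intro w
    obtain ⟨p, hp⟩ := hasWirt_F3hatJ_snd hτ' (z₁ / τ) (w / τ)
    have h1 := HasWirt.comp (h := fun w => w / τ) hp ((hasDerivAt_id w).div_const τ)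
    choose p' hp' using fun k : Fin 3 => hasWirt_F3hatJ_snd hτ (z₁ + k * τ) w
    have h2 := fun k : Fin 3 =>
      HasWirt.mul_left ((hasDerivAt_e _).comp w (hQ (z₁ + k * τ) w)) (hp' k)
    have h3 := (HasWirt.sum (s := Finset.univ) fun k _ => h2 k).const_mul
      (τ / (Real.sqrt 3 : ℝ))
    have h4 := HasWirt.mul_left ((hasDerivAt_e _).comp w (hQ z₁ w).neg) (h1.sub h3)
    refine (h4.congr_deriv rfl ?_).differentiableAt
    simp only [Function.comp_apply]
    rw [F3dbar_neg_inv hτ, sub_self, mul_zero]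
  have hp1 : ∀ w, f (w + 1) = f w := by
    intro w
    have e1 : F3hatJ 1 (z₁ / τ) ((w + 1) / τ) (-1 / τ)
        = e ((z₁ - 2 * w - 1) / τ) * F3hatJ 1 (z₁ / τ) (w / τ) (-1 / τ) := by
      -- The vector (-1, 2) solves 6n₁ + 3n₂ = 0 and 3n₁ + n₂ = -1: it moves z₂ alone, by minus the
      -- modulus -1/τ, that is by +1/τ.
      have := F3hatJ_elliptic 1 hτ' (-1) 2 0 0 (z₁ / τ) (w / τ)
      convert this using 2
      · push_cast; ring
      · push_cast; ring
      · congr 1; push_cast; field_simp; ring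
    have e2 : ∀ k : Fin 3, F3hatJ 1 (z₁ + k * τ) (w + 1) τ = F3hatJ 1 (z₁ + k * τ) w τ := by
      intro k
      have := F3hatJ_elliptic 1 hτ 0 0 0 1 (z₁ + k * τ) w
      simpa [e_zero] using this
    have e3 : ∀ k : Fin 3, e (Q3 (z₁ + k * τ) (w + 1) / τ)
        = e ((z₁ - 2 * w - 1) / τ) * e (Q3 (z₁ + k * τ) w / τ) := by
      intro k
      rw [← e_add]
      refine e_eq_of_sub_eq_int k ?_
      simp only [Q3]; push_cast; field_simp; ring
    have e4 : e (-(Q3 z₁ (w + 1) / τ)) * e ((z₁ - 2 * w - 1) / τ) = e (-(Q3 z₁ w / τ)) := by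
      rw [← e_add]; congr 1; simp only [Q3]; field_simp; ring
    simp only [hf, e1, e2, e3, mul_assoc, ← Finset.mul_sum]
    rw [← e4]
    ring
  have hp2 : ∀ w, f (w + τ) = e (2 * w + (τ - z₁)) * f w := by
    intro w
    have e1 : F3hatJ 1 (z₁ / τ) ((w + τ) / τ) (-1 / τ) = F3hatJ 1 (z₁ / τ) (w / τ) (-1 / τ) := by
      have := F3hatJ_elliptic 1 hτ' 0 0 0 1 (z₁ / τ) (w / τ)
      rw [add_div, div_self h0]
      simpa [e_zero] using this
    have e2 : ∀ k : Fin 3, e (Q3 (z₁ + k * τ) (w + τ) / τ) * F3hatJ 1 (z₁ + k * τ) (w + τ) τ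
        = e (Q3 (z₁ + k * τ) w / τ) * F3hatJ 1 (z₁ + k * τ) w τ := by
      intro k
      have := F3hatJ_elliptic 1 hτ 1 (-2) 0 0 (z₁ + k * τ) w
      have h : F3hatJ 1 (z₁ + k * τ) (w + τ) τ =
          e (2 * w - (z₁ + k * τ) + τ) * F3hatJ 1 (z₁ + k * τ) w τ := by
        convert this using 2
        · push_cast; ring
        · push_cast; ring
        · congr 1; push_cast; ring
      rw [h, ← mul_assoc, ← e_add]
      congr 2
      simp only [Q3]; field_simp; ring
    have e4 : e (-(Q3 z₁ (w + τ) / τ)) = e (2 * w + (τ - z₁)) * e (-(Q3 z₁ w / τ)) := by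
      rw [← e_add]; congr 1; simp only [Q3]; field_simp; ring
    simp only [hf, e1, e2, e4, mul_assoc]
  have := eq_zero_of_degree_neg hτ hd hp1 hp2 z₂
  exact sub_eq_zero.1 ((mul_eq_zero.1 this).resolve_left (e_ne_zero _))

/-! ### The Jacobi version of `F₂` in the strip `0 < Im z₂ < Im τ` -/

lemma summable_exp_neg_mul_abs {ε : ℝ} (hε : 0 < ε) :
    Summable fun n : ℤ => Real.exp (-(ε * |(n : ℝ)|)) := by
  have h : Summable fun n : ℕ => Real.exp (n * -ε) :=
    Real.summable_exp_nat_mul_iff.2 (by linarith)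
  refine Summable.of_nat_of_neg ?_ ?_ <;>
  · refine h.congr fun n => ?_
    congr 1
    simp
    ring

/-- `exp(K|a| - δa² - ε|b|)`, the majorant of the Jacobi version of `F₂`. -/
noncomputable def stripMajorant (K δ ε : ℝ) (p : ℤ × ℤ) : ℝ :=
  Real.exp (K * |(p.1 : ℝ)| - δ * (p.1 : ℝ) ^ 2) * Real.exp (-(ε * |(p.2 : ℝ)|))

lemma stripMajorant_nonneg (K δ ε : ℝ) (p : ℤ × ℤ) : 0 ≤ stripMajorant K δ ε p := by
  unfold stripMajorant; positivity

lemma summable_stripMajorant (K : ℝ) {δ ε : ℝ} (hδ : 0 < δ) (hε : 0 < ε) :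
    Summable (stripMajorant K δ ε) :=
  (summable_exp_abs_sub_sq K hδ).mul_of_nonneg (summable_exp_neg_mul_abs hε)
    (fun _ => (Real.exp_pos _).le) fun _ => (Real.exp_pos _).le

/-- In b the decay is only exponential, so a linear weight costs half of the rate ε and a constant
of order 1/ε. In a the quadratic decay absorbs it as before. -/
lemma weight_mul_stripMajorant_le {w : ℂ} {c₀ ε : ℝ} (hε : 0 < ε) (hc₀ : 0 ≤ c₀) (p : ℤ × ℤ)
    (hw : ‖w‖ ≤ c₀ * (1 + |(p.1 : ℝ)| + |(p.2 : ℝ)|)) (K δ : ℝ) :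
    ‖w‖ * stripMajorant K δ ε p ≤ c₀ * (1 + 2 / ε) * stripMajorant (K + 1) δ (ε / 2) p := by
  set A := |(p.1 : ℝ)|
  set B := |(p.2 : ℝ)|
  have hA : 0 ≤ A := abs_nonneg _
  have hB : 0 ≤ B := abs_nonneg _
  have h1 : 1 + A + B ≤ (1 + 2 / ε) * (Real.exp A * Real.exp (ε / 2 * B)) := by
    have e1 : A + 1 ≤ Real.exp A := Real.add_one_le_exp A
    have e2 : ε / 2 * B + 1 ≤ Real.exp (ε / 2 * B) := Real.add_one_le_exp _
    have e3 : 1 + B ≤ (1 + 2 / ε) * (ε / 2 * B + 1) := by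
      have : (1 + 2 / ε) * (ε / 2 * B + 1) = 1 + B + (2 / ε + ε / 2 * B) := by field_simp; ring
      rw [this]
      have : 0 ≤ 2 / ε + ε / 2 * B := by positivity
      linarith
    calc 1 + A + B ≤ (A + 1) * (1 + B) := by nlinarith [mul_nonneg hA hB]
      _ ≤ Real.exp A * ((1 + 2 / ε) * Real.exp (ε / 2 * B)) := by
          refine mul_le_mul e1 (e3.trans ?_) (by positivity) (Real.exp_pos _).le
          exact mul_le_mul_of_nonneg_left e2 (by positivity)
      _ = _ := by ring
  have h2 : stripMajorant (K + 1) δ (ε / 2) p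
      = (Real.exp A * Real.exp (ε / 2 * B)) * stripMajorant K δ ε p := by
    simp only [stripMajorant, ← Real.exp_add]
    congr 1
    ring
  rw [h2, ← mul_assoc]
  refine mul_le_mul_of_nonneg_right (hw.trans ?_) (stripMajorant_nonneg _ _ _ _)
  rw [mul_assoc]
  exact mul_le_mul_of_nonneg_left h1 hc₀

/-- Decay in b comes from y₂ ≥ ε on the quadrant a, b ≥ 0. On a, b < 0 one has abv ≥ |b|v because a
≤ -1, so v - y₂ ≥ ε takes over. Both walls of the strip are therefore needed. -/
lemma norm_F2JTerm_le {τ : ℂ} {M ε : ℝ} {x : ℂ × ℂ} (hx : ‖x‖ ≤ M)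
    (hτ : 0 < τ.im) (h1 : ε ≤ x.2.im) (h2 : x.2.im ≤ τ.im - ε) (p : ℤ × ℤ) :
    ‖F2JTerm x.1 x.2 τ p‖ ≤ stripMajorant (2 * Real.pi * M + 3 * Real.pi * τ.im)
      (3 * Real.pi * τ.im) (2 * Real.pi * ε) p := by
  have hy : |x.1.im| ≤ M := (Complex.abs_im_le_norm _).trans ((norm_fst_le x).trans hx)
  by_cases h0 : orthantSign p = 0
  · rw [F2JTerm, h0, zero_mul, zero_mul, norm_zero]; exact stripMajorant_nonneg _ _ _ _
  set v := τ.im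
  set a : ℝ := (p.1 : ℝ) with ha
  set b : ℝ := (p.2 : ℝ) with hb
  have him : ((p.1 : ℂ) * x.1 + p.2 * x.2 + (3 * (p.1 : ℂ) * (p.1 + 1) / 2
      + p.1 * p.2) * τ).im = a * x.1.im + b * x.2.im + (3 * a * (a + 1) / 2 + a * b) * v := by
    have e1 : (3 * (p.1 : ℂ) * (p.1 + 1) / 2 + p.1 * p.2)
        = ((3 * a * (a + 1) / 2 + a * b : ℝ) : ℂ) := by simp [a, b]
    have e2 : (p.1 : ℂ) = (a : ℂ) := by simp [a]
    have e3 : (p.2 : ℂ) = (b : ℂ) := by simp [b]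
    rw [e1, e2, e3]
    simp only [Complex.add_im, Complex.im_ofReal_mul, v]
  have e2 : -(a * x.1.im) ≤ |a| * M := by
    refine (neg_le_abs _).trans ?_
    rw [abs_mul]; gcongr
  have hmain : ‖orthantSign p‖ = 1 ∧ ε * |b| - 3 / 2 * |a| * v ≤
      b * x.2.im + (3 * a / 2 + a * b) * v := by
    unfold orthantSign at h0 ⊢
    split_ifs at h0 ⊢ with g1 g2
    · have a0 : 0 ≤ a := by rw [ha]; exact_mod_cast g1.1
      have b0 : 0 ≤ b := by rw [hb]; exact_mod_cast g1.2
      refine ⟨by simp, ?_⟩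
      rw [abs_of_nonneg a0, abs_of_nonneg b0]
      have := mul_le_mul_of_nonneg_right h1 b0
      have := mul_nonneg (mul_nonneg a0 b0) hτ.le
      have := mul_nonneg a0 hτ.le
      nlinarith
    · have a0 : a ≤ -1 := by rw [ha]; exact_mod_cast (by omega : p.1 ≤ -1)
      have b0 : b < 0 := by rw [hb]; exact_mod_cast g2.2
      refine ⟨by simp, ?_⟩
      rw [abs_of_neg b0, abs_of_neg (by linarith : a < 0)]
      have f1 := mul_le_mul_of_nonneg_left h2 (by linarith : 0 ≤ -b)
      have f2 : 0 ≤ (-1 - a) * (-b) * v :=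
        mul_nonneg (mul_nonneg (by linarith) (by linarith)) hτ.le
      nlinarith
    · simp at h0
  rw [F2JTerm, norm_mul, norm_mul, hmain.1, one_mul, norm_zpow, norm_neg, norm_one, one_zpow,
    one_mul, norm_e, him, stripMajorant, ← Real.exp_add]
  apply Real.exp_le_exp.2
  have e4 := mul_le_mul_of_nonneg_left e2 (by positivity : 0 ≤ 2 * Real.pi)
  have e5 := mul_le_mul_of_nonneg_left hmain.2 (by positivity : 0 ≤ 2 * Real.pi)
  nlinarith

lemma summable_weight_F2JTerm {τ : ℂ} {z₁ z₂ : ℂ} (h1 : 0 < z₂.im) (h2 : z₂.im < τ.im)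
    {w : ℤ × ℤ → ℂ} {c₀ : ℝ} (hc₀ : 0 ≤ c₀)
    (hw : ∀ p, ‖w p‖ ≤ c₀ * (1 + |(p.1 : ℝ)| + |(p.2 : ℝ)|)) :
    Summable fun p => w p * F2JTerm z₁ z₂ τ p := by
  set ε := min z₂.im (τ.im - z₂.im) with hε
  have hε0 : 0 < ε := lt_min h1 (by linarith)
  have hτ : 0 < τ.im := h1.trans h2
  have k1 : ε ≤ z₂.im := min_le_left _ _
  have k2 : z₂.im ≤ τ.im - ε := by linarith [min_le_right z₂.im (τ.im - z₂.im)]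
  refine Summable.of_norm_bounded (g := fun p => c₀ * (1 + 2 / (2 * Real.pi * ε)) *
    stripMajorant (2 * Real.pi * ‖(z₁, z₂)‖ + 3 * Real.pi * τ.im + 1)
      (3 * Real.pi * τ.im) (2 * Real.pi * ε / 2) p)
    ((summable_stripMajorant _ (by positivity) (by positivity)).mul_left _) fun p => ?_
  rw [norm_mul]
  refine le_trans ?_ (weight_mul_stripMajorant_le (by positivity) hc₀ p (hw p) _ _)
  gcongr
  exact norm_F2JTerm_le (x := (z₁, z₂)) le_rfl hτ k1 k2 p

lemma summable_F2JTerm {τ : ℂ} {z₁ z₂ : ℂ} (h1 : 0 < z₂.im) (h2 : z₂.im < τ.im) :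
    Summable (F2JTerm z₁ z₂ τ) := by
  simpa using summable_weight_F2JTerm (z₁ := z₁) h1 h2 zero_le_one norm_weight_one_le

lemma hasFDerivAt_F2JSum {τ : ℂ} {x : ℂ × ℂ} (h1 : 0 < x.2.im) (h2 : x.2.im < τ.im) :
    HasFDerivAt (fun w : ℂ × ℂ => ∑' p, F2JTerm w.1 w.2 τ p)
      ((2 * Real.pi * Complex.I) •
        ((∑' p : ℤ × ℤ, p.1 * F2JTerm x.1 x.2 τ p) • ContinuousLinearMap.fst ℂ ℂ ℂ
          + (∑' p : ℤ × ℤ, p.2 * F2JTerm x.1 x.2 τ p) • ContinuousLinearMap.snd ℂ ℂ ℂ)) x := by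
  set M := ‖x‖ + 1 with hM
  set ε := min x.2.im (τ.im - x.2.im) / 2 with hε
  have hmin : 0 < min x.2.im (τ.im - x.2.im) := lt_min h1 (by linarith)
  have hε0 : 0 < ε := by positivity
  have hτ : 0 < τ.im := h1.trans h2
  set U : Set (ℂ × ℂ) := Metric.ball (0 : ℂ × ℂ) M ∩
    {y : ℂ × ℂ | y.2.im ∈ Set.Ioo ε (τ.im - ε)} with hU
  have hcont : Continuous fun y : ℂ × ℂ => y.2.im := Complex.continuous_im.comp continuous_snd
  have hUo : IsOpen U := Metric.isOpen_ball.inter (isOpen_Ioo.preimage hcont)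
  have hUc : IsPreconnected U := by
    refine ((convex_ball (0 : ℂ × ℂ) M).inter ?_).isPreconnected
    exact (convex_Ioo ε (τ.im - ε)).linear_preimage
      (Complex.imLm.comp (LinearMap.snd ℝ ℂ ℂ))
  have hx : x ∈ U := by
    refine ⟨by simp [hM], ?_, ?_⟩
    · linarith [min_le_left x.2.im (τ.im - x.2.im)]
    · linarith [min_le_right x.2.im (τ.im - x.2.im)]
  set K := 2 * Real.pi * M + 3 * Real.pi * τ.im with hK
  set δ := 3 * Real.pi * τ.im with hδ
  have hd : ∀ (p : ℤ × ℤ) (y : ℂ × ℂ), HasFDerivAt (fun w : ℂ × ℂ => F2JTerm w.1 w.2 τ p)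
      ((2 * Real.pi * Complex.I : ℂ) • ((p.1 * F2JTerm y.1 y.2 τ p) • ContinuousLinearMap.fst ℂ ℂ ℂ
        + (p.2 * F2JTerm y.1 y.2 τ p) • ContinuousLinearMap.snd ℂ ℂ ℂ)) y := by
    intro p y
    have h1 : HasFDerivAt (fun x : ℂ × ℂ => (p.1 : ℂ) * x.1 + p.2 * x.2
        + (3 * (p.1 : ℂ) * (p.1 + 1) / 2 + p.1 * p.2) * τ)
      ((p.1 : ℂ) • ContinuousLinearMap.fst ℂ ℂ ℂ + (p.2 : ℂ) • ContinuousLinearMap.snd ℂ ℂ ℂ) y :=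
      ((hasFDerivAt_fst.const_mul _).add (hasFDerivAt_snd.const_mul _)).add_const _
    have h2 := ((hasDerivAt_e _).comp_hasFDerivAt y h1).const_mul (orthantSign p * (-1) ^ p.1)
    refine h2.congr_fderiv ?_
    ext <;> simp [F2JTerm] <;> ring
  set c := 1 * (1 + 2 / (2 * Real.pi * ε)) with hc
  have hb : ∀ (p : ℤ × ℤ), ∀ y ∈ U,
      ‖(2 * Real.pi * Complex.I : ℂ) • ((p.1 * F2JTerm y.1 y.2 τ p) •
        ContinuousLinearMap.fst ℂ ℂ ℂ
        + (p.2 * F2JTerm y.1 y.2 τ p) • ContinuousLinearMap.snd ℂ ℂ ℂ)‖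
      ≤ 2 * Real.pi * (c * stripMajorant (K + 1) δ (2 * Real.pi * ε / 2) p
        + c * stripMajorant (K + 1) δ (2 * Real.pi * ε / 2) p) := by
    intro p y hy
    have hy' : ‖y‖ ≤ M := (mem_ball_zero_iff.1 hy.1).le
    have h0 := norm_F2JTerm_le hy' hτ hy.2.1.le hy.2.2.le p
    rw [norm_smul, show ‖(2 * Real.pi * Complex.I : ℂ)‖ = 2 * Real.pi by
      simp [abs_of_pos Real.pi_pos]]
    refine mul_le_mul_of_nonneg_left ?_ (by positivity)
    refine (norm_add_le _ _).trans (add_le_add ?_ ?_)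
    · rw [norm_smul, norm_mul]
      refine (mul_le_of_le_one_right (by positivity) (ContinuousLinearMap.norm_fst_le ..)).trans ?_
      exact (mul_le_mul_of_nonneg_left h0 (norm_nonneg _)).trans
        (weight_mul_stripMajorant_le (by positivity) zero_le_one p (norm_weight_fst_le p) K δ)
    · rw [norm_smul, norm_mul]
      refine (mul_le_of_le_one_right (by positivity) (ContinuousLinearMap.norm_snd_le ..)).trans ?_
      exact (mul_le_mul_of_nonneg_left h0 (norm_nonneg _)).trans
        (weight_mul_stripMajorant_le (by positivity) zero_le_one p (norm_weight_snd_le p) K δ)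
  have hs := (summable_stripMajorant (K + 1) (by positivity : 0 < δ)
    (by positivity : 0 < 2 * Real.pi * ε / 2)).mul_left c
  refine (hasFDerivAt_tsum_of_isPreconnected ((hs.add hs).mul_left _) hUo hUc
    (fun p y _ => hd p y) hb hx (summable_F2JTerm h1 h2) hx).congr_fderiv ?_
  exact (((summable_weight_F2JTerm h1 h2 zero_le_one norm_weight_fst_le).hasSum.smul_const
    _).add ((summable_weight_F2JTerm h1 h2 zero_le_one
      norm_weight_snd_le).hasSum.smul_const _)).const_smul _ |>.tsum_eq

lemma hasDerivAt_F2J_fst {τ : ℂ} {z₁ z₂ : ℂ} (h1 : 0 < z₂.im) (h2 : z₂.im < τ.im) :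
    HasDerivAt (fun w => F2J w z₂ τ)
      (2 * Real.pi * Complex.I * (e (3 * z₂ / 2) * ∑' p : ℤ × ℤ, p.1 * F2JTerm z₁ z₂ τ p)) z₁ := by
  have h3 : HasFDerivAt (fun w => ∑' p, F2JTerm w z₂ τ p) _ z₁ :=
    HasFDerivAt.comp (g := fun w : ℂ × ℂ => ∑' p, F2JTerm w.1 w.2 τ p) (f := fun w => (w, z₂)) z₁
      (hasFDerivAt_F2JSum (x := (z₁, z₂)) h1 h2) (hasFDerivAt_prodMk_left (𝕜 := ℂ) z₁ z₂)
  refine (h3.hasDerivAt.const_mul (e (3 * z₂ / 2))).congr_deriv ?_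
  simp
  ring

lemma hasDerivAt_F2J_snd {τ : ℂ} {z₁ z₂ : ℂ} (h1 : 0 < z₂.im) (h2 : z₂.im < τ.im) :
    HasDerivAt (fun w => F2J z₁ w τ)
      (2 * Real.pi * Complex.I * (e (3 * z₂ / 2) * ((∑' p : ℤ × ℤ, p.2 * F2JTerm z₁ z₂ τ p)
        + 3 / 2 * ∑' p : ℤ × ℤ, F2JTerm z₁ z₂ τ p))) z₂ := by
  have h3 : HasFDerivAt (fun w => ∑' p, F2JTerm z₁ w τ p) _ z₂ :=
    HasFDerivAt.comp (g := fun w : ℂ × ℂ => ∑' p, F2JTerm w.1 w.2 τ p) (f := fun w => (z₁, w)) z₂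
      (hasFDerivAt_F2JSum (x := (z₁, z₂)) h1 h2) (hasFDerivAt_prodMk_right (𝕜 := ℂ) z₁ z₂)
  have h4 : HasDerivAt (fun w : ℂ => 3 * w / 2) (3 / 2) z₂ := by
    simpa using ((hasDerivAt_id z₂).const_mul (3 : ℂ)).div_const 2
  refine (((hasDerivAt_e _).comp z₂ h4).mul h3.hasDerivAt).congr_deriv ?_
  simp
  ring

lemma F2Term_eq (τ : ℂ) (p : ℤ × ℤ) :
    F2Term τ p = e (2 * τ) * ((6 * p.1 + 2 * p.2 + 3) * F2JTerm (1 / 2) τ (2 * τ) p) := by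
  rw [F2Term, F2JTerm]
  have h : e ((3 * p.1 ^ 2 + 2 * p.1 * p.2 + 3 * p.1 + p.2 + 2) * τ)
      = e (2 * τ) * ((-1) ^ p.1 * e (p.1 * (1 / 2) + p.2 * τ +
        (3 * p.1 * (p.1 + 1) / 2 + p.1 * p.2) * (2 * τ))) := by
    rw [← e_int_half, ← e_add, ← e_add]
    refine e_eq_of_sub_eq_int (-p.1) ?_
    push_cast; ring
  rw [h]; ring

lemma norm_weight_F2_le (p : ℤ × ℤ) :
    ‖(6 * p.1 + 2 * p.2 + 3 : ℂ)‖ ≤ 6 * (1 + |(p.1 : ℝ)| + |(p.2 : ℝ)|) := by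
  have h1 := norm_add_le (6 * p.1 + 2 * p.2 : ℂ) 3
  have h2 := norm_add_le (6 * p.1 : ℂ) (2 * p.2 : ℂ)
  rw [norm_mul, norm_mul, Complex.norm_intCast, Complex.norm_intCast] at h2
  rw [Complex.norm_ofNat] at h1
  rw [Complex.norm_ofNat, Complex.norm_ofNat] at h2
  linarith [abs_nonneg (p.2 : ℝ), abs_nonneg (p.1 : ℝ)]

lemma im_lt_two_mul_im {τ : ℂ} (hτ : 0 < τ.im) : τ.im < (2 * τ).im := by
  simp; linarith

lemma summable_F2Term {τ : ℂ} (hτ : 0 < τ.im) : Summable (F2Term τ) := by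
  refine ((summable_weight_F2JTerm (z₁ := 1 / 2) hτ (im_lt_two_mul_im hτ) (by norm_num)
    norm_weight_F2_le).mul_left (e (2 * τ))).congr fun p => (F2Term_eq τ p).symm

lemma F2_eq_specialize {τ : ℂ} (hτ : 0 < τ.im) : F2 τ = specialize2 F2J τ := by
  have hτ2 := im_lt_two_mul_im hτ
  rw [specialize2, (HasDerivAt.hasWirt (hasDerivAt_F2J_fst hτ hτ2)).zetaD_eq,
    (HasDerivAt.hasWirt (hasDerivAt_F2J_snd hτ hτ2)).zetaD_eq,
    mul_div_cancel_left₀ _ Complex.two_pi_I_ne_zero,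
    mul_div_cancel_left₀ _ Complex.two_pi_I_ne_zero, F2]
  have h := tsum_weights (summable_F2JTerm (z₁ := 1 / 2) hτ hτ2)
    (summable_weight_F2JTerm hτ hτ2 zero_le_one norm_weight_fst_le)
    (summable_weight_F2JTerm hτ hτ2 zero_le_one norm_weight_snd_le) 6 2 3
  have h2 : e (2 * τ) = e (τ / 2) * e (3 * τ / 2) := by rw [← e_add]; congr 1; ring
  rw [tsum_congr (F2Term_eq τ), tsum_mul_left, h, h2]
  ring

/-! ### The meromorphic continuation -/

lemma OffLattice.one_sub_e_ne_zero {z τ : ℂ} (h : OffLattice z τ) (a : ℤ) :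
    1 - e (z + a * τ) ≠ 0 := by
  intro h0
  obtain ⟨n, hn⟩ := e_eq_one_iff.1 (sub_eq_zero.1 h0).symm
  refine h (-a) n ?_
  push_cast
  linear_combination hn

lemma offLattice_of_strip {z τ : ℂ} (h1 : 0 < z.im) (h2 : z.im < τ.im) : OffLattice z τ := by
  intro m n h
  have hi : z.im = m * τ.im := by rw [h]; simp
  have hτ := h1.trans h2
  rw [hi] at h1 h2
  have m1 : (0 : ℝ) < m := pos_of_mul_pos_left h1 hτ.le
  have m2 : (m : ℝ) < 1 := by nlinarith
  have m1' : 0 < m := by exact_mod_cast m1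
  have m2' : m < 1 := by exact_mod_cast m2
  omega

/-- For large |a| the exponential has modulus at least 2 or at most 1/2, uniformly near z; finitely
many a remain, and continuity handles them. -/
lemma exists_lower_bound {z τ : ℂ} (hτ : 0 < τ.im) (h : OffLattice z τ) :
    ∃ ε δ : ℝ, 0 < ε ∧ 0 < δ ∧ ∀ w ∈ Metric.ball z ε, ∀ a : ℤ, δ ≤ ‖1 - e (w + a * τ)‖ := by
  set M := |z.im| + 1 with hM
  obtain ⟨N, hN⟩ := exists_nat_gt ((M + 1) / τ.im)
  have hN' : M + 1 < N * τ.im := by rwa [div_lt_iff₀ hτ] at hN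
  have hpos : ∀ a ∈ Finset.Icc (-(N : ℤ)) N, ∀ᶠ w in 𝓝 z,
      ‖1 - e (z + a * τ)‖ / 2 < ‖1 - e (w + a * τ)‖ := by
    intro a _
    have hc : ContinuousAt (fun w : ℂ => ‖1 - e (w + a * τ)‖) z :=
      (continuous_const.sub (continuous_e.comp
        (continuous_id.add continuous_const))).norm.continuousAt
    exact hc.eventually (lt_mem_nhds (half_lt_self (norm_pos_iff.2 (h.one_sub_e_ne_zero a))))
  have hev := (Filter.eventually_all_finset _).2 hpos
  obtain ⟨ε, hε, hball⟩ := Metric.eventually_nhds_iff_ball.1 hev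
  have hne : (Finset.Icc (-(N : ℤ)) N).Nonempty := ⟨0, by simp⟩
  set δ₁ := (Finset.Icc (-(N : ℤ)) N).inf' hne fun a => ‖1 - e (z + a * τ)‖ / 2 with hδ₁
  have hδ₁0 : 0 < δ₁ := by
    rw [hδ₁, Finset.lt_inf'_iff]
    exact fun a _ => half_pos (norm_pos_iff.2 (h.one_sub_e_ne_zero a))
  refine ⟨min ε 1, min δ₁ (1 / 2), by positivity, by positivity, fun w hw a => ?_⟩
  have hw1 : w ∈ Metric.ball z ε := Metric.ball_subset_ball (min_le_left _ _) hw
  have hw2 : |w.im| ≤ M := by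
    have h1 : ‖w - z‖ < 1 := (mem_ball_iff_norm.1 hw).trans_le (min_le_right _ _)
    have h2 := (Complex.abs_im_le_norm (w - z)).trans h1.le
    have h3 : w.im = z.im + (w - z).im := by simp
    rw [h3]
    exact (abs_add_le _ _).trans (by linarith)
  have hexp : Real.exp (-1) ≤ 1 / 2 := by
    have := Real.add_one_le_exp (1 : ℝ)
    rw [Real.exp_neg, ← one_div]
    exact one_div_le_one_div_of_le two_pos (by linarith)
  have him : (w + a * τ).im = w.im + a * τ.im := by simp
  have hw3 := abs_le.1 hw2
  by_cases ha : a ∈ Finset.Icc (-(N : ℤ)) N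
  · exact (min_le_left _ _).trans ((Finset.inf'_le _ ha).trans (hball w hw1 a ha).le)
  · refine (min_le_right _ _).trans ?_
    rw [Finset.mem_Icc, not_and_or, not_le, not_le] at ha
    have hpi := Real.pi_gt_three
    rcases ha with ha | ha
    · have h1 : (a : ℝ) * τ.im ≤ -(N * τ.im) := by
        have : (a : ℝ) ≤ -N := by exact_mod_cast ha.le
        nlinarith
      have h2 : 2 ≤ ‖e (w + a * τ)‖ := by
        rw [norm_e, him]
        have := Real.add_one_le_exp (-(2 * Real.pi * (w.im + a * τ.im)))
        nlinarith
      have h3 := norm_sub_norm_le (e (w + a * τ)) 1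
      rw [norm_one, norm_sub_rev] at h3
      linarith
    · have h1 : N * τ.im ≤ (a : ℝ) * τ.im := by
        have : (N : ℝ) ≤ a := by exact_mod_cast ha.le
        nlinarith
      have h2 : ‖e (w + a * τ)‖ ≤ 1 / 2 := by
        rw [norm_e, him]
        refine le_trans (Real.exp_le_exp.2 ?_) hexp
        nlinarith
      have h3 := norm_sub_norm_le 1 (e (w + a * τ))
      rw [norm_one] at h3
      linarith

lemma norm_F2Mer_num_le {τ : ℂ} (hτ : 0 < τ.im) {M : ℝ} {z : ℂ} (hz : ‖z‖ ≤ M) (a : ℤ) :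
    ‖(-1) ^ a * e (a * z + 3 * a * (a + 1) / 2 * τ)‖ ≤
      Real.exp ((2 * Real.pi * M + 3 * Real.pi * τ.im) * |(a : ℝ)|
        - 3 * Real.pi * τ.im * (a : ℝ) ^ 2) := by
  have hy : |z.im| ≤ M := (Complex.abs_im_le_norm _).trans hz
  rw [norm_mul, norm_zpow, norm_neg, norm_one, one_zpow, one_mul, norm_e]
  apply Real.exp_le_exp.2
  have him : ((a : ℂ) * z + 3 * a * (a + 1) / 2 * τ).im
      = a * z.im + 3 * a * (a + 1) / 2 * τ.im := by
    have e1 : (3 * (a : ℂ) * (a + 1) / 2) = ((3 * (a : ℝ) * (a + 1) / 2 : ℝ) : ℂ) := by simp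
    have e2 : (a : ℂ) = ((a : ℝ) : ℂ) := by simp
    rw [e1, e2]
    simp only [Complex.add_im, Complex.im_ofReal_mul]
  rw [him]
  have e2 : -(a * z.im) ≤ |(a : ℝ)| * M := by
    refine (neg_le_abs _).trans ?_
    rw [abs_mul]; gcongr
  have e3 : -(a : ℝ) ≤ |(a : ℝ)| := neg_le_abs _
  have e4 := mul_le_mul_of_nonneg_left e2 (by positivity : 0 ≤ 2 * Real.pi)
  have e5 := mul_le_mul_of_nonneg_left e3 (by positivity : 0 ≤ 3 * Real.pi * τ.im)
  nlinarith

lemma summable_F2MerTerm {τ : ℂ} (hτ : 0 < τ.im) (z₁ : ℂ) {z₂ : ℂ} (h : OffLattice z₂ τ) :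
    Summable (F2MerTerm z₁ z₂ τ) := by
  obtain ⟨ε, δ, hε, hδ, hb⟩ := exists_lower_bound hτ h
  refine Summable.of_norm_bounded ((summable_exp_abs_sub_sq
    (2 * Real.pi * ‖z₁‖ + 3 * Real.pi * τ.im)
    (by positivity : 0 < 3 * Real.pi * τ.im)).mul_right δ⁻¹) fun a => ?_
  rw [F2MerTerm, norm_div, div_eq_mul_inv]
  exact mul_le_mul (norm_F2Mer_num_le hτ le_rfl a)
    (inv_anti₀ hδ (hb z₂ (Metric.mem_ball_self hε) a)) (by positivity) (Real.exp_pos _).le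

lemma differentiableAt_F2Mer {τ : ℂ} (hτ : 0 < τ.im) {p : ℂ × ℂ} (h : OffLattice p.2 τ) :
    DifferentiableAt ℂ (fun w : ℂ × ℂ => F2Mer w.1 w.2 τ) p := by
  obtain ⟨ε, δ, hε, hδ, hb⟩ := exists_lower_bound hτ h
  set U : Set (ℂ × ℂ) := Metric.ball p ε with hU
  set M := ‖p‖ + ε with hM
  have hU1 : ∀ y ∈ U, ‖y.1‖ ≤ M := fun y hy => by
    have h1 : ‖y - p‖ < ε := mem_ball_iff_norm.1 hy
    have h2 : ‖y‖ ≤ ‖p‖ + ‖y - p‖ := by simpa using norm_add_le p (y - p)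
    exact (norm_fst_le y).trans (by linarith)
  have hU2 : ∀ y ∈ U, ∀ a : ℤ, δ ≤ ‖1 - e (y.2 + a * τ)‖ := fun y hy a => by
    refine hb y.2 (mem_ball_iff_norm.2 ?_) a
    exact (norm_snd_le (y - p)).trans_lt (mem_ball_iff_norm.1 hy)
  -- With X = e(z₂ + aτ), the logarithmic derivative of 1/(1 - X) is 2πi X/(1 - X) = 2πi(1/(1 - X) -
  -- 1), which is bounded by the lower bound on |1 - X|.
  set F' : ℤ → ℂ × ℂ → (ℂ × ℂ →L[ℂ] ℂ) := fun a y =>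
    (2 * Real.pi * Complex.I * F2MerTerm y.1 y.2 τ a) •
      ((a : ℂ) • ContinuousLinearMap.fst ℂ ℂ ℂ
        + ((1 - e (y.2 + a * τ))⁻¹ - 1) • ContinuousLinearMap.snd ℂ ℂ ℂ) with hF'
  have hd : ∀ (a : ℤ), ∀ y ∈ U, HasFDerivAt (fun w : ℂ × ℂ => F2MerTerm w.1 w.2 τ a) (F' a y) y := by
    intro a y hy
    have hne : 1 - e (y.2 + a * τ) ≠ 0 := norm_pos_iff.1 (hδ.trans_le (hU2 y hy a))
    have h1 : HasFDerivAt (fun w : ℂ × ℂ => (a : ℂ) * w.1 + 3 * a * (a + 1) / 2 * τ)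
      ((a : ℂ) • ContinuousLinearMap.fst ℂ ℂ ℂ) y := (hasFDerivAt_fst.const_mul _).add_const _
    have h2 := ((hasDerivAt_e _).comp_hasFDerivAt y h1).const_mul ((-1 : ℂ) ^ a)
    have h3 : HasFDerivAt (fun w : ℂ × ℂ => w.2 + a * τ) (ContinuousLinearMap.snd ℂ ℂ ℂ) y :=
      hasFDerivAt_snd.add_const _
    have h4 := (((hasDerivAt_e (y.2 + a * τ)).const_sub 1).fun_inv hne).comp_hasFDerivAt y h3
    refine (h2.mul h4).congr_fderiv ?_
    ext
    · simp [hF', F2MerTerm]; ring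
    · simp [hF', F2MerTerm]; field_simp; ring
  have hu : Summable fun a : ℤ => 2 * Real.pi * (Real.exp ((2 * Real.pi * M + 3 * Real.pi * τ.im + 1)
      * |(a : ℝ)| - 3 * Real.pi * τ.im * (a : ℝ) ^ 2) * δ⁻¹) * (1 + (δ⁻¹ + 1)) :=
    (((summable_exp_abs_sub_sq _ (by positivity)).mul_right _).mul_left _).mul_right _
  have hbd : ∀ (a : ℤ), ∀ y ∈ U, ‖F' a y‖ ≤ 2 * Real.pi * (Real.exp ((2 * Real.pi * M
      + 3 * Real.pi * τ.im + 1) * |(a : ℝ)| - 3 * Real.pi * τ.im * (a : ℝ) ^ 2) * δ⁻¹)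
        * (1 + (δ⁻¹ + 1)) := by
    intro a y hy
    have hinv : ‖(1 - e (y.2 + a * τ))⁻¹‖ ≤ δ⁻¹ := by
      rw [norm_inv]; exact inv_anti₀ hδ (hU2 y hy a)
    have ht : ‖F2MerTerm y.1 y.2 τ a‖ ≤ Real.exp ((2 * Real.pi * M
      + 3 * Real.pi * τ.im) * |(a : ℝ)| - 3 * Real.pi * τ.im * (a : ℝ) ^ 2) * δ⁻¹ := by
      rw [F2MerTerm, div_eq_mul_inv, norm_mul]
      exact mul_le_mul (norm_F2Mer_num_le hτ (hU1 y hy) a) hinv (norm_nonneg _)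
        (Real.exp_pos _).le
    have hL : ‖(a : ℂ) • ContinuousLinearMap.fst ℂ ℂ ℂ
        + ((1 - e (y.2 + a * τ))⁻¹ - 1) • ContinuousLinearMap.snd ℂ ℂ ℂ‖ ≤
        Real.exp |(a : ℝ)| * (1 + (δ⁻¹ + 1)) := by
      have h1 : |(a : ℝ)| ≤ Real.exp |(a : ℝ)| := by linarith [Real.add_one_le_exp |(a : ℝ)|]
      have h2 : 1 ≤ Real.exp |(a : ℝ)| := Real.one_le_exp (abs_nonneg _)
      have h3 : ‖(1 - e (y.2 + a * τ))⁻¹ - 1‖ ≤ δ⁻¹ + 1 :=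
        (norm_sub_le _ _).trans (by rw [norm_one]; linarith)
      rw [mul_add, mul_one]
      refine (norm_add_le _ _).trans (add_le_add ?_ ?_)
      · rw [norm_smul, Complex.norm_intCast]
        exact (mul_le_of_le_one_right (abs_nonneg _) (ContinuousLinearMap.norm_fst_le ..)).trans h1
      · rw [norm_smul]
        refine (mul_le_of_le_one_right (norm_nonneg _)
          (ContinuousLinearMap.norm_snd_le ..)).trans (h3.trans ?_)
        exact le_mul_of_one_le_left (by positivity) h2
    rw [hF']
    simp only
    rw [norm_smul, norm_mul, show ‖(2 * Real.pi * Complex.I : ℂ)‖ = 2 * Real.pi by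
      simp [abs_of_pos Real.pi_pos]]
    calc _ ≤ 2 * Real.pi * (Real.exp ((2 * Real.pi * M
      + 3 * Real.pi * τ.im) * |(a : ℝ)| - 3 * Real.pi * τ.im * (a : ℝ) ^ 2) * δ⁻¹) *
        (Real.exp |(a : ℝ)| * (1 + (δ⁻¹ + 1))) := by gcongr
      _ = _ := by
        rw [show (2 * Real.pi * M + 3 * Real.pi * τ.im + 1) * |(a : ℝ)| - 3 * Real.pi * τ.im
          * (a : ℝ) ^ 2 = ((2 * Real.pi * M + 3 * Real.pi * τ.im) * |(a : ℝ)| - 3 * Real.pi * τ.im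
          * (a : ℝ) ^ 2) + |(a : ℝ)| by ring, Real.exp_add]
        ring
  have hp : p ∈ U := Metric.mem_ball_self hε
  have key := hasFDerivAt_tsum_of_isPreconnected hu Metric.isOpen_ball
    (convex_ball p ε).isPreconnected hd hbd hp (summable_F2MerTerm hτ p.1 h) hp
  have h5 : DifferentiableAt ℂ (fun w : ℂ × ℂ => e (3 * w.2 / 2)) p :=
    DifferentiableAt.comp (g := e) (f := fun w : ℂ × ℂ => 3 * w.2 / 2) p (differentiable_e _)
      (by fun_prop)
  exact h5.mul key.differentiableAt

/-- In the strip X = e(z₂ + aτ) satisfies |X| < 1 for a ≥ 0 and |X| > 1 for a < 0. Expanding 1/(1 -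
X) in X or in X⁻¹ accordingly gives the two quadrants, with the minus sign in the second. -/
lemma F2Mer_eq_F2J {τ : ℂ} {z₁ z₂ : ℂ} (h1 : 0 < z₂.im) (h2 : z₂.im < τ.im) :
    F2Mer z₁ z₂ τ = F2J z₁ z₂ τ := by
  have hτ := h1.trans h2
  rw [F2Mer, F2J, (summable_F2JTerm h1 h2).tsum_prod]
  congr 1
  refine tsum_congr fun a => ?_
  set X := e (z₂ + a * τ) with hX
  have hX0 : X ≠ 0 := e_ne_zero _
  have hne := (offLattice_of_strip h1 h2).one_sub_e_ne_zero a
  rw [← hX] at hne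
  have him : (z₂ + a * τ).im = z₂.im + a * τ.im := by simp
  have hfac : ∀ b : ℤ, e (a * z₁ + b * z₂ + (3 * a * (a + 1) / 2 + a * b) * τ)
      = e (a * z₁ + 3 * a * (a + 1) / 2 * τ) * X ^ b := by
    intro b
    rw [hX, ← e_int_mul, ← e_add]; congr 1; ring
  rw [F2MerTerm, ← hX]
  rcases le_or_gt 0 a with ha | ha
  · have hlt : ‖X‖ < 1 := by
      have : (0 : ℝ) ≤ a := by exact_mod_cast ha
      rw [hX, norm_e, Real.exp_lt_one_iff, him]
      have : 0 < z₂.im + a * τ.im := by positivity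
      have := mul_pos Real.two_pi_pos this
      linarith
    have hinj : Function.Injective fun n : ℕ => (n : ℤ) := Nat.cast_injective
    rw [← hinj.tsum_eq]
    · have : ∀ n : ℕ, F2JTerm z₁ z₂ τ (a, (n : ℤ))
          = ((-1) ^ a * e (a * z₁ + 3 * a * (a + 1) / 2 * τ)) * X ^ n := by
        intro n
        rw [F2JTerm, hfac, orthantSign, if_pos ⟨ha, Int.natCast_nonneg n⟩, zpow_natCast]
        ring
      rw [tsum_congr this, tsum_mul_left, tsum_geometric_of_norm_lt_one hlt, div_eq_mul_inv]
    · intro b hb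
      rcases le_or_gt 0 b with h | h
      · exact ⟨b.toNat, by simpa using h⟩
      · refine absurd ?_ hb
        simp [F2JTerm, orthantSign, h, not_lt.2 ha, not_le.2 h]
  · have hlt : ‖X⁻¹‖ < 1 := by
      have : (a : ℝ) ≤ -1 := by exact_mod_cast (by omega : a ≤ -1)
      rw [hX, ← e_neg, norm_e, Real.exp_lt_one_iff, Complex.neg_im, him]
      have : 0 < -(z₂.im + a * τ.im) := by nlinarith
      have := mul_pos Real.two_pi_pos this
      linarith
    have hinj : Function.Injective fun n : ℕ => -((n : ℤ) + 1) := fun m n h => by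
      simpa using h
    rw [← hinj.tsum_eq]
    · have : ∀ n : ℕ, F2JTerm z₁ z₂ τ (a, -((n : ℤ) + 1))
          = (-((-1) ^ a * e (a * z₁ + 3 * a * (a + 1) / 2 * τ)) * X⁻¹) * X⁻¹ ^ n := by
        intro n
        have hn : -((n : ℤ) + 1) < 0 := by omega
        rw [F2JTerm, hfac, orthantSign, if_neg (fun h => absurd h.1 (not_le.2 ha)),
          if_pos ⟨ha, hn⟩, zpow_neg, ← inv_zpow, zpow_add₀ (inv_ne_zero hX0), zpow_one,
          zpow_natCast]
        ring
      rw [tsum_congr this, tsum_mul_left, tsum_geometric_of_norm_lt_one hlt]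
      have : X - 1 ≠ 0 := fun h => hne (by linear_combination -h)
      field_simp
      ring
    · intro b hb
      rcases le_or_gt 0 b with h | h
      · refine absurd ?_ hb
        simp [F2JTerm, orthantSign, not_lt.2 h, not_le.2 ha]
      · exact ⟨(-b - 1).toNat, by simp only; omega⟩

/-! ### The series `ϑ` and `R` -/

lemma summable_e_gauss {τ : ℂ} (hτ : 0 < τ.im) (x : ℂ) :
    Summable fun n : ℤ => e (n ^ 2 / 2 * τ + n * x) := by
  refine (summable_exp_gauss hτ x).congr fun n => ?_
  rw [e]; congr 1; ring

lemma summable_thetaTerm {τ : ℂ} (hτ : 0 < τ.im) (z : ℂ) : Summable (thetaTerm z τ) := by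
  refine ((summable_e_gauss hτ (z + 1 / 2 + τ / 2)).mul_left (e ((z + 1 / 2) / 2 + τ / 8))).congr
    fun n => ?_
  rw [thetaTerm, ← e_add]; congr 1; ring

/-- The factor q^{-n²/2} grows like exp(πvn²), but the sign minus the error function decays like
exp(-2πv(n+L)²). What remains is the norm of an ordinary theta series. -/
lemma summable_RTerm {s : ℝ} (hs : 1 ≤ s) {τ : ℂ} (hτ : 0 < τ.im) (z : ℂ) :
    Summable (RTerm s z τ) := by
  set L : ℝ := 1 / 2 + z.im / τ.im with hL
  set κ : ℝ := Real.sqrt (2 * τ.im) with hκ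
  have hκ0 : 0 < κ := Real.sqrt_pos.2 (by positivity)
  have hκ2 : κ ^ 2 = 2 * τ.im := Real.sq_sqrt (by positivity)
  have hg := ((summable_e_gauss hτ (z + τ / 2)).norm).mul_left
    (2 * Real.exp (Real.pi * κ ^ 2 * (|L| + 1) ^ 2)
      * Real.exp (-(Real.pi * τ.im / 4 + Real.pi * z.im + 2 * Real.pi * z.im ^ 2 / τ.im)))
  refine Summable.of_norm_bounded hg fun n => ?_
  have h1 := abs_sg_sub_E_le hκ0 hs (le_refl |L|) n
  have e1 : s * (((n : ℝ) + 1 / 2 + z.im / τ.im) * κ) = s * (κ * (n + L)) := by rw [hL]; ring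
  rw [RTerm, e1, norm_mul, norm_mul, norm_zpow, norm_neg, norm_one, one_zpow, mul_one,
    Complex.norm_real, Real.norm_eq_abs]
  have him : (-((n + 1 / 2 : ℂ) ^ 2 / 2 * τ) - (n + 1 / 2) * z).im
      = -(((n : ℝ) + 1 / 2) ^ 2 / 2 * τ.im) - (n + 1 / 2) * z.im := by
    rw [show (-((n + 1 / 2 : ℂ) ^ 2 / 2 * τ) - (n + 1 / 2) * z)
      = -(((((n : ℝ) + 1 / 2) ^ 2 / 2 : ℝ) : ℂ) * τ) - (((n : ℝ) + 1 / 2 : ℝ) : ℂ) * z by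
      push_cast; ring]
    simp only [Complex.sub_im, Complex.neg_im, Complex.im_ofReal_mul]
  have him2 : ((n : ℂ) ^ 2 / 2 * τ + n * (z + τ / 2)).im
      = (n : ℝ) ^ 2 / 2 * τ.im + n * (z.im + τ.im / 2) := by
    rw [show ((n : ℂ) ^ 2 / 2 * τ + n * (z + τ / 2))
      = (((n : ℝ) ^ 2 / 2 : ℝ) : ℂ) * τ + ((n : ℝ) : ℂ) * (z + ((1 / 2 : ℝ) : ℂ) * τ) by
      push_cast; ring]
    simp only [Complex.add_im, Complex.im_ofReal_mul]
    ring
  rw [norm_e, norm_e, him, him2]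
  refine (mul_le_mul_of_nonneg_right h1 (Real.exp_pos _).le).trans (le_of_eq ?_)
  have key : Real.exp (-(Real.pi * κ ^ 2 * (n + L) ^ 2)) *
      Real.exp (-(2 * Real.pi * (-(((n : ℝ) + 1 / 2) ^ 2 / 2 * τ.im) - (n + 1 / 2) * z.im))) =
      Real.exp (-(Real.pi * τ.im / 4 + Real.pi * z.im + 2 * Real.pi * z.im ^ 2 / τ.im)) *
      Real.exp (-(2 * Real.pi * ((n : ℝ) ^ 2 / 2 * τ.im + n * (z.im + τ.im / 2)))) := by
    rw [← Real.exp_add, ← Real.exp_add, hκ2, hL]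
    congr 1
    field_simp
    ring
  rw [mul_assoc, key]
  ring

/-! ### `F̂₂` through the building block -/

/-- The second argument of the building block belonging to `F̂₂`. -/
noncomputable def shiftArg (z₁ τ : ℂ) : ℂ := z₁ + 3 * τ / 2 + 1 / 2

lemma shiftArg_im (z₁ τ : ℂ) : (shiftArg z₁ τ).im = z₁.im + 3 / 2 * τ.im := by
  rw [shiftArg, show z₁ + 3 * τ / 2 + 1 / 2 = z₁ + ((3 / 2 : ℝ) : ℂ) * τ + ((1 / 2 : ℝ) : ℂ) by
    push_cast; ring]
  simp only [Complex.add_im, Complex.im_ofReal_mul, Complex.ofReal_im, add_zero]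

lemma qf_F2 (a b : ℝ) : qf (1 / 3) 3 (1 / 3) a b = 3 * b ^ 2 / 2 + a * b := by rw [qf]; ring

lemma sg_sub_three_mul {k : ℕ} (hk : k < 3) (n : ℤ) : sg (k - 3 * n - 3) = -sg n := by
  rcases le_or_gt 0 n with h | h
  · rw [sg_of_nonneg h, sg_of_neg (by omega)]
  · rw [sg_of_neg h, sg_of_nonneg (by omega), neg_neg]

/-- The change of variables (k, m, n) ↦ (k - 3n - 3, m + n + 1) merges the positive theta and the
negative R into the form ab + 3b²/2. It reverses the sign of the half-integer index of R, and the
half-integral shifts go into `shiftArg`. -/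
lemma theta_mul_R_term (s : ℝ) {τ : ℂ} (hτ : 0 < τ.im) (z₁ z₂ : ℂ) {k : ℕ} (hk : k < 3) (m n : ℤ) :
    e (k * z₂) * (thetaTerm (z₁ + k * τ) (3 * τ) m * RTerm s (3 * z₂ - z₁ - k * τ) (3 * τ) n) =
      Complex.I * e (3 * z₂ / 2) *
        nhTerm s (1 / 3) 3 (1 / 3) τ (z₂, shiftArg z₁ τ) (k - 3 * n - 3, m + n + 1) := by
  have him : (3 * z₂ - z₁ - k * τ).im = 3 * z₂.im - z₁.im - k * τ.im := by
    rw [show 3 * z₂ - z₁ - k * τ = ((3 : ℝ) : ℂ) * z₂ - z₁ - ((k : ℝ) : ℂ) * τ by push_cast; ring]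
    simp only [Complex.sub_im, Complex.im_ofReal_mul]
  have him3 : (3 * τ).im = 3 * τ.im := by
    rw [show 3 * τ = ((3 : ℝ) : ℂ) * τ by push_cast; ring, Complex.im_ofReal_mul]
  have hE : s * errArg (1 / 3) (1 / 3) τ (z₂, shiftArg z₁ τ) (k - 3 * n - 3) =
      -(s * (((n : ℝ) + 1 / 2 + (3 * z₂ - z₁ - k * τ).im / (3 * τ).im)
        * Real.sqrt (2 * (3 * τ).im))) := by
    have hsq : Real.sqrt (2 * (3 * τ).im) = 3 * Real.sqrt (2 * (1 / 3) * τ.im) := by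
      rw [him3, show 2 * (3 * τ.im) = 3 ^ 2 * (2 * (1 / 3) * τ.im) by ring,
        Real.sqrt_mul (by norm_num), Real.sqrt_sq (by norm_num)]
    rw [errArg, hsq, him, him3, shiftL_apply, shiftArg_im]
    push_cast
    field_simp
    ring
  have hsg : Real.sign ((n : ℝ) + 1 / 2) = sg n := rfl
  rw [nhTerm, RTerm, hE, E_neg, sg_sub_three_mul hk, ← hsg]
  set u : ℝ := s * (((n : ℝ) + 1 / 2 + (3 * z₂ - z₁ - k * τ).im / (3 * τ).im)
        * Real.sqrt (2 * (3 * τ).im))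
  have hI : e (-1 / 4) = -Complex.I := by
    rw [e, show 2 * Real.pi * Complex.I * (-1 / 4) = -(Real.pi / 2 * Complex.I) by ring,
      Complex.exp_neg, Complex.exp_pi_div_two_mul_I, Complex.inv_I]
  have key : e (k * z₂) * thetaTerm (z₁ + k * τ) (3 * τ) m * (-1) ^ n *
      e (-((n + 1 / 2) ^ 2 / 2 * (3 * τ)) - (n + 1 / 2) * (3 * z₂ - z₁ - k * τ)) =
      -Complex.I * e (3 * z₂ / 2) * eTerm (1 / 3) 3 (1 / 3) τ (z₂, shiftArg z₁ τ)
        (k - 3 * n - 3, m + n + 1) := by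
    rw [← hI, ← e_int_half, thetaTerm, eTerm, ← e_add, ← e_add, ← e_add, ← e_add, ← e_add]
    congr 1
    rw [qf_F2, shiftArg]
    push_cast
    ring
  push_cast
  linear_combination ((Real.sign ((n : ℝ) + 1 / 2) : ℝ) - (E u : ℝ) : ℂ) * key

/-- The lattice points `(k - 3n - 3, m + n + 1)` with `0 ≤ k < 3`. -/
def thetaEquiv : Fin 3 × (ℤ × ℤ) ≃ ℤ × ℤ where
  toFun x := (x.1 - 3 * x.2.2 - 3, x.2.1 + x.2.2 + 1)
  invFun y := (⟨(y.1 % 3).toNat, by omega⟩, (y.2 + y.1 / 3, -1 - y.1 / 3))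
  left_inv := by
    rintro ⟨⟨k, hk⟩, a, b⟩
    simp only [Prod.mk.injEq, Fin.mk.injEq]
    refine ⟨?_, ?_, ?_⟩ <;> omega
  right_inv := by
    rintro ⟨m, l⟩
    simp only [Prod.mk.injEq]
    constructor <;> omega

/-- The building block of `F̂₂`. -/
noncomputable def NH2 (s : ℝ) (z₁ z₂ τ : ℂ) : ℂ :=
  NH s (1 / 3) 3 (1 / 3) τ (z₂, shiftArg z₁ τ)

lemma F2hatJ_eq {s : ℝ} (hs : 1 ≤ s) {τ : ℂ} (hτ : 0 < τ.im) (z₁ z₂ : ℂ) :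
    F2hatJ s z₁ z₂ τ = F2Mer z₁ z₂ τ - 1 / 2 * e (3 * z₂ / 2) * NH2 s z₁ z₂ τ := by
  have him3 : 0 < (3 * τ).im := by
    rw [show 3 * τ = ((3 : ℝ) : ℂ) * τ by push_cast; ring, Complex.im_ofReal_mul]; positivity
  have hN := summable_nhTerm hs (by norm_num : (0 : ℝ) < 1 / 3) (by norm_num : (0 : ℝ) < 3) (1 / 3)
    hτ (z₂, shiftArg z₁ τ)
  have hN' := thetaEquiv.summable_iff.2 hN
  have hT := hN'.tsum_prod
  simp only [Function.comp_apply] at hT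
  have h1 : ∀ k : Fin 3, e ((k : ℕ) * z₂) * theta (z₁ + (k : ℕ) * τ) (3 * τ)
        * R s (3 * z₂ - z₁ - (k : ℕ) * τ) (3 * τ)
      = Complex.I * e (3 * z₂ / 2) * ∑' p : ℤ × ℤ,
        nhTerm s (1 / 3) 3 (1 / 3) τ (z₂, shiftArg z₁ τ) (thetaEquiv (k, p)) := by
    intro k
    rw [mul_assoc, theta, R, tsum_mul_tsum_of_summable_norm (summable_thetaTerm him3 _).norm
      (summable_RTerm hs him3 _).norm, ← tsum_mul_left, ← tsum_mul_left]
    exact tsum_congr fun p => theta_mul_R_term s hτ z₁ z₂ k.2 p.1 p.2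
  rw [F2hatJ, Finset.sum_range, Finset.sum_congr rfl fun k _ => h1 k, ← Finset.mul_sum, NH2, NH,
    ← thetaEquiv.tsum_eq, hT, tsum_fintype]
  linear_combination (1 / 2 * e (3 * z₂ / 2) * ∑ k : Fin 3, ∑' p : ℤ × ℤ,
    nhTerm s (1 / 3) 3 (1 / 3) τ (z₂, shiftArg z₁ τ) (thetaEquiv (k, p))) * Complex.I_sq

lemma differentiableAt_F2hatJ {s : ℝ} (hs : 1 ≤ s) {τ : ℂ} (hτ : 0 < τ.im) {p : ℂ × ℂ}
    (h : OffLattice p.2 τ) : DifferentiableAt ℝ (fun w : ℂ × ℂ => F2hatJ s w.1 w.2 τ) p := by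
  simp only [F2hatJ_eq hs hτ, NH2]
  have h1 : DifferentiableAt ℝ (fun w : ℂ × ℂ => F2Mer w.1 w.2 τ) p :=
    (differentiableAt_F2Mer hτ h).restrictScalars ℝ
  have h2 : DifferentiableAt ℝ (fun w : ℂ × ℂ => NH s (1 / 3) 3 (1 / 3) τ (w.2, shiftArg w.1 τ))
      p := by
    refine DifferentiableAt.comp (g := NH s (1 / 3) 3 (1 / 3) τ)
      (f := fun w : ℂ × ℂ => (w.2, shiftArg w.1 τ)) p
      (differentiableAt_NH hs (by norm_num) (by norm_num) _ hτ _) ?_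
    unfold shiftArg
    fun_prop
  have h3 : DifferentiableAt ℝ (fun w : ℂ × ℂ => 1 / 2 * e (3 * w.2 / 2)) p := by
    have : Differentiable ℝ e := differentiable_e.restrictScalars ℝ
    refine DifferentiableAt.const_mul ?_ _
    exact DifferentiableAt.comp (g := e) (f := fun w : ℂ × ℂ => 3 * w.2 / 2) p (this _)
      (by fun_prop)
  exact h1.sub (h3.mul h2)

/-! ### Elementary transformations of `F̂₂` -/

/-- The form `-3z₂²/2 + z₁z₂`. -/
noncomputable def Q2 (z₁ z₂ : ℂ) : ℂ := -3 * z₂ ^ 2 / 2 + z₁ * z₂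

lemma e_three_half_int (m : ℤ) : e (3 * m / 2) = (-1) ^ m := by
  rw [← e_int_half]
  exact e_eq_of_sub_eq_int m (by ring)

lemma F2Mer_add_int (m₁ m₂ : ℤ) (z₁ z₂ τ : ℂ) :
    F2Mer (z₁ + m₁) (z₂ + m₂) τ = (-1) ^ m₂ * F2Mer z₁ z₂ τ := by
  have h : ∀ a, F2MerTerm (z₁ + m₁) (z₂ + m₂) τ a = F2MerTerm z₁ z₂ τ a := by
    intro a
    have k1 : e (a * (z₁ + m₁) + 3 * a * (a + 1) / 2 * τ)
        = e (a * z₁ + 3 * a * (a + 1) / 2 * τ) :=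
      e_eq_of_sub_eq_int (a * m₁) (by push_cast; ring)
    have k2 : e (z₂ + m₂ + a * τ) = e (z₂ + a * τ) := e_eq_of_sub_eq_int m₂ (by ring)
    rw [F2MerTerm, F2MerTerm, k1, k2]
  rw [F2Mer, F2Mer, tsum_congr h, ← e_three_half_int, ← mul_assoc, ← e_add]
  congr 2
  ring

lemma eTerm_congr_int {D C r : ℝ} {τ : ℂ} {x y : ℂ × ℂ} {p : ℤ × ℤ} (m₁ m₂ : ℤ)
    (h1 : x.1 = y.1 + m₁) (h2 : x.2 = y.2 + m₂) : eTerm D C r τ x p = eTerm D C r τ y p := by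
  rw [eTerm, eTerm]
  refine e_eq_of_sub_eq_int (p.1 * m₁ + p.2 * m₂) ?_
  rw [h1, h2]; push_cast; ring

lemma errArg_add_int (D r : ℝ) (τ : ℂ) (x : ℂ × ℂ) (m₁ m₂ : ℤ) :
    errArg D r τ (x.1 + m₁, x.2 + m₂) = errArg D r τ x := by
  funext a
  simp [errArg, shiftL_apply]

lemma NH_add_int (s D C r : ℝ) (τ : ℂ) (x : ℂ × ℂ) (m₁ m₂ : ℤ) :
    NH s D C r τ (x.1 + m₁, x.2 + m₂) = NH s D C r τ x := by
  refine tsum_congr fun p => ?_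
  rw [nhTerm, nhTerm, errArg_add_int, eTerm_congr_int m₁ m₂ rfl rfl]

lemma GS_add_int (s D C r : ℝ) (τ : ℂ) (x : ℂ × ℂ) (m₁ m₂ : ℤ) :
    GS s D C r τ (x.1 + m₁, x.2 + m₂) = GS s D C r τ x := by
  refine tsum_congr fun p => ?_
  rw [gTerm, gTerm, errArg_add_int, eTerm_congr_int m₁ m₂ rfl rfl]

lemma F2hatJ_add_int {s : ℝ} (hs : 1 ≤ s) {τ : ℂ} (hτ : 0 < τ.im) (m₁ m₂ : ℤ) (z₁ z₂ : ℂ) :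
    F2hatJ s (z₁ + m₁) (z₂ + m₂) τ = (-1) ^ m₂ * F2hatJ s z₁ z₂ τ := by
  have h := NH_add_int s (1 / 3) 3 (1 / 3) τ (z₂, shiftArg z₁ τ) m₂ m₁
  rw [F2hatJ_eq hs hτ, F2hatJ_eq hs hτ, F2Mer_add_int, NH2, NH2,
    show shiftArg (z₁ + m₁) τ = shiftArg z₁ τ + m₁ by simp only [shiftArg]; ring, h,
    show 3 * (z₂ + m₂) / 2 = 3 * z₂ / 2 + 3 * m₂ / 2 by ring, e_add, e_three_half_int]
  ring

lemma even_mul_add_one_div_two (a : ℤ) : ∃ k : ℤ, (a : ℂ) * (a + 1) = 2 * k := by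
  obtain ⟨k, hk⟩ := Int.even_mul_succ_self a
  exact ⟨k, by rw [two_mul]; exact_mod_cast hk⟩

lemma F2Mer_add_one (z₁ z₂ τ : ℂ) : F2Mer z₁ z₂ (τ + 1) = F2Mer z₁ z₂ τ := by
  rw [F2Mer, F2Mer]
  congr 1
  refine tsum_congr fun a => ?_
  rw [F2MerTerm, F2MerTerm]
  congr 2
  · obtain ⟨k, hk⟩ := even_mul_add_one_div_two a
    refine e_eq_of_sub_eq_int (3 * k) ?_
    push_cast
    linear_combination 3 / 2 * hk
  · exact e_eq_of_sub_eq_int a (by ring)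

lemma NH2_add_one (s : ℝ) (z₁ z₂ τ : ℂ) : NH2 s z₁ z₂ (τ + 1) = NH2 s z₁ z₂ τ := by
  refine tsum_congr fun p => ?_
  rw [nhTerm, nhTerm]
  congr 1
  · simp [errArg, shiftL_apply, shiftArg_im]
  · rw [eTerm, eTerm]
    obtain ⟨k, hk⟩ := even_mul_add_one_div_two p.2
    refine e_eq_of_sub_eq_int (3 * k + p.1 * p.2) ?_
    simp only [qf_F2, shiftArg]
    push_cast
    linear_combination 3 / 2 * hk

lemma F2hatJ_add_one {s : ℝ} (hs : 1 ≤ s) {τ : ℂ} (hτ : 0 < τ.im) (z₁ z₂ : ℂ) :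
    F2hatJ s z₁ z₂ (τ + 1) = F2hatJ s z₁ z₂ τ := by
  rw [F2hatJ_eq hs hτ, F2hatJ_eq hs (by simpa using hτ), F2Mer_add_one, NH2_add_one]

lemma sg_sub_one (a : ℤ) : sg (a - 1) = sg a - if a = 0 then 2 else 0 := by
  split_ifs with h
  · subst h; rw [sg_of_neg (by norm_num), sg_of_nonneg le_rfl]; norm_num
  · rcases lt_or_gt_of_ne h with h | h
    · rw [sg_of_neg h, sg_of_neg (by omega), sub_zero]
    · rw [sg_of_nonneg h.le, sg_of_nonneg (by omega), sub_zero]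

/-- The wall-crossing sum of `F̂₂`. -/
noncomputable def wallF2 (z₁ τ : ℂ) : ℂ := ∑' b : ℤ, (-1) ^ b * e (b * z₁ + 3 * b * (b + 1) / 2 * τ)

lemma summable_wallF2 {τ : ℂ} (hτ : 0 < τ.im) (z₁ : ℂ) :
    Summable fun b : ℤ => (-1) ^ b * e (b * z₁ + 3 * b * (b + 1) / 2 * τ) := by
  have him3 : 0 < (3 * τ).im := by
    rw [show 3 * τ = ((3 : ℝ) : ℂ) * τ by push_cast; ring, Complex.im_ofReal_mul]; positivity
  refine (summable_e_gauss him3 (z₁ + 3 / 2 * τ + 1 / 2)).congr fun n => ?_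
  rw [← e_int_half, ← e_add]
  congr 1; ring

/-- The shift multiplies the a-th term by qᵃ = e(-z₂)X with X = e(z₂ + aτ), and X/(1 - X) = 1/(1 -
X) - 1. The -1 leaves a theta series that obstructs ellipticity. -/
lemma F2Mer_add_tau {τ : ℂ} (hτ : 0 < τ.im) (z₁ : ℂ) {z₂ : ℂ} (h : OffLattice z₂ τ) :
    F2Mer (z₁ + τ) z₂ τ = e (-z₂) * (F2Mer z₁ z₂ τ - e (3 * z₂ / 2) * wallF2 z₁ τ) := by
  have hs := summable_F2MerTerm hτ z₁ h
  have hw := summable_wallF2 hτ z₁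
  rw [F2Mer, F2Mer, wallF2, ← mul_sub, ← hs.tsum_sub hw, mul_left_comm,
    ← tsum_mul_left (a := e (-z₂))]
  refine congrArg (e (3 * z₂ / 2) * ·) (tsum_congr fun a => ?_)
  have h1 := h.one_sub_e_ne_zero a
  rw [F2MerTerm, F2MerTerm]
  have h2 : e (a * (z₁ + τ) + 3 * a * (a + 1) / 2 * τ)
      = e (-z₂) * e (z₂ + a * τ) * e (a * z₁ + 3 * a * (a + 1) / 2 * τ) := by
    rw [← e_add, ← e_add]; congr 1; ring
  rw [h2]
  field_simp
  ring

/-- The shift moves the first index by one. The error function follows, but the sign does not: it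
jumps by 2 at a = 0. The resulting column is the same theta series as in `F2Mer_add_tau`, so the two
defects cancel in F̂₂. -/
lemma NH2_add_tau {s : ℝ} (hs : 1 ≤ s) {τ : ℂ} (hτ : 0 < τ.im) (z₁ z₂ : ℂ) :
    NH2 s (z₁ + τ) z₂ τ = e (-z₂) * (NH2 s z₁ z₂ τ - 2 * wallF2 z₁ τ) := by
  have hN := summable_nhTerm hs (by norm_num : (0 : ℝ) < 1 / 3) (by norm_num : (0 : ℝ) < 3) (1 / 3)
    hτ (z₂, shiftArg z₁ τ)
  set w : ℤ × ℤ → ℂ := fun p => if p.1 = 0 then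
    (-1) ^ p.2 * e (p.2 * z₁ + 3 * p.2 * (p.2 + 1) / 2 * τ) else 0 with hw
  have hinj : Function.Injective fun b : ℤ => ((0 : ℤ), b) := fun a b hab => by simpa using hab
  have hsupp : ∀ p ∉ Set.range fun b : ℤ => ((0 : ℤ), b), w p = 0 := by
    rintro ⟨a, b⟩ hp
    by_cases ha : a = 0
    · exact absurd ⟨b, by simp [ha]⟩ hp
    · simp [hw, ha]
  have hwall : ∑' p, w p = wallF2 z₁ τ := by
    rw [wallF2, ← hinj.tsum_eq (f := w)]
    · simp [hw]
    · intro p hp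
      by_contra h
      exact hp (hsupp p h)
  have hws : Summable w := by
    rw [← hinj.summable_iff hsupp]
    exact (summable_wallF2 hτ z₁).congr fun b => by simp [hw]
  rw [NH2, NH2, NH, NH, ← hwall, ← tsum_mul_left, ← hN.tsum_sub (hws.mul_left 2), ← tsum_mul_left,
    ← (Equiv.addRight ((-1, 0) : ℤ × ℤ)).tsum_eq]
  refine tsum_congr fun p => ?_
  have hE : errArg (1 / 3) (1 / 3) τ (z₂, shiftArg (z₁ + τ) τ) (p.1 + -1)
      = errArg (1 / 3) (1 / 3) τ (z₂, shiftArg z₁ τ) p.1 := by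
    rw [errArg, errArg, shiftL_apply, shiftL_apply, shiftArg_im, shiftArg_im, Complex.add_im]
    push_cast; field_simp; ring
  have he : eTerm (1 / 3) 3 (1 / 3) τ (z₂, shiftArg (z₁ + τ) τ) (p.1 + -1, p.2 + 0)
      = e (-z₂) * eTerm (1 / 3) 3 (1 / 3) τ (z₂, shiftArg z₁ τ) p := by
    rw [eTerm, eTerm, ← e_add, qf_F2, qf_F2, shiftArg, shiftArg]
    congr 1
    push_cast; ring
  change nhTerm _ _ _ _ _ _ (p.1 + -1, p.2 + 0) = _
  rw [nhTerm, hE, he, nhTerm,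
    ← sub_eq_add_neg, sg_sub_one]
  by_cases hp : p.1 = 0
  · have hz : eTerm (1 / 3) 3 (1 / 3) τ (z₂, shiftArg z₁ τ) p
        = (-1) ^ p.2 * e (p.2 * z₁ + 3 * p.2 * (p.2 + 1) / 2 * τ) := by
      rw [eTerm, qf_F2, shiftArg, hp, ← e_int_half, ← e_add]
      congr 1
      push_cast; ring
    simp only [hw, hp, if_true, hz]
    push_cast
    ring
  · simp only [hw, hp, if_false]
    push_cast
    ring

lemma F2hatJ_add_tau {s : ℝ} (hs : 1 ≤ s) {τ : ℂ} (hτ : 0 < τ.im) (z₁ : ℂ) {z₂ : ℂ}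
    (h : OffLattice z₂ τ) : F2hatJ s (z₁ + τ) z₂ τ = e (-z₂) * F2hatJ s z₁ z₂ τ := by
  rw [F2hatJ_eq hs hτ, F2hatJ_eq hs hτ, F2Mer_add_tau hτ z₁ h, NH2_add_tau hs hτ]
  ring

/-! ### The inversion for `F̂₂` -/

/-- The dual lattice of the form `3b²/2 + ab`. -/
def dualEquivF2 : Fin 1 × (ℤ × ℤ) ≃ ℤ × ℤ where
  toFun x := (-3 * x.2.2 - x.2.1, -x.2.2)
  invFun y := (0, (3 * y.2 - y.1, -y.2))
  left_inv := by
    rintro ⟨k, a, b⟩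
    simp only [Prod.mk.injEq]
    exact ⟨Subsingleton.elim _ _, by ring, by ring⟩
  right_inv := by
    rintro ⟨m, l⟩
    simp only [Prod.mk.injEq]
    exact ⟨by ring, by ring⟩

/-- The form ab + 3b²/2 is unimodular (CD = 1), so the dual lattice is the lattice itself and a
single term appears. -/
lemma GS_F2 {τ : ℂ} (hτ : 0 < τ.im) (x y : ℂ) :
    GS 1 (1 / 3) 3 (1 / 3) (-1 / τ) (x / τ, y / τ) =
      ‖τ‖ * (e (Q2 y x / τ) * GS 1 (1 / 3) 3 (1 / 3) τ (x, y)) := by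
  have h0 : τ ≠ 0 := by rintro rfl; simp at hτ
  have h3 : (0 : ℝ) < 1 / 3 := by norm_num
  have h6 : (0 : ℝ) < 3 := by norm_num
  have hterm : ∀ (k : Fin 1) (p : ℤ × ℤ),
      gR (1 / 3) 3 (1 / 3) τ (x, y) (((dualEquivF2 (k, p)).2
            - (dualEquivF2 (k, p)).1 * (1 / 3)) / (1 / 3))
          (-(dualEquivF2 (k, p)).1 / 3
            - 1 / 3 * (((dualEquivF2 (k, p)).2 - (dualEquivF2 (k, p)).1 * (1 / 3)) / (1 / 3))) =
      gR (1 / 3) 3 (1 / 3) τ (x, y) p.1 p.2 := by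
    intro k p
    congr 1 <;> simp only [dualEquivF2, Equiv.coe_fn_mk] <;> push_cast <;> ring
  rw [GS_neg_inv h3 h6 (1 / 3) hτ (x, y), show (3 * (1 / 3) : ℝ) = 1 by norm_num, Real.sqrt_one,
    div_one, mul_assoc, GS_one_eq h3 3 (1 / 3) hτ]
  rw [tsum_tsum_regroup dualEquivF2 (F := fun m l => gR (1 / 3) 3 (1 / 3) τ (x, y)
      ((l - m * (1 / 3)) / (1 / 3)) (-m / 3 - 1 / 3 * ((l - m * (1 / 3)) / (1 / 3))))]
  · rw [Fin.sum_univ_one, tsum_congr (hterm 0)]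
    congr 3
    simp only [Q2]; push_cast; ring
  · intro k
    simp only [hterm]
    exact summable_gR h3 h6 (1 / 3) hτ _

lemma GS_F2_sub_tau {τ : ℂ} (hτ : 0 < τ.im) (x y : ℂ) :
    GS 1 (1 / 3) 3 (1 / 3) τ (x, y - τ) = e x * GS 1 (1 / 3) 3 (1 / 3) τ (x, y) := by
  rw [GS, GS, ← tsum_mul_left, ← (Equiv.addRight ((1, 0) : ℤ × ℤ)).tsum_eq]
  refine tsum_congr fun p => ?_
  have hE : errArg (1 / 3) (1 / 3) τ (x, y - τ) (p.1 + 1) = errArg (1 / 3) (1 / 3) τ (x, y) p.1 := by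
    rw [errArg, errArg, shiftL_apply, shiftL_apply, Complex.sub_im]
    push_cast; field_simp; ring
  have he : eTerm (1 / 3) 3 (1 / 3) τ (x, y - τ) (p.1 + 1, p.2 + 0)
      = e x * eTerm (1 / 3) 3 (1 / 3) τ (x, y) p := by
    rw [eTerm, eTerm, ← e_add, qf_F2, qf_F2]
    congr 1
    push_cast; ring
  change gTerm _ _ _ _ _ _ (p.1 + 1, p.2 + 0) = _
  rw [gTerm, hE, he, gTerm]
  ring

/-- The antiholomorphic derivative of `F̂₂` in `z₁`. -/
noncomputable def F2dbar (z₁ z₂ τ : ℂ) : ℂ :=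
  Complex.I * (Real.sqrt (2 / 3) / 2 : ℝ) / (Real.sqrt τ.im : ℝ) *
    (e (3 * z₂ / 2) * GS 1 (1 / 3) 3 (1 / 3) τ (z₂, shiftArg z₁ τ))

lemma hasDerivAt_F2Mer_fst {τ : ℂ} (hτ : 0 < τ.im) (z₁ : ℂ) {z₂ : ℂ} (h : OffLattice z₂ τ) :
    HasDerivAt (fun w => F2Mer w z₂ τ) (deriv (fun w => F2Mer w z₂ τ) z₁) z₁ := by
  refine DifferentiableAt.hasDerivAt ?_
  exact DifferentiableAt.comp (g := fun w : ℂ × ℂ => F2Mer w.1 w.2 τ) (f := fun w => (w, z₂)) z₁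
    (differentiableAt_F2Mer hτ h) (by fun_prop)

lemma hasDerivAt_shiftArg (τ z : ℂ) : HasDerivAt (fun w => shiftArg w τ) 1 z :=
  ((hasDerivAt_id z).add_const _).add_const _

lemma hasWirt_F2hatJ_fst {τ : ℂ} (hτ : 0 < τ.im) (z₁ : ℂ) {z₂ : ℂ} (h : OffLattice z₂ τ) :
    ∃ p, HasWirt (fun w => F2hatJ 1 w z₂ τ) p (F2dbar z₁ z₂ τ) z₁ := by
  simp only [F2hatJ_eq le_rfl hτ]
  have h1 := HasDerivAt.hasWirt (hasDerivAt_F2Mer_fst hτ z₁ h)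
  have h2 := (hasWirt_NH le_rfl (by norm_num : (0 : ℝ) < 1 / 3) (by norm_num : (0 : ℝ) < 3)
    (1 / 3) hτ (hasDerivAt_const z₁ z₂) (hasDerivAt_shiftArg τ z₁)).const_mul
      (1 / 2 * e (3 * z₂ / 2))
  refine ⟨_, (h1.sub h2).congr_deriv rfl ?_⟩
  have k1 := congrArg (fun x : ℝ => (x : ℂ))
    (sqrt_div_self_im (by norm_num : (0 : ℝ) ≤ 2 / 3) hτ)
  simp only [Complex.ofReal_div] at k1
  rw [F2dbar, show 2 * (1 / 3) * τ.im = 2 / 3 * τ.im by ring]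
  simp only [mul_one, sub_zero, Complex.conj_ofReal]
  generalize GS 1 (1 / 3) 3 (1 / 3) τ (z₂, shiftArg z₁ τ) = A
  push_cast at k1 ⊢
  linear_combination (Complex.I / 2 * A * e (3 * z₂ / 2)) * k1

lemma F2dbar_neg_inv {τ : ℂ} (hτ : 0 < τ.im) (z₁ z₂ : ℂ) :
    F2dbar (z₁ / τ) (z₂ / τ) (-1 / τ) * conj (1 / τ) =
      τ * (e (Q2 z₁ z₂ / τ) * F2dbar z₁ z₂ τ) := by
  have h0 : τ ≠ 0 := by rintro rfl; simp at hτ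
  have hc0 : conj τ ≠ 0 := by simpa using h0
  have k1 := congrArg (fun x : ℝ => (x : ℂ)) (inv_sqrt_im_neg_inv hτ)
  simp only [Complex.ofReal_div, Complex.ofReal_one] at k1
  have k2 : (‖τ‖ : ℂ) * ‖τ‖ = τ * conj τ := by rw [Complex.mul_conj', sq]
  have h1 := GS_F2 hτ z₂ (shiftArg z₁ τ - τ - 2)
  have h2 := GS_F2_sub_tau hτ z₂ (shiftArg z₁ τ)
  have h3 := GS_add_int 1 (1 / 3) 3 (1 / 3) τ (z₂, shiftArg z₁ τ - τ - 2) 0 2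
  -- The argument `shiftArg` is compatible with inversion only up to the lattice vector τ + 2, which
  -- is undone with `GS_F2_sub_tau` and integer periodicity.
  have e1 : (shiftArg z₁ τ - τ - 2) / τ = shiftArg (z₁ / τ) (-1 / τ) := by
    simp only [shiftArg]; field_simp; ring
  simp only [Int.cast_zero, add_zero, Int.cast_ofNat, sub_add_cancel] at h3
  rw [e1, ← h3, h2] at h1
  rw [F2dbar, F2dbar, h1, div_eq_mul_one_div _ ((Real.sqrt (-1 / τ).im : ℝ) : ℂ), k1]
  have he : e (3 * (z₂ / τ) / 2) * e (Q2 (shiftArg z₁ τ - τ - 2) z₂ / τ) * e z₂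
      = e (Q2 z₁ z₂ / τ) * e (3 * z₂ / 2) := by
    rw [← e_add, ← e_add, ← e_add]
    congr 1
    simp only [Q2, shiftArg]; field_simp; ring
  rw [map_div₀, map_one]
  generalize GS 1 (1 / 3) 3 (1 / 3) τ (z₂, shiftArg z₁ τ) = A
  set r : ℂ := ((Real.sqrt (2 / 3) / 2 : ℝ) : ℂ)
  set w : ℂ := ((Real.sqrt τ.im : ℝ) : ℂ)
  calc _ = Complex.I * r / w * A * (e (3 * (z₂ / τ) / 2) * e (Q2 (shiftArg z₁ τ - τ - 2) z₂ / τ)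
        * e z₂) * ((‖τ‖ : ℂ) * ‖τ‖ / conj τ) := by ring
    _ = _ := by
      rw [he, k2, mul_div_cancel_right₀ _ hc0]; ring

lemma OffLattice.div_neg_inv {z τ : ℂ} (h0 : τ ≠ 0) (h : OffLattice z τ) :
    OffLattice (z / τ) (-1 / τ) := by
  intro m n hmn
  refine h n (-m) ?_
  have := congrArg (· * τ) hmn
  simp only [div_mul_cancel₀ _ h0] at this
  rw [this]; field_simp; push_cast; ring

lemma F2hatJ_neg_inv {τ : ℂ} (hτ : 0 < τ.im) (z₁ : ℂ) {z₂ : ℂ} (h : OffLattice z₂ τ) :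
    F2hatJ 1 (z₁ / τ) (z₂ / τ) (-1 / τ) = τ * (e (Q2 z₁ z₂ / τ) * F2hatJ 1 z₁ z₂ τ) := by
  have h0 : τ ≠ 0 := by rintro rfl; simp at hτ
  have hτ' := neg_inv_im_pos hτ
  have h' := h.div_neg_inv h0
  -- Regarded as a function of z₁, the difference has no quadratic exponent; its multipliers are 1
  -- and e(-z₂), a degree-zero bundle that is nontrivial because z₂ is off the lattice.
  set f : ℂ → ℂ := fun w => e (-(Q2 w z₂ / τ)) *
    (F2hatJ 1 (w / τ) (z₂ / τ) (-1 / τ) - τ * (e (Q2 w z₂ / τ) * F2hatJ 1 w z₂ τ)) with hf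
  have hdQ : ∀ c w : ℂ, HasDerivAt (fun w => e (c * Q2 w z₂))
      (2 * Real.pi * Complex.I * e (c * Q2 w z₂) * (c * z₂)) w := by
    intro c w
    refine (hasDerivAt_e _).comp w (HasDerivAt.const_mul c ?_)
    simpa [Q2] using ((hasDerivAt_id w).mul_const z₂).const_add (-3 * z₂ ^ 2 / 2)
  have hd : Differentiable ℂ f := by
    intro w
    obtain ⟨p, hp⟩ := hasWirt_F2hatJ_fst hτ w h
    obtain ⟨p', hp'⟩ := hasWirt_F2hatJ_fst hτ' (w / τ) h'
    have hdiv : HasDerivAt (fun w : ℂ => w / τ) (1 / τ) w := (hasDerivAt_id w).div_const τ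
    have a1 := HasWirt.comp (h := fun w : ℂ => w / τ) hp' hdiv
    have a2 := (HasWirt.mul_left (hdQ (1 / τ) w) hp).const_mul τ
    have a3 := HasWirt.mul_left (hdQ (-(1 / τ)) w) (a1.sub a2)
    have e1 : ∀ w, -(1 / τ) * Q2 w z₂ = -(Q2 w z₂ / τ) := fun w => by ring
    have e2 : ∀ w, 1 / τ * Q2 w z₂ = Q2 w z₂ / τ := fun w => by ring
    simp only [e1, e2] at a3
    refine HasWirt.differentiableAt (p := _) (a3.congr_deriv rfl ?_)
    rw [F2dbar_neg_inv hτ, sub_self, mul_zero]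
  have hp1 : ∀ w, f (w + 1) = f w := by
    intro w
    have e1 : F2hatJ 1 ((w + 1) / τ) (z₂ / τ) (-1 / τ)
        = e (z₂ / τ) * F2hatJ 1 (w / τ) (z₂ / τ) (-1 / τ) := by
      have := F2hatJ_add_tau le_rfl hτ' ((w + 1) / τ) h'
      rw [show (w + 1) / τ + -1 / τ = w / τ by ring] at this
      rw [this, ← mul_assoc, ← e_add, add_neg_cancel, e_zero, one_mul]
    have e2 : F2hatJ 1 (w + 1) z₂ τ = F2hatJ 1 w z₂ τ := by
      simpa using F2hatJ_add_int le_rfl hτ 1 0 w z₂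
    have e3 : e (Q2 (w + 1) z₂ / τ) = e (z₂ / τ) * e (Q2 w z₂ / τ) := by
      rw [← e_add]; congr 1; simp only [Q2]; ring
    have e4 : e (-(Q2 (w + 1) z₂ / τ)) * e (z₂ / τ) = e (-(Q2 w z₂ / τ)) := by
      rw [← e_add]; congr 1; simp only [Q2]; ring
    simp only [hf, e1, e2, e3]
    rw [← e4]; ring
  have hp2 : ∀ w, f (w + τ) = e (-z₂) * f w := by
    intro w
    have e1 : F2hatJ 1 ((w + τ) / τ) (z₂ / τ) (-1 / τ) = F2hatJ 1 (w / τ) (z₂ / τ) (-1 / τ) := by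
      rw [add_div, div_self h0]
      simpa using F2hatJ_add_int le_rfl hτ' 1 0 (w / τ) (z₂ / τ)
    have e2 := F2hatJ_add_tau le_rfl hτ w h
    have e3 : e (Q2 (w + τ) z₂ / τ) * e (-z₂) = e (Q2 w z₂ / τ) := by
      rw [← e_add]; congr 1; simp only [Q2]; field_simp; ring
    have e4 : e (-(Q2 (w + τ) z₂ / τ)) = e (-z₂) * e (-(Q2 w z₂ / τ)) := by
      rw [← e_add]; congr 1; simp only [Q2]; field_simp; ring
    simp only [hf, e1, e2, e4]
    rw [← e3]; ring
  have := eq_zero_of_degree_zero hτ h hd hp1 hp2 z₁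
  exact sub_eq_zero.1 ((mul_eq_zero.1 this).resolve_left (e_ne_zero _))

lemma OffLattice.add {z τ : ℂ} (h : OffLattice z τ) (n m : ℤ) : OffLattice (z + n * τ + m) τ := by
  intro a b hab
  refine h (a - n) (b - m) ?_
  push_cast
  linear_combination hab

/-- Inversion turns translation by n₁τ, n₂τ into translation by integers, which is elementary. In
particular the shift of z₂ by τ needs no direct computation. -/
lemma F2hatJ_elliptic {τ : ℂ} (hτ : 0 < τ.im) (n₁ n₂ m₁ m₂ : ℤ) (z₁ : ℂ) {z₂ : ℂ}
    (h : OffLattice z₂ τ) :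
    F2hatJ 1 (z₁ + n₁ * τ + m₁) (z₂ + n₂ * τ + m₂) τ = (-1) ^ (n₂ + m₂) *
      e ((3 * n₂ - n₁) * z₂ - n₂ * z₁ + (3 * n₂ ^ 2 / 2 - n₁ * n₂) * τ) * F2hatJ 1 z₁ z₂ τ := by
  have h0 : τ ≠ 0 := by rintro rfl; simp at hτ
  have hτ' := neg_inv_im_pos hτ
  have h1 : OffLattice (z₂ + n₂ * τ) τ := by simpa using h.add n₂ 0
  have k1 := F2hatJ_neg_inv hτ (z₁ + n₁ * τ) h1
  have k2 := F2hatJ_neg_inv hτ z₁ h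
  have k3 := F2hatJ_add_int le_rfl hτ' n₁ n₂ (z₁ / τ) (z₂ / τ)
  have e1 : ∀ (z : ℂ) (n : ℤ), (z + n * τ) / τ = z / τ + n := fun z n => by field_simp
  rw [e1, e1, k3, k2, mul_left_comm] at k1
  have k4 := mul_left_cancel₀ h0 k1
  have k5 : F2hatJ 1 (z₁ + n₁ * τ) (z₂ + n₂ * τ) τ = (-1) ^ n₂ *
      e ((3 * n₂ - n₁) * z₂ - n₂ * z₁ + (3 * n₂ ^ 2 / 2 - n₁ * n₂) * τ) * F2hatJ 1 z₁ z₂ τ := by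
    have e2 : e (Q2 z₁ z₂ / τ) = e (Q2 (z₁ + n₁ * τ) (z₂ + n₂ * τ) / τ) *
        e ((3 * n₂ - n₁) * z₂ - n₂ * z₁ + (3 * n₂ ^ 2 / 2 - n₁ * n₂) * τ) := by
      rw [← e_add]; congr 1; simp only [Q2]; field_simp; ring
    rw [e2] at k4
    refine mul_left_cancel₀ (e_ne_zero (Q2 (z₁ + n₁ * τ) (z₂ + n₂ * τ) / τ)) ?_
    rw [← k4]; ring
  rw [F2hatJ_add_int le_rfl hτ, k5, zpow_add₀ (by norm_num)]
  ring

/-! ### The full modular group -/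

lemma coe_smul_eq (γ : SL(2, ℤ)) (τ : ℍ) : ((γ • τ : ℍ) : ℂ) =
    ((γ 0 0 : ℂ) * τ + (γ 0 1 : ℂ)) / ((γ 1 0 : ℂ) * τ + (γ 1 1 : ℂ)) := by
  simpa using UpperHalfPlane.coe_specialLinearGroup_apply γ τ

lemma det_eq_one (γ : SL(2, ℤ)) : γ 0 0 * γ 1 1 - γ 0 1 * γ 1 0 = 1 := by
  have := γ.det_coe
  rwa [Matrix.det_fin_two] at this

lemma det_eq_one_complex (γ : SL(2, ℤ)) : (γ 0 0 : ℂ) * γ 1 1 - γ 0 1 * γ 1 0 = 1 := by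
  exact_mod_cast det_eq_one γ

/-- The automorphy factor `cτ + d`. -/
noncomputable def autj (γ : SL(2, ℤ)) (τ : ℂ) : ℂ := (γ 1 0 : ℂ) * τ + (γ 1 1 : ℂ)

lemma autj_ne_zero (γ : SL(2, ℤ)) (τ : ℍ) : autj γ τ ≠ 0 := by
  have := UpperHalfPlane.denom_ne_zero (γ : GL (Fin 2) ℝ) τ
  rwa [ModularGroup.denom_apply] at this

lemma autj_mul (γ δ : SL(2, ℤ)) (τ : ℍ) :
    autj (γ * δ) τ = autj γ ((δ • τ : ℍ) : ℂ) * autj δ τ := by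
  have h := autj_ne_zero δ τ
  rw [autj, autj, coe_smul_eq]
  rw [autj] at h
  rw [autj, add_mul, mul_assoc, div_mul_cancel₀ _ h]
  simp [Matrix.mul_apply, Fin.sum_univ_two]
  ring

/-- The cocycle relation behind the additivity of the exponents cQ(z)/(cτ + d) under composition. -/
lemma mul_one_zero_eq (γ δ : SL(2, ℤ)) (τ : ℍ) :
    ((γ * δ) 1 0 : ℂ) * autj δ τ = γ 1 0 + δ 1 0 * autj (γ * δ) τ := by
  have h := det_eq_one_complex δ
  simp [autj, Matrix.mul_apply, Fin.sum_univ_two]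
  linear_combination (γ 1 0 : ℂ) * h

lemma OffLattice.smul {z : ℂ} {τ : ℍ} (h : OffLattice z τ) (γ : SL(2, ℤ)) :
    OffLattice (z / autj γ τ) ((γ • τ : ℍ) : ℂ) := by
  intro m n hmn
  have hj := autj_ne_zero γ τ
  refine h (m * γ 0 0 + n * γ 1 0) (m * γ 0 1 + n * γ 1 1) ?_
  rw [coe_smul_eq, ← autj, div_eq_iff hj, add_mul, mul_assoc, div_mul_cancel₀ _ hj] at hmn
  rw [hmn, autj]
  push_cast
  ring

/-- The transformation law of a Jacobi form of weight one and index form `Q2`. -/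
def JacobiLaw (γ : SL(2, ℤ)) : Prop := ∀ (z₁ z₂ : ℂ) (τ : ℍ), OffLattice z₂ τ →
  F2hatJ 1 (z₁ / autj γ τ) (z₂ / autj γ τ) ((γ • τ : ℍ) : ℂ) =
    autj γ τ * (e (γ 1 0 * Q2 z₁ z₂ / autj γ τ) * F2hatJ 1 z₁ z₂ τ)

lemma JacobiLaw.mul {γ δ : SL(2, ℤ)} (hγ : JacobiLaw γ) (hδ : JacobiLaw δ) :
    JacobiLaw (γ * δ) := by
  intro z₁ z₂ τ h
  have h1 := hγ (z₁ / autj δ τ) (z₂ / autj δ τ) (δ • τ) (h.smul δ)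
  have h2 := hδ z₁ z₂ τ h
  have hj := autj_ne_zero δ τ
  have hj' := autj_ne_zero γ (δ • τ)
  have hm := mul_one_zero_eq γ δ τ
  rw [autj_mul] at hm ⊢
  rw [mul_smul, mul_comm (autj γ _), ← div_div, ← div_div, h1, h2]
  rw [show ∀ a b c d f : ℂ, a * (b * (c * (d * f))) = c * a * ((b * d) * f) by intros; ring, ← e_add]
  congr 3
  simp only [Q2]
  field_simp
  linear_combination (-(3 * z₂ ^ 2) + 2 * z₁ * z₂) * (-hm)

lemma JacobiLaw.inv {γ : SL(2, ℤ)} (hγ : JacobiLaw γ) : JacobiLaw γ⁻¹ := by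
  intro z₁ z₂ τ h
  have h1 := hγ (z₁ / autj γ⁻¹ τ) (z₂ / autj γ⁻¹ τ) (γ⁻¹ • τ) (h.smul γ⁻¹)
  have hj := autj_ne_zero γ⁻¹ τ
  have hj' := autj_ne_zero γ (γ⁻¹ • τ)
  have hm := autj_mul γ γ⁻¹ τ
  have hc := mul_one_zero_eq γ γ⁻¹ τ
  rw [mul_inv_cancel] at hm hc
  have hone : autj 1 τ = 1 := by simp [autj]
  rw [hone] at hm hc
  rw [div_div, div_div, mul_comm (autj γ⁻¹ _), ← hm, div_one, div_one, smul_inv_smul] at h1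
  rw [h1]
  have hc' : (γ 1 0 : ℂ) = -γ⁻¹ 1 0 := by
    have : ((1 : SL(2, ℤ)) 1 0 : ℂ) = 0 := by simp
    rw [this] at hc
    linear_combination -hc
  rw [show ∀ a b c d f : ℂ, a * (b * (c * (d * f))) = (c * a) * ((b * d) * f) by intros; ring,
    ← e_add, ← hm, one_mul]
  have hx : autj γ ((γ⁻¹ • τ : ℍ) : ℂ) = 1 / autj γ⁻¹ τ := by
    rw [eq_div_iff hj, ← hm]
  rw [hx, hc']
  convert (one_mul _).symm
  refine (congrArg e ?_).trans e_zero
  simp only [Q2]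
  field_simp
  ring

lemma jacobiLaw (γ : SL(2, ℤ)) : JacobiLaw γ := by
  have hmem : γ ∈ Subgroup.closure {ModularGroup.S, ModularGroup.T} := by
    simp [SpecialLinearGroup.SL2Z_generators]
  induction hmem using Subgroup.closure_induction with
  | mem x hx =>
    rcases hx with rfl | rfl
    · intro z₁ z₂ τ h
      have h1 := F2hatJ_neg_inv τ.im_pos z₁ h
      have h2 : ((ModularGroup.S • τ : ℍ) : ℂ) = -1 / τ := by
        rw [coe_smul_eq]; simp [ModularGroup.S]
      have h3 : autj ModularGroup.S τ = τ := by simp [autj, ModularGroup.S]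
      rw [h2, h3, h1]
      simp [ModularGroup.S]
    · intro z₁ z₂ τ h
      have h2 : ((ModularGroup.T • τ : ℍ) : ℂ) = τ + 1 := by
        rw [coe_smul_eq]; simp [ModularGroup.T]
      have h3 : autj ModularGroup.T τ = 1 := by simp [autj, ModularGroup.T]
      rw [h2, h3, div_one, div_one, F2hatJ_add_one le_rfl τ.im_pos]
      simp [ModularGroup.T, e_zero]
  | one =>
    intro z₁ z₂ τ h
    simp [autj, e_zero]
  | mul x y _ _ hx hy => exact hx.mul hy
  | inv x _ hx => exact hx.inv

/-! ### Holomorphic parts of the Jacobi versions -/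

lemma tendsto_NH_zero {D C : ℝ} (hD : 0 < D) (hC : 0 < C) {r : ℝ} {τ : ℂ}
    (hτ : 0 < τ.im) {x : ℂ × ℂ} (h0 : 0 < shiftL D r τ.im x) (h1 : shiftL D r τ.im x < 1) :
    Tendsto (fun s => NH s D C r τ x) atTop (𝓝 0) := by
  simpa [NH] using tendsto_weight_nhTerm_zero hD hC hτ h0 h1 zero_le_one norm_weight_one_le

lemma tendsto_F2hatJ {z₁ z₂ τ : ℂ} (hy : 0 < z₂.im) (hy' : z₂.im < τ.im)
    (h0 : 1 / 6 < (3 * z₂.im - z₁.im) / (3 * τ.im))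
    (h1 : (3 * z₂.im - z₁.im) / (3 * τ.im) < 1 / 2) :
    Tendsto (fun s : ℝ => F2hatJ s z₁ z₂ τ) atTop (𝓝 (F2J z₁ z₂ τ)) := by
  have hτ := hy.trans hy'
  -- This is why the assumption reads 1/6 < ... < 1/2: it says exactly that the shift of the block
  -- lies strictly between 0 and 1.
  have hL : shiftL (1 / 3) (1 / 3) τ.im (z₂, shiftArg z₁ τ)
      = 3 / 2 - 3 * ((3 * z₂.im - z₁.im) / (3 * τ.im)) := by
    rw [shiftL_apply, shiftArg_im]; field_simp; ring
  have h := (tendsto_NH_zero (by norm_num : (0 : ℝ) < 1 / 3) (by norm_num : (0 : ℝ) < 3) hτ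
    (x := (z₂, shiftArg z₁ τ)) (r := 1 / 3) (by rw [hL]; linarith) (by rw [hL]; linarith)).const_mul
      (1 / 2 * e (3 * z₂ / 2))
  have h2 := h.const_sub (F2Mer z₁ z₂ τ)
  rw [mul_zero, sub_zero, F2Mer_eq_F2J hy hy'] at h2
  refine h2.congr' ?_
  filter_upwards [eventually_ge_atTop 1] with s hs
  rw [F2hatJ_eq hs hτ, F2Mer_eq_F2J hy hy', NH2]

lemma tendsto_F3hatJ {z₁ z₂ τ : ℂ} (hτ : 0 < τ.im)
    (h0 : 0 < (3 * z₂.im - z₁.im) / (3 * τ.im)) (h1 : (3 * z₂.im - z₁.im) / (3 * τ.im) < 1)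
    (h2 : 0 < (z₁.im - 2 * z₂.im) / τ.im) (h3 : (z₁.im - 2 * z₂.im) / τ.im < 1) :
    Tendsto (fun s : ℝ => F3hatJ s z₁ z₂ τ) atTop (𝓝 (F3J z₁ z₂ τ)) := by
  have hL : shiftL 3 3 τ.im (z₁, z₂) = (3 * z₂.im - z₁.im) / (3 * τ.im) := shiftL_apply ..
  have hL' : shiftL (1 / 2) (1 / 2) τ.im (z₂, z₁) = (z₁.im - 2 * z₂.im) / τ.im := by
    rw [shiftL_apply]; field_simp
  have k1 := (tendsto_NH_zero three_pos one_pos hτ (x := (z₁, z₂)) (r := 3)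
    (by rwa [hL]) (by rwa [hL])).const_mul (1 / 2)
  have k2 := (tendsto_NH_zero (by norm_num : (0 : ℝ) < 1 / 2) (by norm_num : (0 : ℝ) < 6) hτ
    (x := (z₂, z₁)) (r := 1 / 2) (by rwa [hL']) (by rwa [hL'])).const_mul (1 / 2)
  have k3 := (k1.const_sub (F3J z₁ z₂ τ)).sub k2
  rw [mul_zero, sub_zero, sub_zero] at k3
  refine k3.congr' ?_
  filter_upwards [eventually_ge_atTop 1] with s hs
  rw [F3hatJ_eq hs hτ]

/-! ### Holomorphic parts of the specializations -/

lemma norm_weight_le (α β γ : ℂ) (p : ℤ × ℤ) :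
    ‖α * p.1 + β * p.2 + γ‖ ≤ (‖α‖ + ‖β‖ + ‖γ‖) * (1 + |(p.1 : ℝ)| + |(p.2 : ℝ)|) := by
  have h := norm_add₃_le (a := α * p.1) (b := β * p.2) (c := γ)
  rw [norm_mul, norm_mul, Complex.norm_intCast, Complex.norm_intCast] at h
  have := mul_nonneg (norm_nonneg α) (abs_nonneg (p.2 : ℝ))
  have := mul_nonneg (norm_nonneg β) (abs_nonneg (p.1 : ℝ))
  have := mul_nonneg (norm_nonneg γ) (abs_nonneg (p.1 : ℝ))
  have := mul_nonneg (norm_nonneg γ) (abs_nonneg (p.2 : ℝ))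
  nlinarith [norm_nonneg α, norm_nonneg β]

lemma tsum_weights_nhTerm {s D C : ℝ} (hs : 1 ≤ s) (hD : 0 < D) (hC : 0 < C) (r : ℝ) {τ : ℂ}
    (hτ : 0 < τ.im) (x : ℂ × ℂ) (α β γ : ℂ) :
    ∑' p : ℤ × ℤ, (α * p.1 + β * p.2 + γ) * nhTerm s D C r τ x p =
      α * (∑' p : ℤ × ℤ, p.1 * nhTerm s D C r τ x p)
        + β * (∑' p : ℤ × ℤ, p.2 * nhTerm s D C r τ x p) + γ * NH s D C r τ x :=
  tsum_weights (summable_nhTerm hs hD hC r hτ x)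
    (summable_weight_nhTerm hs hD hC r hτ x zero_le_one norm_weight_fst_le)
    (summable_weight_nhTerm hs hD hC r hτ x zero_le_one norm_weight_snd_le) α β γ

/-- A sum over `ℤ` that is odd about `-1/2` vanishes. -/
lemma tsum_eq_zero_of_odd {f : ℤ → ℂ} (h : ∀ b, f (-1 - b) = -f b) : ∑' b, f b = 0 := by
  have h1 := (Equiv.subLeft (-1 : ℤ)).tsum_eq f
  simp only [Equiv.subLeft_apply, h, tsum_neg] at h1
  linear_combination (-1 / 2) * h1

/-- The direction (2, 1) gives rh₂' - h₁' = 1 for the block (3, 1, 3), hence a Gaussian term. For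
the block (1/2, 6, 1/2) it gives 0: the operator is tangent to the wall on which that block sits. -/
lemma F3hat_eq {s : ℝ} (hs : 1 ≤ s) {τ : ℂ} (hτ : 0 < τ.im) :
    F3hat s τ = F3 τ - 3 * e τ / 8 *
      ((∑' p : ℤ × ℤ, (2 * p.1 + 1 * p.2 + 1 : ℂ) *
          nhTerm s 3 1 3 τ (3 * τ, 3 * τ / 2 + 1 / 2) p)
        + Complex.I * Real.sqrt (2 * 3 * τ.im) / (3 * τ.im) / (2 * Real.pi * Complex.I) *
          (s * GS s 3 1 3 τ (3 * τ, 3 * τ / 2 + 1 / 2))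
        + ∑' p : ℤ × ℤ, (1 * p.1 + 2 * p.2 + 1 : ℂ) *
          nhTerm s (1 / 2) 6 (1 / 2) τ (3 * τ / 2 + 1 / 2, 3 * τ) p) := by
  have h2 : (0 : ℝ) < 1 / 2 := by norm_num
  have h6 : (0 : ℝ) < 6 := by norm_num
  rw [F3_eq_specialize hτ, F3hat, specialize3, specialize3]
  generalize 3 * τ / 2 + 1 / 2 = y
  generalize 3 * τ = x
  simp only [F3hatJ_eq hs hτ]
  have A1 := HasDerivAt.hasWirt (hasDerivAt_F3J_fst hτ x y)
  have A2 := HasDerivAt.hasWirt (hasDerivAt_F3J_snd hτ x y)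
  have B1 := (hasWirt_NH hs three_pos one_pos 3 hτ (hasDerivAt_id x)
    (hasDerivAt_const x y)).const_mul (1 / 2)
  have B2 := (hasWirt_NH hs three_pos one_pos 3 hτ (hasDerivAt_const y x)
    (hasDerivAt_id y)).const_mul (1 / 2)
  have C1 := (hasWirt_NH hs h2 h6 (1 / 2) hτ (hasDerivAt_const x y)
    (hasDerivAt_id x)).const_mul (1 / 2)
  have C2 := (hasWirt_NH hs h2 h6 (1 / 2) hτ (hasDerivAt_id y)
    (hasDerivAt_const y x)).const_mul (1 / 2)
  have D1 := ((A1.sub B1).sub C1).zetaD_eq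
  have D2 := ((A2.sub B2).sub C2).zetaD_eq
  simp only [id] at D1 D2
  rw [D1, D2, A1.zetaD_eq, A2.zetaD_eq, tsum_weights_nhTerm hs three_pos one_pos 3 hτ,
    tsum_weights_nhTerm hs h2 h6 (1 / 2) hτ]
  have hpi : (Real.pi : ℂ) ≠ 0 := by exact_mod_cast Real.pi_ne_zero
  push_cast
  field_simp
  ring

lemma tendsto_F3hat {τ : ℂ} (hτ : 0 < τ.im) :
    Tendsto (fun s : ℝ => F3hat s τ) atTop (𝓝 (F3 τ)) := by
  have h2 : (0 : ℝ) < 1 / 2 := by norm_num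
  have h6 : (0 : ℝ) < 6 := by norm_num
  have i1 : (3 * τ).im = 3 * τ.im := by simp
  have i2 : (3 * τ / 2 + 1 / 2).im = 3 / 2 * τ.im := by
    rw [show 3 * τ / 2 + 1 / 2 = ((3 / 2 : ℝ) : ℂ) * τ + ((1 / 2 : ℝ) : ℂ) by push_cast; ring]
    simp only [Complex.add_im, Complex.im_ofReal_mul, Complex.ofReal_im, add_zero]
  have hL : shiftL 3 3 τ.im (3 * τ, 3 * τ / 2 + 1 / 2) = 1 / 2 := by
    rw [shiftL_apply, i1, i2]; field_simp; ring
  have hL' : shiftL (1 / 2) (1 / 2) τ.im (3 * τ / 2 + 1 / 2, 3 * τ) = 0 := by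
    rw [shiftL_apply, i1, i2]; field_simp; ring
  have k1 := tendsto_weight_nhTerm_zero three_pos one_pos hτ (by rw [hL]; norm_num)
    (by rw [hL]; norm_num) (by positivity) (norm_weight_le 2 1 1)
  have k2 := (tendsto_mul_GS_zero three_pos one_pos hτ (x := (3 * τ, 3 * τ / 2 + 1 / 2)) (r := 3)
    (by rw [hL]; norm_num) (by rw [hL]; norm_num)).const_mul
    (Complex.I * Real.sqrt (2 * 3 * τ.im) / (3 * τ.im) / (2 * Real.pi * Complex.I))
  -- The column on the wall has weight 2b + 1, odd under b ↦ -1-b, while its exponential is even, so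
  -- the limit is 0.
  have k3 := tendsto_weight_nhTerm_wall h2 h6 hτ hL' (by positivity) (norm_weight_le 1 2 1)
  rw [tsum_eq_zero_of_odd] at k3
  · have k4 := ((((k1.add k2).add k3).const_mul (3 * e τ / 8))).const_sub (F3 τ)
    simp only [mul_zero, add_zero, sub_zero] at k4
    refine k4.congr' ?_
    filter_upwards [eventually_ge_atTop 1] with s hs
    rw [F3hat_eq hs hτ]
  · intro b
    have : e (((-1 - b : ℤ) : ℂ) * (3 * τ) + ((6 / 2 : ℝ) : ℂ) * ((-1 - b : ℤ) : ℂ) ^ 2 * τ)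
        = e (b * (3 * τ) + ((6 / 2 : ℝ) : ℂ) * (b : ℂ) ^ 2 * τ) := by
      congr 1; push_cast; ring
    simp only [this]
    push_cast
    ring

/-- The constant 6 is 4 · 3/2, from differentiating ζ₂^{3/2}. There is no Gaussian term since 12/3 -
4 = 0: the operator is tangent to the wall through the special point. -/
lemma F2hat_eq {s : ℝ} (hs : 1 ≤ s) {τ : ℂ} (hτ : 0 < τ.im) :
    F2hat s τ = F2 τ - e (τ / 2) * e (3 * τ / 2) / 8 *
      ∑' p : ℤ × ℤ, (4 * p.1 + 12 * p.2 + 6 : ℂ) *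
          nhTerm s (1 / 3) 3 (1 / 3) (2 * τ) (τ, shiftArg (1 / 2) (2 * τ)) p := by
  have h3 : (0 : ℝ) < 1 / 3 := by norm_num
  have h2 := im_lt_two_mul_im hτ
  have hT := hτ.trans h2
  rw [F2_eq_specialize hτ, F2hat, specialize2, specialize2]
  simp only [F2hatJ_eq hs hT, NH2]
  have A1 := HasDerivAt.hasWirt (hasDerivAt_F2J_fst (z₁ := 1 / 2) hτ h2)
  have A2 := HasDerivAt.hasWirt (hasDerivAt_F2J_snd (z₁ := 1 / 2) hτ h2)
  have A1' := A1.congr_of_eventuallyEq (g := fun w => F2Mer w τ (2 * τ))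
    (Eventually.of_forall fun w => F2Mer_eq_F2J hτ h2)
  have A2' := A2.congr_of_eventuallyEq (g := fun w => F2Mer (1 / 2) w (2 * τ)) (by
    have o1 := Complex.continuous_im.continuousAt.eventually_const_lt hτ
    have o2 := Complex.continuous_im.continuousAt.eventually_lt_const h2
    filter_upwards [o1, o2] with w w1 w2 using F2Mer_eq_F2J w1 w2)
  have B1 := (hasWirt_NH hs h3 three_pos (1 / 3) hT (hasDerivAt_const (1 / 2) τ)
    (hasDerivAt_shiftArg (2 * τ) (1 / 2))).const_mul (1 / 2 * e (3 * τ / 2))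
  have hE : HasDerivAt (fun w : ℂ => 1 / 2 * e (3 * w / 2))
      (1 / 2 * (2 * Real.pi * Complex.I * e (3 * τ / 2) * (3 / 2))) τ := by
    have h4 : HasDerivAt (fun w : ℂ => 3 * w / 2) (3 / 2) τ := by
      simpa using ((hasDerivAt_id τ).const_mul (3 : ℂ)).div_const 2
    exact ((hasDerivAt_e _).comp τ h4).const_mul (1 / 2)
  have B2 := HasWirt.mul_left hE (hasWirt_NH hs h3 three_pos (1 / 3) hT (hasDerivAt_id τ)
    (hasDerivAt_const τ (shiftArg (1 / 2) (2 * τ))))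
  have D1 := (A1'.sub B1).zetaD_eq
  have D2 := (A2'.sub B2).zetaD_eq
  simp only [id] at D1 D2
  rw [D1, D2, A1.zetaD_eq, A2.zetaD_eq, tsum_weights_nhTerm hs h3 three_pos (1 / 3) hT]
  have hpi : (Real.pi : ℂ) ≠ 0 := by exact_mod_cast Real.pi_ne_zero
  push_cast
  field_simp
  ring

lemma tendsto_F2hat {τ : ℂ} (hτ : 0 < τ.im) :
    Tendsto (fun s : ℝ => F2hat s τ) atTop (𝓝 (F2 τ)) := by
  have h3 : (0 : ℝ) < 1 / 3 := by norm_num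
  have hT := hτ.trans (im_lt_two_mul_im hτ)
  have i1 : (2 * τ).im = 2 * τ.im := by simp
  have hL : shiftL (1 / 3) (1 / 3) (2 * τ).im (τ, shiftArg (1 / 2) (2 * τ)) = 0 := by
    have : (1 / 2 : ℂ).im = 0 := by simp
    rw [shiftL_apply, shiftArg_im, i1, this]; field_simp; ring
  have k3 := tendsto_weight_nhTerm_wall h3 three_pos hT hL (by positivity) (norm_weight_le 4 12 6)
  rw [tsum_eq_zero_of_odd] at k3
  · have k4 := (k3.const_mul (e (τ / 2) * e (3 * τ / 2) / 8)).const_sub (F2 τ)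
    simp only [mul_zero, sub_zero] at k4
    refine k4.congr' ?_
    filter_upwards [eventually_ge_atTop 1] with s hs
    rw [F2hat_eq hs hτ]
  · intro b
    have : e (((-1 - b : ℤ) : ℂ) * shiftArg (1 / 2) (2 * τ)
          + ((3 / 2 : ℝ) : ℂ) * ((-1 - b : ℤ) : ℂ) ^ 2 * (2 * τ))
        = e (b * shiftArg (1 / 2) (2 * τ) + ((3 / 2 : ℝ) : ℂ) * (b : ℂ) ^ 2 * (2 * τ)) := by
      refine e_eq_of_sub_eq_int (-1 - 2 * b) ?_
      simp only [shiftArg]; push_cast; ring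
    simp only [this]
    push_cast
    ring

/-! ### Characters with values in the fourth roots of unity -/

lemma stdAddChar_four (j : ℤ) : ZMod.stdAddChar (j : ZMod 4) = e (j / 4) := by
  rw [ZMod.stdAddChar_coe, e]
  congr 1
  push_cast
  ring

lemma transformsWeightTwo_of {N M : ℕ} {f : ℂ → ℂ} (κ : SL(2, ℤ) → ZMod 4)
    (hmul : ∀ γ ∈ CongruenceSubgroup.Gamma0 N, ∀ δ ∈ CongruenceSubgroup.Gamma0 N,
      κ (γ * δ) = κ γ + κ δ)
    (htriv : ∀ γ ∈ CongruenceSubgroup.Gamma M, κ γ = 0)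
    (hlaw : ∀ γ ∈ CongruenceSubgroup.Gamma0 N, ∀ τ : ℍ, f ((γ • τ : ℍ) : ℂ)
      = ZMod.stdAddChar (κ γ) * autj γ τ ^ 2 * f τ) : TransformsWeightTwo N M f := by
  have h1 : κ 1 = 0 := by
    have := hmul 1 (one_mem _) 1 (one_mem _)
    rw [mul_one] at this
    exact left_eq_add.1 this
  let χ : CongruenceSubgroup.Gamma0 N →* ℂ :=
    { toFun := fun γ => ZMod.stdAddChar (κ γ)
      map_one' := by simp [h1]
      map_mul' := fun γ δ => by
        rw [← AddChar.map_add_eq_mul, ← hmul γ γ.2 δ δ.2]; rfl }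
  refine ⟨χ.toHomUnits, fun γ => ?_, fun γ hγ => ?_, fun γ τ => hlaw γ γ.2 τ⟩
  · ext
    rw [Units.val_pow_eq_pow_val, MonoidHom.coe_toHomUnits, Units.val_one]
    change ZMod.stdAddChar (κ γ) ^ 4 = 1
    rw [← AddChar.map_nsmul_eq_pow]
    have : ∀ x : ZMod 4, 4 • x = 0 := by decide
    rw [this, AddChar.map_zero_eq_one]
  · ext
    rw [MonoidHom.coe_toHomUnits, Units.val_one]
    change ZMod.stdAddChar (κ γ) = 1
    rw [htriv γ hγ, AddChar.map_zero_eq_one]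

/-- The Wirtinger derivative at a zero under a change of variables and a holomorphic factor. -/
lemma wirtinger_mul_comp {φ M : ℂ → ℂ} (hφ : DifferentiableAt ℝ φ 0) (h0 : φ 0 = 0)
    (hM : DifferentiableAt ℂ M 0) (j : ℂ) :
    wirtinger (fun t => M t * φ (j * t)) 0 = M 0 * j * wirtinger φ 0 := by
  obtain ⟨p, q, h1⟩ : ∃ p q, HasWirt φ p q 0 := ⟨_, _, hasWirt_of_hasFDerivAt hφ.hasFDerivAt⟩
  have h2 : HasDerivAt (fun t : ℂ => j * t) j 0 := by simpa using (hasDerivAt_id (0 : ℂ)).const_mul j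
  have h3 : HasWirt φ p q (j * 0) := by rwa [mul_zero]
  have h4 := HasWirt.mul_left hM.hasDerivAt (HasWirt.comp (h := fun t => j * t) h3 h2)
  rw [h4.wirtinger_eq, mul_zero, h0, h1.wirtinger_eq]
  ring

lemma wirtinger_congr {f g : ℂ → ℂ} {z : ℂ} (h : f =ᶠ[𝓝 z] g) : wirtinger f z = wirtinger g z := by
  rw [wirtinger, wirtinger, h.fderiv_eq]

/-! ### Modularity of `F̂₂` -/

lemma F2hatJ_smul {a b c d : ℤ} (hdet : a * d - b * c = 1) {τ : ℂ} (hτ : 0 < τ.im) (z₁ : ℂ) {z₂ : ℂ}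
    (h : OffLattice z₂ τ) :
    F2hatJ 1 (z₁ / (c * τ + d)) (z₂ / (c * τ + d)) ((a * τ + b) / (c * τ + d)) =
      (c * τ + d) * (e (c * Q2 z₁ z₂ / (c * τ + d)) * F2hatJ 1 z₁ z₂ τ) := by
  obtain ⟨γ, h1, h2, h3, h4⟩ : ∃ γ : SL(2, ℤ), γ 0 0 = a ∧ γ 0 1 = b ∧ γ 1 0 = c ∧ γ 1 1 = d :=
    ⟨⟨!![a, b; c, d], by rw [Matrix.det_fin_two_of, hdet]⟩, rfl, rfl, rfl, rfl⟩
  have := jacobiLaw γ z₁ z₂ ⟨τ, hτ⟩ h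
  rwa [coe_smul_eq, autj, h1, h2, h3, h4] at this

/-- `F̂₂` along the line through `(1/2, τ)` in the direction `(3, 1)`. -/
noncomputable def lineF2 (τ t : ℂ) : ℂ := F2hatJ 1 (1 / 2 + 3 * t) (τ + 1 * t) (2 * τ)

/-- The law for minus the identity says that F̂₂ is odd in (z₁, z₂). The negative of (1/2, τ)
differs from it by (1, 2τ), a lattice vector with multiplier +1 there, so the value equals its own
negative. -/
lemma lineF2_zero {τ : ℂ} (hτ : 0 < τ.im) : lineF2 τ 0 = 0 := by
  have hT := im_lt_two_mul_im hτ
  have ho := offLattice_of_strip hτ hT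
  have ho' : OffLattice (-τ) (2 * τ) := by
    have := ho.add (-1) 0
    rwa [show τ + ((-1 : ℤ) : ℂ) * (2 * τ) + ((0 : ℤ) : ℂ) = -τ by push_cast; ring] at this
  have h1 := F2hatJ_smul (a := -1) (b := 0) (c := 0) (d := -1) (by norm_num) (hτ.trans hT) (1 / 2) ho
  have h2 := F2hatJ_elliptic (hτ.trans hT) 0 1 1 0 (-1 / 2) ho'
  have e1 : e ((3 * ((1 : ℤ) : ℂ) - ((0 : ℤ) : ℂ)) * -τ - ((1 : ℤ) : ℂ) * (-1 / 2)
      + (3 * ((1 : ℤ) : ℂ) ^ 2 / 2 - ((0 : ℤ) : ℂ) * ((1 : ℤ) : ℂ)) * (2 * τ)) = -1 := by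
    refine (congrArg e ?_).trans e_half; push_cast; ring
  rw [e1] at h2
  push_cast at h1 h2
  rw [show (1 / 2 : ℂ) / (0 * (2 * τ) + -1) = -1 / 2 by ring,
    show τ / (0 * (2 * τ) + -1) = -τ by ring,
    show (-1 * (2 * τ) + 0) / (0 * (2 * τ) + -1) = 2 * τ by ring] at h1
  rw [show (-1 / 2 : ℂ) + 0 * (2 * τ) + 1 = 1 / 2 by ring,
    show -τ + 1 * (2 * τ) + 0 = τ by ring, h1] at h2
  rw [lineF2]
  simp only [zero_mul, zero_div, e_zero, add_zero, mul_zero] at h2 ⊢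
  norm_num at h2
  simpa [eq_neg_iff_add_eq_zero] using h2

lemma differentiableAt_lineF2 {τ : ℂ} (hτ : 0 < τ.im) : DifferentiableAt ℝ (lineF2 τ) 0 := by
  have hT := im_lt_two_mul_im hτ
  have ho := offLattice_of_strip hτ hT
  have h := differentiableAt_F2hatJ le_rfl (hτ.trans hT) (p := (1 / 2 + 3 * 0, τ + 1 * 0))
    (by simpa using ho)
  exact DifferentiableAt.comp (g := fun w : ℂ × ℂ => F2hatJ 1 w.1 w.2 (2 * τ))
    (f := fun t : ℂ => (1 / 2 + 3 * t, τ + 1 * t)) 0 h (by fun_prop)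

lemma F2hat_eq_wirtinger {τ : ℂ} (hτ : 0 < τ.im) :
    F2hat 1 τ = e (τ / 2) / (2 * Real.pi * Complex.I) * wirtinger (lineF2 τ) 0 := by
  have hT := im_lt_two_mul_im hτ
  have ho := offLattice_of_strip hτ hT
  have h := wirtinger_line (differentiableAt_F2hatJ le_rfl (hτ.trans hT) (p := (1 / 2, τ)) ho) 3 1
  simp only at h
  have h' : wirtinger (lineF2 τ) 0 = _ := h
  rw [h', F2hat, specialize2, zetaD, zetaD]
  ring

/-- The matrix (a, 2b; 2k, d) acts on 2τ. Since 4 divides the lower-left entry and a, d are odd, the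
base point (1/2, τ) is preserved modulo the lattice: j/2 = 1/2 + k(2τ) + m and jτ' = τ + n(2τ) + b.
The elliptic law removes these shifts. -/
lemma lineF2_smul {a b k d : ℤ} (hdet : a * d - b * (4 * k) = 1) {n m : ℤ} (ha : a = 2 * n + 1)
    (hd : d = 2 * m + 1) {τ τ' : ℂ} (hτ : 0 < τ.im) (hj : 4 * k * τ + d ≠ 0)
    (hτ' : τ' = (a * τ + b) / (4 * k * τ + d)) {t : ℂ}
    (ht : OffLattice (τ + (4 * k * τ + d) * t) (2 * τ)) :
    lineF2 τ' t = (4 * k * τ + d) * (-1) ^ (n + b) *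
      e (2 * k * (4 * k * τ + d) * Q2 (1 / 2 + 3 * t) (τ' + t)
        + ((3 * n - k) * (τ + (4 * k * τ + d) * t) - n * (1 / 2 + 3 * ((4 * k * τ + d) * t))
          + (3 * n ^ 2 / 2 - k * n) * (2 * τ))) * lineF2 τ ((4 * k * τ + d) * t) := by
  have hT : 0 < (2 * τ).im := hτ.trans (im_lt_two_mul_im hτ)
  set j : ℂ := 4 * k * τ + d with hjdef
  have hj' : ((2 * k : ℤ) : ℂ) * (2 * τ) + d = j := by rw [hjdef]; push_cast; ring
  have ho := ht.add n b
  have h1 := F2hatJ_smul (a := a) (b := 2 * b) (c := 2 * k) (d := d) (by linear_combination hdet)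
    hT (1 / 2 + 3 * (j * t) + k * (2 * τ) + m) ho
  rw [hj'] at h1
  have h2 := F2hatJ_elliptic hT k n m b (1 / 2 + 3 * (j * t)) ht
  have hjτ' : j * τ' = a * τ + b := by rw [hτ', mul_div_cancel₀ _ hj]
  have e1 : (1 / 2 + 3 * (j * t) + k * (2 * τ) + m : ℂ) = j * (1 / 2 + 3 * t) := by
    have : (d : ℂ) = 2 * m + 1 := by exact_mod_cast hd
    rw [hjdef, this]; ring
  have e2 : (τ + j * t + n * (2 * τ) + b : ℂ) = j * (τ' + 1 * t) := by
    have : (a : ℂ) = 2 * n + 1 := by exact_mod_cast ha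
    linear_combination -hjτ' - τ * this
  have e3 : ((a : ℂ) * (2 * τ) + (2 * b : ℤ)) / j = 2 * τ' := by rw [hτ']; push_cast; ring
  rw [h2, e1, e2, e3, mul_div_cancel_left₀ _ hj, mul_div_cancel_left₀ _ hj] at h1
  rw [lineF2, h1, lineF2, e_add (2 * k * j * Q2 (1 / 2 + 3 * t) (τ' + t))]
  have e4 : ((2 * k : ℤ) : ℂ) * Q2 (j * (1 / 2 + 3 * t)) (j * (τ' + 1 * t)) / j
      = 2 * k * j * Q2 (1 / 2 + 3 * t) (τ' + t) := by
    simp only [Q2]; field_simp; push_cast; ring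
  rw [e4]
  ring_nf

lemma F2hat_smul {a b k d : ℤ} (hdet : a * d - b * (4 * k) = 1) {τ τ' : ℂ} (hτ : 0 < τ.im)
    (him : 0 < τ'.im) (hj : 4 * k * τ + d ≠ 0) (hτ' : τ' = (a * τ + b) / (4 * k * τ + d)) :
    e (-(5 / 4) * τ') * F2hat 1 τ' =
      e ((-(a * b) : ℤ) / 4) * (4 * k * τ + d) ^ 2 * (e (-(5 / 4) * τ) * F2hat 1 τ) := by
  have hodd : Odd (a * d) := ⟨2 * (b * k), by linear_combination hdet⟩
  obtain ⟨⟨n, ha⟩, ⟨m, hd⟩⟩ := Int.odd_mul.1 hodd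
  have hT := im_lt_two_mul_im hτ
  set j : ℂ := 4 * k * τ + d with hjdef
  set M : ℂ → ℂ := fun t => j * (-1) ^ (n + b) *
      e (2 * k * j * Q2 (1 / 2 + 3 * t) (τ' + t)
        + ((3 * n - k) * (τ + j * t) - n * (1 / 2 + 3 * (j * t))
          + (3 * n ^ 2 / 2 - k * n) * (2 * τ))) with hM
  have hMd : DifferentiableAt ℂ M 0 := by
    refine DifferentiableAt.const_mul (DifferentiableAt.comp (g := e) (0 : ℂ)
      (differentiable_e _) ?_) _
    simp only [Q2]
    fun_prop
  have hcont : Continuous fun t : ℂ => (τ + j * t).im := by fun_prop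
  have hev : lineF2 τ' =ᶠ[𝓝 0] fun t => M t * lineF2 τ (j * t) := by
    have hc : ContinuousAt (fun t : ℂ => (τ + j * t).im) 0 := hcont.continuousAt
    have o1 := hc.eventually_const_lt (u := 0) (by simpa using hτ)
    have o2 := hc.eventually_lt_const (u := (2 * τ).im) (by simpa using hT)
    filter_upwards [o1, o2] with t t1 t2
    exact lineF2_smul hdet ha hd hτ hj hτ' (offLattice_of_strip t1 t2)
  rw [F2hat_eq_wirtinger hτ, F2hat_eq_wirtinger him, wirtinger_congr hev,
    wirtinger_mul_comp (differentiableAt_lineF2 hτ) (lineF2_zero hτ) hMd]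
  have hjτ' : j * τ' = a * τ + b := by rw [hτ', mul_div_cancel₀ _ hj]
  have hdet' : (a : ℂ) * d - b * (4 * k) = 1 := by exact_mod_cast hdet
  have ha' : (a : ℂ) = 2 * n + 1 := by exact_mod_cast ha
  -- The total prefactor q^{-3/4} is the usual factor at a torsion point: z₂ = (2τ)/2 gives `Q2` 0
  -- (1/2) · 2τ = -3τ/4. It cancels the τ-dependent exponents and leaves the root of unity e(-ab/4).
  have key : e (-(5 / 4) * τ') * e (τ' / 2) * ((-1) ^ (n + b) * e (2 * k * j * Q2 (1 / 2) τ'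
        + ((3 * n - k) * τ - n * (1 / 2) + (3 * n ^ 2 / 2 - k * n) * (2 * τ)))) =
      e ((-(a * b) : ℤ) / 4) * e (-(5 / 4) * τ) * e (τ / 2) := by
    rw [← e_int_half]
    simp only [← e_add]
    refine e_eq_of_sub_eq_int (k * b - b * n) ?_
    have h1 : 4 * k * (j * τ') = a * j - 1 := by
      rw [hjτ', hjdef]; linear_combination (-1 : ℂ) * hdet'
    simp only [Q2]
    push_cast
    linear_combination (-3 / 4 * τ') * h1 + (k - 3 / 4 * a) * hjτ' +
      (τ * (-3 / 4 * (a + 2 * n + 1) + k) - b / 2) * ha'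
  have hM0 : M 0 = j * ((-1) ^ (n + b) * e (2 * k * j * Q2 (1 / 2) τ'
        + ((3 * n - k) * τ - n * (1 / 2) + (3 * n ^ 2 / 2 - k * n) * (2 * τ)))) := by
    simp only [hM, mul_zero, add_zero]
    ring
  rw [hM0]
  linear_combination (j ^ 2 * wirtinger (lineF2 τ) 0 / (2 * Real.pi * Complex.I)) * key

lemma transformsWeightTwo_F2hat :
    TransformsWeightTwo 4 4 (fun τ => e (-(5 / 4) * τ) * F2hat 1 τ) := by
  have h4 : ∀ γ ∈ CongruenceSubgroup.Gamma0 4, ((γ 1 0 : ℤ) : ZMod 4) = 0 := fun γ hγ =>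
    CongruenceSubgroup.Gamma0_mem.1 hγ
  refine transformsWeightTwo_of (fun γ => -((γ 0 0 : ZMod 4) * (γ 0 1 : ZMod 4))) ?_ ?_ ?_
  · intro γ hγ δ hδ
    have d1 := congrArg (fun n : ℤ => (n : ZMod 4)) (det_eq_one γ)
    have d2 := congrArg (fun n : ℤ => (n : ZMod 4)) (det_eq_one δ)
    have hsq : ∀ x y : ZMod 4, x * y = 1 → x ^ 2 = 1 := by decide
    simp only [Int.cast_sub, Int.cast_mul, h4 γ hγ, h4 δ hδ, mul_zero, sub_zero, Int.cast_one] at d1 d2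
    have k1 := hsq _ _ d1
    simp only [Matrix.SpecialLinearGroup.coe_mul, Matrix.mul_apply, Fin.sum_univ_two, Int.cast_add,
      Int.cast_mul, h4 δ hδ, mul_zero, add_zero]
    -- With lower-left entries zero modulo 4, only a² = 1 for γ and ad = 1 for δ are needed for ab
    -- to be additive.
    linear_combination (-((δ 0 0 : ZMod 4) * (δ 0 1 : ZMod 4))) * k1
      - ((γ 0 0 : ZMod 4) * (γ 0 1 : ZMod 4)) * d2
  · intro γ hγ
    rw [CongruenceSubgroup.Gamma_mem] at hγ
    simp only [hγ.2.1, mul_zero, neg_zero]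
  · intro γ hγ τ
    obtain ⟨k, hk⟩ := (ZMod.intCast_zmod_eq_zero_iff_dvd _ 4).1 (h4 γ hγ)
    have hdet := det_eq_one γ
    have hj := autj_ne_zero γ τ
    have hτ' := coe_smul_eq γ τ
    have hc : (γ 1 0 : ℂ) = 4 * k := by rw [hk]; push_cast; ring
    rw [autj, hc] at hj
    rw [hc] at hτ'
    rw [hk] at hdet
    rw [F2hat_smul hdet τ.im_pos (γ • τ).im_pos hj hτ', ← stdAddChar_four, autj, hc]
    push_cast
    rfl

/-! ### The character of order four of `SL₂(ℤ)` -/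

/-- The character `SL₂(ℤ) → ℤ/4` with `T ↦ 1`, as a polynomial in the entries. -/
def psiPoly (a b c d : ZMod 4) : ZMod 4 :=
  (1 - c ^ 2) * (b * d + 3 * (c - 1) * d + c + 3) + c * (a + d - 3)

lemma psiPoly_T : ∀ a b c d : ZMod 4, a * d - b * c = 1 →
    psiPoly a (a + b) c (c + d) = psiPoly a b c d + 1 := by
  unfold psiPoly; decide

lemma psiPoly_S : ∀ a b c d : ZMod 4, a * d - b * c = 1 →
    psiPoly b (-a) d (-c) = psiPoly a b c d + 1 := by
  unfold psiPoly; decide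

/-- The character `SL₂(ℤ) → ℤ/4` with `T ↦ 1`. -/
def psi (γ : SL(2, ℤ)) : ZMod 4 := psiPoly (γ 0 0) (γ 0 1) (γ 1 0) (γ 1 1)

lemma det_eq_one_zmod (N : ℕ) (γ : SL(2, ℤ)) :
    (γ 0 0 : ZMod N) * γ 1 1 - γ 0 1 * γ 1 0 = 1 := by
  exact_mod_cast congrArg (fun n : ℤ => (n : ZMod N)) (det_eq_one γ)

lemma psi_one : psi 1 = 0 := by simp [psi]; decide

/-- Right multiplication by S or by T raises the polynomial by 1, a finite check over ℤ/4; the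
generators give the rest by induction. The value 1 at S is consistent with S² = (ST)³, which forces
ψ(S) = -3ψ(T). -/
lemma psi_mul (γ δ : SL(2, ℤ)) : psi (γ * δ) = psi γ + psi δ := by
  have hmem : δ ∈ Subgroup.closure {ModularGroup.S, ModularGroup.T} := by
    simp [SpecialLinearGroup.SL2Z_generators]
  induction hmem using Subgroup.closure_induction generalizing γ with
  | mem x hx =>
    rcases hx with rfl | rfl
    · have h1 : psi ModularGroup.S = 1 := by simp [psi, ModularGroup.S]; decide
      rw [h1, psi, psi, ← psiPoly_S _ _ _ _ (det_eq_one_zmod 4 γ)]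
      simp [Matrix.SpecialLinearGroup.coe_mul, Matrix.mul_apply, Fin.sum_univ_two,
        ModularGroup.coe_S]
    · have h1 : psi ModularGroup.T = 1 := by simp [psi, ModularGroup.T]; decide
      rw [h1, psi, psi, ← psiPoly_T _ _ _ _ (det_eq_one_zmod 4 γ)]
      simp [Matrix.SpecialLinearGroup.coe_mul, Matrix.mul_apply, Fin.sum_univ_two,
        ModularGroup.coe_T]
  | one => rw [psi_one, mul_one, add_zero]
  | mul x y _ _ hx hy => rw [← mul_assoc, hy, hx, hy x, add_assoc]
  | inv x _ hx =>
    have h1 := hx (γ * x⁻¹)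
    have h2 := hx x⁻¹
    rw [inv_mul_cancel_right] at h1
    rw [inv_mul_cancel, psi_one] at h2
    rw [h1, add_assoc, add_comm (psi x), ← h2, add_zero]

/-- The quadratic character modulo `3`, with values in `ℤ/4`. -/
def sgnThree (x : ZMod 3) : ZMod 4 := if x = 2 then 2 else 0

lemma sgnThree_mul : ∀ x y x' y' : ZMod 3, x * x' = 1 → y * y' = 1 →
    sgnThree (x * y) = sgnThree x + sgnThree y := by
  unfold sgnThree; decide

/-- The exponent of the multiplier of `F̂₃`. -/
def kappaThree (γ : SL(2, ℤ)) : ZMod 4 := -psi γ + sgnThree (γ 1 1)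

lemma kappaThree_mul {γ δ : SL(2, ℤ)} (hγ : γ ∈ CongruenceSubgroup.Gamma0 3)
    (hδ : δ ∈ CongruenceSubgroup.Gamma0 3) :
    kappaThree (γ * δ) = kappaThree γ + kappaThree δ := by
  have h1 : ((γ 1 0 : ℤ) : ZMod 3) = 0 := CongruenceSubgroup.Gamma0_mem.1 hγ
  have h2 : ((δ 1 0 : ℤ) : ZMod 3) = 0 := CongruenceSubgroup.Gamma0_mem.1 hδ
  have d1 := det_eq_one_zmod 3 γ
  have d2 := det_eq_one_zmod 3 δ
  rw [h1, mul_zero, sub_zero, mul_comm] at d1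
  rw [h2, mul_zero, sub_zero, mul_comm] at d2
  have h3 : (((γ * δ) 1 1 : ℤ) : ZMod 3) = (γ 1 1 : ZMod 3) * δ 1 1 := by
    simp [Matrix.mul_apply, Fin.sum_univ_two, h1]
  rw [kappaThree, h3, psi_mul, sgnThree_mul _ _ _ _ d1 d2, kappaThree, kappaThree]
  ring

lemma kappaThree_eq_zero {γ : SL(2, ℤ)} (hγ : γ ∈ CongruenceSubgroup.Gamma 12) :
    kappaThree γ = 0 := by
  rw [CongruenceSubgroup.Gamma_mem] at hγ
  obtain ⟨h1, h2, h3, h4⟩ := hγ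
  have c4 : ∀ x y : ℤ, (x : ZMod 12) = y → (x : ZMod 4) = y := fun x y h =>
    (ZMod.intCast_eq_intCast_iff_dvd_sub ..).2
      (Dvd.dvd.trans (by norm_num) ((ZMod.intCast_eq_intCast_iff_dvd_sub ..).1 h))
  have c3 : ∀ x y : ℤ, (x : ZMod 12) = y → (x : ZMod 3) = y := fun x y h =>
    (ZMod.intCast_eq_intCast_iff_dvd_sub ..).2
      (Dvd.dvd.trans (by norm_num) ((ZMod.intCast_eq_intCast_iff_dvd_sub ..).1 h))
  rw [kappaThree, psi, c4 (γ 0 0) 1 (by exact_mod_cast h1), c4 (γ 0 1) 0 (by exact_mod_cast h2),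
    c4 (γ 1 0) 0 (by exact_mod_cast h3), c4 (γ 1 1) 1 (by exact_mod_cast h4),
    c3 (γ 1 1) 1 (by exact_mod_cast h4)]
  simp only [Int.cast_one, Int.cast_zero]
  decide

/-! ### Generators of `Γ₀(3)` -/

/-- The lower triangular generator of `Γ₀(3)`. -/
def lowerThree : SL(2, ℤ) := ModularGroup.S * ModularGroup.T ^ 3 * ModularGroup.S⁻¹

lemma coe_lowerThree_zpow (m : ℤ) :
    ((lowerThree ^ m : SL(2, ℤ)) : Matrix (Fin 2) (Fin 2) ℤ) = !![1, 0; -3 * m, 1] := by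
  have h : lowerThree ^ m = ModularGroup.S * ModularGroup.T ^ (3 * m) * ModularGroup.S⁻¹ := by
    rw [lowerThree, conj_zpow, zpow_mul]; norm_cast
  rw [h, Matrix.SpecialLinearGroup.coe_mul, Matrix.SpecialLinearGroup.coe_mul,
    ModularGroup.coe_T_zpow]
  ext i j
  fin_cases i <;> fin_cases j <;>
    simp [ModularGroup.coe_S, Matrix.mul_apply, Fin.sum_univ_two,
      Matrix.SpecialLinearGroup.coe_inv, Matrix.adjugate_fin_two]

lemma exists_two_mul_abs_add_mul_le (x : ℤ) {y : ℤ} (hy : y ≠ 0) :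
    ∃ n : ℤ, 2 * |x + n * y| ≤ |y| := by
  refine ⟨-round ((x : ℚ) / y), ?_⟩
  have h := abs_sub_round ((x : ℚ) / y)
  have hy' : (0 : ℚ) < |(y : ℚ)| := by positivity
  have h2 : |(x : ℚ) / y - round ((x : ℚ) / y)| * |(y : ℚ)| ≤ 1 / 2 * |(y : ℚ)| := by gcongr
  rw [← abs_mul, sub_mul, div_mul_cancel₀ _ (by exact_mod_cast hy)] at h2
  have h3 : 2 * |(x : ℚ) + -(round ((x : ℚ) / y) : ℤ) * (y : ℚ)| ≤ |(y : ℚ)| := by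
    rw [neg_mul, ← sub_eq_add_neg]; linarith
  exact_mod_cast h3

/-- A Euclidean descent on the bottom row: T reduces d modulo c, and `lowerThree` reduces c modulo
3d. With remainders nearest to zero, the new |c| is at most 3|d|/2 ≤ 3|c|/4. -/
lemma mem_of_mem_Gamma0_three {H : Subgroup SL(2, ℤ)} (hT : ModularGroup.T ∈ H)
    (hV : lowerThree ∈ H) (hneg : -1 ∈ H) (γ : SL(2, ℤ))
    (hγ : γ ∈ CongruenceSubgroup.Gamma0 3) : γ ∈ H := by
  have h3 : (3 : ℤ) ∣ γ 1 0 :=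
    (ZMod.intCast_zmod_eq_zero_iff_dvd _ 3).1 (CongruenceSubgroup.Gamma0_mem.1 hγ)
  clear hγ
  induction hn : (γ 1 0).natAbs using Nat.strong_induction_on generalizing γ with
  | _ N ih =>
  have hdet := det_eq_one γ
  by_cases hc : γ 1 0 = 0
  · rw [hc, mul_zero, sub_zero] at hdet
    have key : ∀ δ : SL(2, ℤ), δ 0 0 = 1 → δ 1 0 = 0 → δ 1 1 = 1 → δ ∈ H := by
      intro δ h00 h10 h11
      have : δ = ModularGroup.T ^ δ 0 1 := by
        ext i j
        rw [ModularGroup.coe_T_zpow]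
        fin_cases i <;> fin_cases j <;> simp [h00, h10, h11]
      rw [this]
      exact H.zpow_mem hT _
    rcases Int.eq_one_or_neg_one_of_mul_eq_one' hdet with ⟨h1, h2⟩ | ⟨h1, h2⟩
    · exact key γ h1 hc h2
    · have := H.mul_mem hneg (key (-γ) (by simp [h1]) (by simp [hc]) (by simp [h2]))
      simpa using this
  · obtain ⟨n, hn1⟩ := exists_two_mul_abs_add_mul_le (γ 1 1) hc
    set d := γ 1 1 + n * γ 1 0 with hd
    -- If d vanished, the determinant would be a multiple of c, hence of 3.
    have hd0 : d ≠ 0 := by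
      intro h0
      obtain ⟨k, hk⟩ := h3
      have : (3 : ℤ) ∣ 1 := ⟨-(γ 0 0 * n * k + γ 0 1 * k), by
        rw [hk] at hd hdet
        linear_combination -hdet + γ 0 0 * h0 - γ 0 0 * hd⟩
      norm_num at this
    obtain ⟨m, hm1⟩ := exists_two_mul_abs_add_mul_le (γ 1 0) (y := 3 * d) (by omega)
    have hcoe : (γ * ModularGroup.T ^ n * lowerThree ^ (-m)) 1 0 = γ 1 0 + m * (3 * d) := by
      rw [Matrix.SpecialLinearGroup.coe_mul, Matrix.SpecialLinearGroup.coe_mul,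
        ModularGroup.coe_T_zpow, coe_lowerThree_zpow]
      simp [Matrix.mul_apply, Fin.sum_univ_two]
      rw [hd]; ring
    have hmem := ih _ (by
      rw [← hn, hcoe]
      rw [abs_mul] at hm1
      have : |(3 : ℤ)| = 3 := rfl
      have h5 := abs_pos.2 hc
      zify
      rw [this] at hm1
      linarith) (γ * ModularGroup.T ^ n * lowerThree ^ (-m))
      (by rw [hcoe]; exact dvd_add h3 ⟨m * d, by ring⟩) rfl
    have h6 := H.mul_mem (H.mul_mem hmem (H.zpow_mem hV m)) (H.zpow_mem hT (-n))
    simpa [mul_assoc, ← zpow_add] using h6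

/-! ### Modularity of `F̂₃` -/

lemma F3hatJ_add_int (s : ℝ) {τ : ℂ} (hτ : 0 < τ.im) (m₁ m₂ : ℤ) (z₁ z₂ : ℂ) :
    F3hatJ s (z₁ + m₁) (z₂ + m₂) τ = F3hatJ s z₁ z₂ τ := by
  simpa [e_zero] using F3hatJ_elliptic s hτ 0 0 m₁ m₂ z₁ z₂

lemma F3hatJ_add_three {τ : ℂ} (hτ : 0 < τ.im) (z₁ z₂ : ℂ) :
    F3hatJ 1 z₁ z₂ (τ + 3) = F3hatJ 1 z₁ (z₂ + 1 / 2) τ := by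
  have h := F3hatJ_add_int 1 hτ 0 1 z₁ (z₂ + 1 / 2)
  rw [show τ + 3 = τ + 1 + 1 + 1 by ring, F3hatJ_add_one, F3hatJ_add_one, F3hatJ_add_one, ← h]
  congr 1 <;> push_cast <;> ring

/-- The inversion of F̂₃ is vector-valued, but τ ↦ τ + 3 multiplies the three components by a common
factor after z₂ moves by 1/2, because k(k+1)/2 is an integer. The sum therefore recombines into a
single inverted F̂₃, which explains the level 3. -/
lemma F3hatJ_neg_inv_add_three {τ : ℂ} (hτ : 0 < τ.im) (z₁ z₂ : ℂ) :
    F3hatJ 1 (z₁ / (τ + 3)) (z₂ / (τ + 3)) (-1 / (τ + 3)) =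
      (τ + 3) / τ * e (Q3 z₁ z₂ / (τ + 3) - Q3 z₁ (z₂ + 1 / 2) / τ) *
        F3hatJ 1 (z₁ / τ) ((z₂ + 1 / 2) / τ) (-1 / τ) := by
  have h0 : τ ≠ 0 := by rintro rfl; simp at hτ
  have hτ3 : 0 < (τ + 3).im := by simpa using hτ
  have h03 : τ + 3 ≠ 0 := by intro h; rw [h] at hτ3; simp at hτ3
  suffices hs : ∑ k : Fin 3, e (Q3 (z₁ + k * (τ + 3)) z₂ / (τ + 3)) *
      F3hatJ 1 (z₁ + k * (τ + 3)) z₂ (τ + 3) = e (Q3 z₁ z₂ / (τ + 3) - Q3 z₁ (z₂ + 1 / 2) / τ) *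
      ∑ k : Fin 3, e (Q3 (z₁ + k * τ) (z₂ + 1 / 2) / τ) *
        F3hatJ 1 (z₁ + k * τ) (z₂ + 1 / 2) τ by
    rw [F3hatJ_neg_inv hτ3, F3hatJ_neg_inv hτ, hs]
    field_simp
  rw [Finset.mul_sum]
  refine Finset.sum_congr rfl fun k _ => ?_
  have e1 : F3hatJ 1 (z₁ + k * (τ + 3)) z₂ (τ + 3) = F3hatJ 1 (z₁ + k * τ) (z₂ + 1 / 2) τ := by
    rw [F3hatJ_add_three hτ, ← F3hatJ_add_int 1 hτ (3 * k) 0 (z₁ + k * τ) (z₂ + 1 / 2)]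
    congr 1 <;> push_cast <;> ring
  obtain ⟨m, hm⟩ := even_mul_add_one_div_two (k : ℕ)
  have e2 : e (Q3 (z₁ + k * (τ + 3)) z₂ / (τ + 3)) = e (Q3 z₁ z₂ / (τ + 3)
      - Q3 z₁ (z₂ + 1 / 2) / τ) * e (Q3 (z₁ + k * τ) (z₂ + 1 / 2) / τ) := by
    rw [← e_add]
    refine e_eq_of_sub_eq_int (-m) ?_
    simp only [Q3]
    push_cast at hm ⊢
    field_simp
    linear_combination (-12 * τ * (τ + 3)) * hm
  rw [e1, e2, mul_assoc]

/-- This is `F3hatJ_neg_inv_add_three` at -1/τ, which conjugates T³ by the inversion into the lower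
triangular generator. -/
lemma F3hatJ_lower {τ : ℂ} (hτ : 0 < τ.im) (w₁ w₂ : ℂ) :
    F3hatJ 1 (w₁ / (1 - 3 * τ)) (w₂ / (1 - 3 * τ)) (τ / (1 - 3 * τ)) =
      (1 - 3 * τ) * e (-Q3 w₁ w₂ / (τ * (1 - 3 * τ)) + Q3 w₁ (w₂ - τ / 2) / τ) *
        F3hatJ 1 w₁ (w₂ - τ / 2) τ := by
  have h0 : τ ≠ 0 := by rintro rfl; simp at hτ
  have hj : 1 - 3 * τ ≠ 0 := by
    intro h
    have := congrArg Complex.im h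
    simp at this
    exact hτ.ne' this
  have h := F3hatJ_neg_inv_add_three (neg_inv_im_pos hτ) (-(w₁ / τ)) (-(w₂ / τ))
  have e0 : -1 / τ + 3 = -((1 - 3 * τ) / τ) := by field_simp; ring
  have e1 : ∀ w : ℂ, -(w / τ) / -((1 - 3 * τ) / τ) = w / (1 - 3 * τ) := fun w => by
    rw [neg_div_neg_eq, div_div_div_cancel_right₀ h0]
  have e2 : -1 / -((1 - 3 * τ) / τ) = τ / (1 - 3 * τ) := by rw [neg_div_neg_eq, one_div_div]
  have e3 : -(w₁ / τ) / (-1 / τ) = w₁ := by field_simp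
  have e4 : (-(w₂ / τ) + 1 / 2) / (-1 / τ) = w₂ - τ / 2 := by field_simp; ring
  have e5 : -1 / (-1 / τ) = τ := by field_simp
  have e6 : -((1 - 3 * τ) / τ) / (-1 / τ) = 1 - 3 * τ := by field_simp
  rw [e0, e1, e1, e2, e3, e4, e5, e6] at h
  rw [h]
  congr 3
  simp only [Q3]
  field_simp
  ring

/-- `F̂₃` along the line through `(3τ, 3τ/2 + 1/2)` in the direction `(2, 1)`. -/
noncomputable def lineF3 (τ t : ℂ) : ℂ := F3hatJ 1 (3 * τ + 2 * t) (3 * τ / 2 + 1 / 2 + 1 * t) τ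

/-- F̂₃ is odd, and the base point differs from its negative by (6τ, 3τ + 1), a lattice vector with
multiplier 1 there. In particular the summand +1 of the operator contributes nothing. -/
lemma lineF3_zero {τ : ℂ} (hτ : 0 < τ.im) : lineF3 τ 0 = 0 := by
  have h1 := F3hatJ_elliptic 1 hτ 1 0 0 1 (-(3 * τ)) (-(3 * τ / 2 + 1 / 2))
  have e1 : e (-(((1 : ℤ) : ℂ) * -(3 * τ) + ((0 : ℤ) : ℂ) * -(3 * τ / 2 + 1 / 2))
      - (3 * ((1 : ℤ) : ℂ) ^ 2 + 3 * ((1 : ℤ) : ℂ) * ((0 : ℤ) : ℂ) + ((0 : ℤ) : ℂ) ^ 2 / 2) * τ)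
      = 1 := by
    refine (congrArg e ?_).trans e_zero
    push_cast; ring
  rw [e1, F3hatJ_neg, one_mul] at h1
  push_cast at h1
  rw [show -(3 * τ) + (6 * 1 + 3 * 0) * τ + 0 = 3 * τ by ring,
    show -(3 * τ / 2 + 1 / 2) + (3 * 1 + 0) * τ + 1 = 3 * τ / 2 + 1 / 2 by ring] at h1
  rw [lineF3, mul_zero, mul_zero, add_zero, add_zero]
  linear_combination h1 / 2

lemma differentiableAt_lineF3 {τ : ℂ} (hτ : 0 < τ.im) : DifferentiableAt ℝ (lineF3 τ) 0 :=
  DifferentiableAt.comp (g := fun w : ℂ × ℂ => F3hatJ 1 w.1 w.2 τ)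
    (f := fun t : ℂ => (3 * τ + 2 * t, 3 * τ / 2 + 1 / 2 + 1 * t)) 0
    (differentiableAt_F3hatJ le_rfl hτ _) (by fun_prop)

lemma F3hat_eq_wirtinger {τ : ℂ} (hτ : 0 < τ.im) :
    F3hat 1 τ = 3 * e τ / 4 / (2 * Real.pi * Complex.I) * wirtinger (lineF3 τ) 0 := by
  have h := wirtinger_line (differentiableAt_F3hatJ le_rfl hτ
    (3 * τ, 3 * τ / 2 + 1 / 2)) 2 1
  simp only at h
  have h' : wirtinger (lineF3 τ) 0 = _ := h
  have h0 := lineF3_zero hτ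
  rw [lineF3, mul_zero, mul_zero, add_zero, add_zero] at h0
  rw [h', F3hat, specialize3, zetaD, zetaD, h0]
  ring

/-- The normalized completion of `F₃`. -/
noncomputable def modF3 (τ : ℂ) : ℂ := e (-(1 / 4) * τ) * F3hat 1 τ

lemma modF3_add_one {τ : ℂ} (hτ : 0 < τ.im) : modF3 (τ + 1) = e (3 / 4) * modF3 τ := by
  have h : lineF3 (τ + 1) = lineF3 τ := by
    funext t
    rw [lineF3, lineF3, F3hatJ_add_one,
      ← F3hatJ_add_int 1 hτ 3 2 (3 * τ + 2 * t) (3 * τ / 2 + 1 / 2 + 1 * t)]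
    congr 1 <;> push_cast <;> ring
  rw [modF3, modF3, F3hat_eq_wirtinger hτ, F3hat_eq_wirtinger (by simpa using hτ), h]
  have h1 : e (-(1 / 4) * (τ + 1)) * e (τ + 1) = e (3 / 4) * (e (-(1 / 4) * τ) * e τ) := by
    rw [← e_add, ← e_add, ← e_add]; congr 1; ring
  linear_combination (3 / 4 / (2 * Real.pi * Complex.I) * wirtinger (lineF3 τ) 0) * h1

lemma lineF3_lower {τ : ℂ} (hτ : 0 < τ.im) (t : ℂ) :
    lineF3 (τ / (1 - 3 * τ)) t = (1 - 3 * τ) *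
      e (-Q3 (3 * τ + 2 * ((1 - 3 * τ) * t)) (1 / 2 + (1 - 3 * τ) * t) / (τ * (1 - 3 * τ))
        + Q3 (3 * τ + 2 * ((1 - 3 * τ) * t)) (1 / 2 + (1 - 3 * τ) * t - τ / 2) / τ + 4 * τ) *
      lineF3 τ ((1 - 3 * τ) * t) := by
  have hj : 1 - 3 * τ ≠ 0 := by
    intro h
    have := congrArg Complex.im h
    simp at this
    exact hτ.ne' this
  set j := 1 - 3 * τ with hjdef
  have h := F3hatJ_lower hτ (3 * τ + 2 * (j * t)) (1 / 2 + j * t)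
  rw [← hjdef] at h
  have e1 : (3 * τ + 2 * (j * t)) / j = 3 * (τ / j) + 2 * t := by field_simp
  have e2 : (1 / 2 + j * t) / j = 3 * (τ / j) / 2 + 1 / 2 + 1 * t := by
    field_simp; rw [hjdef]; ring
  -- The vector (2, -4) moves z₂ alone, by 2τ, which carries 1/2 - τ/2 back to the base point 3τ/2 +
  -- 1/2.
  have h2 := F3hatJ_elliptic 1 hτ 2 (-4) 0 0 (3 * τ + 2 * (j * t)) (1 / 2 + j * t - τ / 2)
  have e3 : e (-(((2 : ℤ) : ℂ) * (3 * τ + 2 * (j * t)) + ((-4 : ℤ) : ℂ) * (1 / 2 + j * t - τ / 2))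
      - (3 * ((2 : ℤ) : ℂ) ^ 2 + 3 * ((2 : ℤ) : ℂ) * ((-4 : ℤ) : ℂ) + ((-4 : ℤ) : ℂ) ^ 2 / 2) * τ)
      = e (-(4 * τ)) := e_eq_of_sub_eq_int 2 (by push_cast; ring)
  rw [e3] at h2
  have h3 : F3hatJ 1 (3 * τ + 2 * (j * t)) (1 / 2 + j * t - τ / 2) τ = e (4 * τ) * lineF3 τ (j * t) := by
    have e4 : lineF3 τ (j * t) = e (-(4 * τ)) *
        F3hatJ 1 (3 * τ + 2 * (j * t)) (1 / 2 + j * t - τ / 2) τ := by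
      rw [← h2, lineF3]
      congr 1 <;> push_cast <;> ring
    rw [e4, ← mul_assoc (e (4 * τ)), ← e_add, add_neg_cancel, e_zero, one_mul]
  rw [e1, e2, h3] at h
  rw [lineF3, h, e_add _ (4 * τ)]
  ring

lemma modF3_lower {τ : ℂ} (hτ : 0 < τ.im) (hτ' : 0 < (τ / (1 - 3 * τ)).im) :
    modF3 (τ / (1 - 3 * τ)) = e (1 / 4) * (1 - 3 * τ) ^ 2 * modF3 τ := by
  have h0 : τ ≠ 0 := by rintro rfl; simp at hτ
  have hj : 1 - 3 * τ ≠ 0 := by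
    intro h
    rw [h] at hτ'
    simp at hτ'
  set M : ℂ → ℂ := fun t => (1 - 3 * τ) *
      e (-Q3 (3 * τ + 2 * ((1 - 3 * τ) * t)) (1 / 2 + (1 - 3 * τ) * t) / (τ * (1 - 3 * τ))
        + Q3 (3 * τ + 2 * ((1 - 3 * τ) * t)) (1 / 2 + (1 - 3 * τ) * t - τ / 2) / τ + 4 * τ) with hM
  have hMd : DifferentiableAt ℂ M 0 := by
    refine DifferentiableAt.const_mul (DifferentiableAt.comp (g := e) (0 : ℂ)
      (differentiable_e _) ?_) _
    simp only [Q3]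
    fun_prop
  have h : lineF3 (τ / (1 - 3 * τ)) = fun t => M t * lineF3 τ ((1 - 3 * τ) * t) :=
    funext fun t => lineF3_lower hτ t
  rw [modF3, modF3, F3hat_eq_wirtinger hτ, F3hat_eq_wirtinger hτ', h,
    wirtinger_mul_comp (differentiableAt_lineF3 hτ) (lineF3_zero hτ) hMd]
  -- The total prefactor q^{3/4} is the torsion-point factor `Q3` 3 (3/2) = 3/4.
  have key : e (-(1 / 4) * (τ / (1 - 3 * τ))) * e (τ / (1 - 3 * τ)) *
      e (-Q3 (3 * τ) (1 / 2) / (τ * (1 - 3 * τ)) + Q3 (3 * τ) (1 / 2 - τ / 2) / τ + 4 * τ)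
      = e (1 / 4) * (e (-(1 / 4) * τ) * e τ) := by
    simp only [← e_add]
    refine e_eq_of_sub_eq_int 1 ?_
    have hj' : 1 - τ * 3 ≠ 0 := by rwa [mul_comm]
    simp only [Q3]
    field_simp
    ring
  have hM0 : M 0 = (1 - 3 * τ) * e (-Q3 (3 * τ) (1 / 2) / (τ * (1 - 3 * τ))
      + Q3 (3 * τ) (1 / 2 - τ / 2) / τ + 4 * τ) := by
    simp only [hM, mul_zero, add_zero]
  rw [hM0]
  linear_combination (3 / 4 / (2 * Real.pi * Complex.I) * (1 - 3 * τ) ^ 2 *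
    wirtinger (lineF3 τ) 0) * key

/-- The matrices of `Γ₀(3)` under which `modF3` transforms with the multiplier `kappaThree`. -/
def modF3Subgroup : Subgroup SL(2, ℤ) where
  carrier := {γ | γ ∈ CongruenceSubgroup.Gamma0 3 ∧ ∀ τ : ℍ, modF3 ((γ • τ : ℍ) : ℂ)
    = ZMod.stdAddChar (kappaThree γ) * autj γ τ ^ 2 * modF3 τ}
  one_mem' := by
    refine ⟨one_mem _, fun τ => ?_⟩
    have h : kappaThree 1 = 0 := by
      have := kappaThree_mul (one_mem (CongruenceSubgroup.Gamma0 3)) (one_mem _)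
      rw [mul_one] at this
      exact left_eq_add.1 this
    simp [h, autj]
  mul_mem' := by
    rintro γ δ ⟨hγ, h1⟩ ⟨hδ, h2⟩
    refine ⟨mul_mem hγ hδ, fun τ => ?_⟩
    rw [mul_smul, h1, h2, kappaThree_mul hγ hδ, AddChar.map_add_eq_mul, autj_mul]
    ring
  inv_mem' := by
    rintro γ ⟨hγ, h1⟩
    refine ⟨inv_mem hγ, fun τ => ?_⟩
    have h2 := h1 (γ⁻¹ • τ)
    rw [smul_inv_smul] at h2
    have h3 := autj_mul γ γ⁻¹ τ
    have h4 := kappaThree_mul hγ (inv_mem hγ)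
    have h5 := kappaThree_mul (one_mem (CongruenceSubgroup.Gamma0 3)) (one_mem _)
    rw [mul_one] at h5
    rw [mul_inv_cancel, left_eq_add.1 h5] at h4
    rw [mul_inv_cancel, show autj 1 τ = 1 by simp [autj]] at h3
    have h6 : (ZMod.stdAddChar (kappaThree γ⁻¹) : ℂ) * ZMod.stdAddChar (kappaThree γ) = 1 := by
      rw [← AddChar.map_add_eq_mul, add_comm, ← h4, AddChar.map_zero_eq_one]
    rw [h2]
    set x : ℂ := ZMod.stdAddChar (kappaThree γ)
    set y : ℂ := ZMod.stdAddChar (kappaThree γ⁻¹)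
    set u := autj γ ((γ⁻¹ • τ : ℍ) : ℂ)
    set v := autj γ⁻¹ τ
    calc _ = 1 * 1 ^ 2 * modF3 ((γ⁻¹ • τ : ℍ) : ℂ) := by ring
      _ = (y * x) * (u * v) ^ 2 * modF3 ((γ⁻¹ • τ : ℍ) : ℂ) := by rw [h6, ← h3]
      _ = _ := by ring

lemma transformsWeightTwo_F3hat :
    TransformsWeightTwo 3 12 (fun τ => e (-(1 / 4) * τ) * F3hat 1 τ) := by
  have hT : ModularGroup.T ∈ modF3Subgroup := by
    refine ⟨by simp [CongruenceSubgroup.Gamma0_mem, ModularGroup.coe_T], fun τ => ?_⟩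
    have h1 : ((ModularGroup.T • τ : ℍ) : ℂ) = τ + 1 := by
      rw [coe_smul_eq]; simp [ModularGroup.T]
    have h2 : autj ModularGroup.T τ = 1 := by simp [autj, ModularGroup.T]
    have h3 : kappaThree ModularGroup.T = ((3 : ℤ) : ZMod 4) := by
      simp [kappaThree, psi, ModularGroup.coe_T]; decide
    rw [h1, h2, h3, stdAddChar_four, modF3_add_one τ.im_pos]
    push_cast
    ring
  have hV : lowerThree ∈ modF3Subgroup := by
    have hc := coe_lowerThree_zpow 1
    rw [zpow_one] at hc
    have h00 : lowerThree 0 0 = 1 := by rw [hc]; rfl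
    have h01 : lowerThree 0 1 = 0 := by rw [hc]; rfl
    have h10 : lowerThree 1 0 = -3 := by rw [hc]; rfl
    have h11 : lowerThree 1 1 = 1 := by rw [hc]; rfl
    refine ⟨by rw [CongruenceSubgroup.Gamma0_mem, h10]; decide, fun τ => ?_⟩
    have h1 : ((lowerThree • τ : ℍ) : ℂ) = τ / (1 - 3 * τ) := by
      rw [coe_smul_eq, h00, h01, h10, h11]; push_cast; ring
    have h2 : autj lowerThree τ = 1 - 3 * τ := by rw [autj, h10, h11]; push_cast; ring
    have h3 : kappaThree lowerThree = ((1 : ℤ) : ZMod 4) := by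
      rw [kappaThree, psi, h00, h01, h10, h11]; decide
    have him := (lowerThree • τ).im_pos
    rw [← UpperHalfPlane.coe_im, h1] at him
    rw [h1, h2, h3, stdAddChar_four, modF3_lower τ.im_pos him]
    push_cast
    ring
  have hneg : -1 ∈ modF3Subgroup := by
    refine ⟨by simp [CongruenceSubgroup.Gamma0_mem], fun τ => ?_⟩
    -- Even weight forces the multiplier at -1 to be trivial. Here ψ(-1) = 2, and the quadratic
    -- character modulo 3 is present to cancel it.
    have h3 : kappaThree (-1) = 0 := by
      simp [kappaThree, psi]; decide
    rw [h3, AddChar.map_zero_eq_one, ModularGroup.SL_neg_smul, one_smul]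
    simp [autj]
  exact transformsWeightTwo_of kappaThree (fun γ hγ δ hδ => kappaThree_mul hγ hδ)
    (fun γ hγ => kappaThree_eq_zero hγ)
    fun γ hγ => (mem_of_mem_Gamma0_three hT hV hneg γ hγ).2

end GWPotential

/-! ### Assembly of the theorem -/

open GWPotential Filter Topology in
theorem mainTheorem4 :
    -- absolute convergence of all the series
    (∀ τ : ℂ, 0 < τ.im →
      Summable (F2Term τ) ∧ Summable (F3Term τ) ∧
      (∀ z₁ z₂ : ℂ, 0 < z₂.im → z₂.im < τ.im → Summable (F2JTerm z₁ z₂ τ)) ∧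
      (∀ z₁ z₂ : ℂ, OffLattice z₂ τ → Summable (F2MerTerm z₁ z₂ τ)) ∧
      (∀ z : ℂ, Summable (thetaTerm z τ)) ∧
      (∀ (s : ℝ) (z : ℂ), 1 ≤ s → Summable (RTerm s z τ)) ∧
      (∀ z₁ z₂ : ℂ, Summable (F3JTerm z₁ z₂ τ)) ∧
      (∀ (s : ℝ) (z₁ z₂ : ℂ), 1 ≤ s → Summable (F3hatJTerm s z₁ z₂ τ))) ∧
    -- differentiability in the elliptic variables; the continuation of the Jacobi version of `F₂`
    (∀ τ : ℂ, 0 < τ.im →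
      (∀ z₁ z₂ : ℂ, 0 < z₂.im → z₂.im < τ.im → F2Mer z₁ z₂ τ = F2J z₁ z₂ τ) ∧
      (∀ p : ℂ × ℂ, OffLattice p.2 τ →
        DifferentiableAt ℂ (fun w : ℂ × ℂ => F2Mer w.1 w.2 τ) p) ∧
      (∀ p : ℂ × ℂ, DifferentiableAt ℂ (fun w : ℂ × ℂ => F3J w.1 w.2 τ) p) ∧
      (∀ (s : ℝ) (p : ℂ × ℂ), 1 ≤ s → OffLattice p.2 τ →
        DifferentiableAt ℝ (fun w : ℂ × ℂ => F2hatJ s w.1 w.2 τ) p) ∧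
      (∀ (s : ℝ) (p : ℂ × ℂ), 1 ≤ s →
        DifferentiableAt ℝ (fun w : ℂ × ℂ => F3hatJ s w.1 w.2 τ) p)) ∧
    -- `F₂` and `F₃` are derivatives of their Jacobi versions, specialized
    (∀ τ : ℂ, 0 < τ.im → F2 τ = specialize2 F2J τ ∧ F3 τ = specialize3 F3J τ) ∧
    -- Jacobi transformations of the completion of the Jacobi version of `F₂`
    (∀ (γ : SL(2, ℤ)) (z₁ z₂ : ℂ) (τ : ℍ), OffLattice z₂ τ →
      F2hatJ 1 (z₁ / ((γ 1 0 : ℂ) * τ + (γ 1 1 : ℂ))) (z₂ / ((γ 1 0 : ℂ) * τ + (γ 1 1 : ℂ)))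
          ((γ • τ : ℍ) : ℂ) =
        ((γ 1 0 : ℂ) * τ + (γ 1 1 : ℂ)) *
          Complex.exp (Real.pi * Complex.I * (γ 1 0 : ℂ) * (-3 * z₂ ^ 2 + 2 * z₁ * z₂) /
            ((γ 1 0 : ℂ) * τ + (γ 1 1 : ℂ))) *
          F2hatJ 1 z₁ z₂ τ) ∧
    (∀ (n₁ n₂ m₁ m₂ : ℤ) (z₁ z₂ : ℂ) (τ : ℍ), OffLattice z₂ τ →
      F2hatJ 1 (z₁ + n₁ * τ + m₁) (z₂ + n₂ * τ + m₂) τ =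
        (-1) ^ (n₂ + m₂) *
          e ((3 * n₂ - n₁) * z₂ - n₂ * z₁ + (3 * n₂ ^ 2 / 2 - n₁ * n₂) * τ) *
          F2hatJ 1 z₁ z₂ τ) ∧
    -- Jacobi transformations of the completion of the Jacobi version of `F₃`
    (∀ (n₁ n₂ m₁ m₂ : ℤ) (z₁ z₂ : ℂ) (τ : ℍ),
      F3hatJ 1 (z₁ + (6 * n₁ + 3 * n₂) * τ + m₁) (z₂ + (3 * n₁ + n₂) * τ + m₂) τ =
        e (-(n₁ * z₁ + n₂ * z₂) - (3 * n₁ ^ 2 + 3 * n₁ * n₂ + n₂ ^ 2 / 2) * τ) *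
          F3hatJ 1 z₁ z₂ τ) ∧
    (∀ (z₁ z₂ : ℂ) (τ : ℍ), F3hatJ 1 z₁ z₂ (τ + 1) = F3hatJ 1 z₁ (z₂ + 1 / 2) τ) ∧
    (∀ (z₁ z₂ : ℂ) (τ : ℍ),
      F3hatJ 1 (z₁ / τ) (z₂ / τ) (-1 / τ) =
        τ / (Real.sqrt 3 : ℂ) * ∑ k ∈ Finset.range 3,
          e ((-((z₁ + k * τ) ^ 2) / 6 + (z₁ + k * τ) * z₂ - z₂ ^ 2) / τ) *
            F3hatJ 1 (z₁ + k * τ) z₂ τ) ∧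
    -- the holomorphic parts of the completed Jacobi versions are the Jacobi versions
    (∀ z₁ z₂ τ : ℂ, 0 < τ.im → 0 < z₂.im → z₂.im < τ.im →
      1 / 6 < (3 * z₂.im - z₁.im) / (3 * τ.im) → (3 * z₂.im - z₁.im) / (3 * τ.im) < 1 / 2 →
      Tendsto (fun s : ℝ => F2hatJ s z₁ z₂ τ) atTop (𝓝 (F2J z₁ z₂ τ))) ∧
    (∀ z₁ z₂ τ : ℂ, 0 < τ.im →
      0 < (3 * z₂.im - z₁.im) / (3 * τ.im) → (3 * z₂.im - z₁.im) / (3 * τ.im) < 1 →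
      0 < (z₁.im - 2 * z₂.im) / τ.im → (z₁.im - 2 * z₂.im) / τ.im < 1 →
      Tendsto (fun s : ℝ => F3hatJ s z₁ z₂ τ) atTop (𝓝 (F3J z₁ z₂ τ))) ∧
    -- `F̂₂` and `F̂₃` have holomorphic parts `F₂` and `F₃`
    (∀ τ : ℂ, 0 < τ.im →
      Tendsto (fun s : ℝ => F2hat s τ) atTop (𝓝 (F2 τ)) ∧
      Tendsto (fun s : ℝ => F3hat s τ) atTop (𝓝 (F3 τ))) ∧
    -- and they are modular of weight `2`, up to the usual fractional powers of `q`
    TransformsWeightTwo 4 4 (fun τ => e (-(5 / 4) * τ) * F2hat 1 τ) ∧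
    TransformsWeightTwo 3 12 (fun τ => e (-(1 / 4) * τ) * F3hat 1 τ) := by
  refine ⟨fun τ hτ => ⟨summable_F2Term hτ, summable_F3Term hτ,
      fun z₁ z₂ h1 h2 => summable_F2JTerm h1 h2, fun z₁ z₂ h => summable_F2MerTerm hτ z₁ h,
      summable_thetaTerm hτ, fun s z hs => summable_RTerm hs hτ z, summable_F3JTerm hτ,
      fun s z₁ z₂ hs => summable_F3hatJTerm hs hτ z₁ z₂⟩,
    fun τ hτ => ⟨fun z₁ z₂ h1 h2 => F2Mer_eq_F2J h1 h2,
      fun p h => differentiableAt_F2Mer hτ h, fun p => (hasFDerivAt_F3J hτ p).differentiableAt,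
      fun s p hs h => differentiableAt_F2hatJ hs hτ h,
      fun s p hs => differentiableAt_F3hatJ hs hτ p⟩,
    fun τ hτ => ⟨F2_eq_specialize hτ, F3_eq_specialize hτ⟩,
    fun γ z₁ z₂ τ h => ?_,
    fun n₁ n₂ m₁ m₂ z₁ z₂ τ h => F2hatJ_elliptic τ.im_pos n₁ n₂ m₁ m₂ z₁ h,
    fun n₁ n₂ m₁ m₂ z₁ z₂ τ => F3hatJ_elliptic 1 τ.im_pos n₁ n₂ m₁ m₂ z₁ z₂,
    fun z₁ z₂ τ => F3hatJ_add_one 1 z₁ z₂ τ, fun z₁ z₂ τ => ?_,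
    fun z₁ z₂ τ _ hy hy' h0 h1 => tendsto_F2hatJ hy hy' h0 h1,
    fun z₁ z₂ τ hτ h0 h1 h2 h3 => tendsto_F3hatJ hτ h0 h1 h2 h3,
    fun τ hτ => ⟨tendsto_F2hat hτ, tendsto_F3hat hτ⟩,
    transformsWeightTwo_F2hat, transformsWeightTwo_F3hat⟩
  · have h1 := jacobiLaw γ z₁ z₂ τ h
    rw [autj] at h1
    rw [h1, ← mul_assoc]
    congr 2
    rw [e]
    congr 1
    rw [Q2]
    ring
  · rw [F3hatJ_neg_inv τ.im_pos, Finset.sum_range]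
    refine congrArg _ (Finset.sum_congr rfl fun k _ => ?_)
    rw [Q3]
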